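/- Let $n=2$ or $n=3$, let $\nu$ be a Haar measure on $\mathrm{GL}_n(\mathbb R)$, and let $\mu$ be the measure it induces on the space of lattices $\mathrm{GL}_n(\mathbb R)/\mathrm{GL}_n(\mathbb Z)$, that is, $\int_{\mathrm{GL}_n(\mathbb R)/\mathrm{GL}_n(\mathbb Z)} f\,d\mu=\int_{\mathcal F} f(X\cdot\mathrm{GL}_n(\mathbb Z))\,d\nu(X)$ for a fundamental domain $\mathcal F$ of the right action of $\mathrm{GL}_n(\mathbb Z)$ on $\mathrm{GL}_n(\mathbb R)$. Let $\Omega$ be the closed Euclidean unit ball in $\mathbb R^n$ and, for $X\in \mathrm{GL}_n(\mathbb R)$ and $t>0$, put $\Omega_X=X^{-1}\Omega$ and $$E_X(t)=\#\bigl(X\mathbb Z^n\cap t\Omega\bigr)-\mathrm{vol}(t\Omega_X),$$ which depends only on $t$ and the class of $X$ in $\mathrm{GL}_n(\mathbb R)/\mathrm{GL}_n(\mathbb Z)$. Let $L_0$ be a compact subset of $\mathrm{GL}_n(\mathbb R)/\mathrm{GL}_n(\mathbb Z)$. Then $X\mapsto |E_X(t)|^2$ is $\mu$-integrable on $L_0$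 for every $t>0$, and there is an integer $m>0$ such that $$\Bigl(\int_{L_0}|E_X(t)|^2\,d\mu(X)\Bigr)^{1/2}=O\bigl(t^{(n-1)/2}(\log t)^m\bigr)\qquad\text{as } t\to\infty .$$ -/

import Mathlib

namespace RandomLattice

open Matrix MeasureTheory Set Filter Topology Asymptotics
open scoped Pointwise

/-- `GL_n(ℝ)` (with Mathlib's topology) carries its Borel `σ`-algebra. -/
instance instMeasurableSpaceGL (n : ℕ) : MeasurableSpace (GL (Fin n) ℝ) := borel _

instance instBorelSpaceGL (n : ℕ) : BorelSpace (GL (Fin n) ℝ) := ⟨rfl⟩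

/-- `GL_n(ℤ)` as a subgroup of `GL_n(ℝ)`. -/
def glInt (n : ℕ) : Subgroup (GL (Fin n) ℝ) :=
  (Matrix.GeneralLinearGroup.map (n := Fin n) (Int.castRingHom ℝ)).range

/-- The space of lattices `GL_n(ℝ) / GL_n(ℤ)`, with the quotient topology and the quotient
`σ`-algebra (a set is measurable iff its preimage in `GL_n(ℝ)` is Borel). -/
abbrev LatticeSpace (n : ℕ) : Type := GL (Fin n) ℝ ⧸ glInt n

section FundamentalDomain

instance instCountableGLInt (n : ℕ) : Countable (glInt n) := by
  have : Countable (GL (Fin n) ℤ) :=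
    Function.Injective.countable (f := fun g : GL (Fin n) ℤ => (fun i j => g.1 i j))
      (fun a b h => Units.ext h)
  exact (Set.countable_range _).to_subtype

instance instSecondCountableGL (n : ℕ) : SecondCountableTopology (GL (Fin n) ℝ) := by
  have : SecondCountableTopology (Matrix (Fin n) (Fin n) ℝ) :=
    inferInstanceAs (SecondCountableTopology (Fin n → Fin n → ℝ))
  have : SecondCountableTopology (Matrix (Fin n) (Fin n) ℝ)ᵐᵒᵖ :=
    MulOpposite.opHomeomorph.symm.isInducing.secondCountableTopology
  exact (Units.isEmbedding_embedProduct).isInducing.secondCountableTopology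

theorem exists_open_glInt (n : ℕ) :
    ∃ U : Set (GL (Fin n) ℝ), IsOpen U ∧ 1 ∈ U ∧ ∀ γ ∈ glInt n, γ ∈ U → γ = 1 := by
  have he := (Int.isClosedEmbedding_coe_real.isEmbedding).generalLinearGroup_map
    (n := Fin n) (f := Int.castRingHom ℝ)
  have : DiscreteTopology (Matrix (Fin n) (Fin n) ℤ)ᵐᵒᵖ :=
    MulOpposite.opHomeomorph.symm.isEmbedding.discreteTopology
  have : DiscreteTopology (GL (Fin n) ℤ) :=
    Units.isEmbedding_embedProduct.discreteTopology
  obtain ⟨U, hU, h⟩ := he.isInducing.isOpen_iff.1 (isOpen_discrete ({1} : Set (GL (Fin n) ℤ)))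
  refine ⟨U, hU, ?_, ?_⟩
  · have : (1 : GL (Fin n) ℤ) ∈ Matrix.GeneralLinearGroup.map (Int.castRingHom ℝ) ⁻¹' U := by
      rw [h]; rfl
    simpa using this
  · rintro _ ⟨g, rfl⟩ hg
    have : g ∈ Matrix.GeneralLinearGroup.map (Int.castRingHom ℝ) ⁻¹' U := hg
    rw [h] at this
    rw [Set.mem_singleton_iff.1 this, map_one]

/-- There is a Borel set meeting every coset `X · GL_n(ℤ)` in exactly one point. -/
theorem exists_fundamentalDomain (n : ℕ) :
    ∃ F : Set (GL (Fin n) ℝ), MeasurableSet F ∧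
      ∀ X : GL (Fin n) ℝ, ∃! γ : glInt n, X * (γ : GL (Fin n) ℝ) ∈ F := by
  obtain ⟨U, hU, h1, hγ⟩ := exists_open_glInt n
  obtain ⟨V, hV, hV1, hVU⟩ : ∃ V : Set (GL (Fin n) ℝ), IsOpen V ∧ 1 ∈ V ∧
      ∀ a ∈ V, ∀ b ∈ V, a⁻¹ * b ∈ U := by
    have hc : Continuous fun p : GL (Fin n) ℝ × GL (Fin n) ℝ => p.1⁻¹ * p.2 := by fun_prop
    have hn : (fun p : GL (Fin n) ℝ × GL (Fin n) ℝ => p.1⁻¹ * p.2) ⁻¹' U ∈ 𝓝 (1, 1) :=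
      (hU.preimage hc).mem_nhds (by simpa using h1)
    rw [nhds_prod_eq, Filter.mem_prod_self_iff] at hn
    obtain ⟨t, ht, hts⟩ := hn
    obtain ⟨V, hVt, hVo, hV1⟩ := mem_nhds_iff.1 ht
    exact ⟨V, hVo, hV1, fun a ha b hb => hts (Set.mk_mem_prod (hVt ha) (hVt hb))⟩
  obtain ⟨s, hs, hsU⟩ := TopologicalSpace.countable_cover_nhds
    (f := fun x : GL (Fin n) ℝ => (fun y => x⁻¹ * y) ⁻¹' V)
    (fun x => (hV.preimage (by fun_prop)).mem_nhds (by simpa using hV1))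
  have hne : s.Nonempty := by
    by_contra h
    rw [Set.not_nonempty_iff_eq_empty] at h
    have h1 := Set.mem_univ (1 : GL (Fin n) ℝ)
    rw [← hsU, h] at h1
    simp at h1
  obtain ⟨c, rfl⟩ := hs.exists_eq_range hne
  let W : ℕ → Set (GL (Fin n) ℝ) := fun i => (fun y => (c i)⁻¹ * y) ⁻¹' V
  have hWo : ∀ i, IsOpen (W i) := fun i => hV.preimage (by fun_prop)
  have hWinj : ∀ i x (γ γ' : glInt n), x * (γ : GL (Fin n) ℝ) ∈ W i →
      x * (γ' : GL (Fin n) ℝ) ∈ W i → γ = γ' := by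
    intro i x γ γ' h h'
    have := hγ _ (γ⁻¹ * γ').2 (by
      have := hVU _ h _ h'
      simpa [mul_assoc] using this)
    exact (inv_mul_eq_one.1 (Subtype.ext this))
  let S : ℕ → Set (GL (Fin n) ℝ) := fun i => ⋃ γ : glInt n, (fun y => y * (γ : GL (Fin n) ℝ)) ⁻¹' W i
  have hSo : ∀ i, IsOpen (S i) := fun i =>
    isOpen_iUnion fun γ => (hWo i).preimage (by fun_prop)
  have hSinv : ∀ i x (γ : glInt n), x * (γ : GL (Fin n) ℝ) ∈ S i ↔ x ∈ S i := by
    intro i x γ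
    simp only [S, Set.mem_iUnion, Set.mem_preimage]
    constructor
    · rintro ⟨δ, h⟩
      exact ⟨γ * δ, by simpa [mul_assoc] using h⟩
    · rintro ⟨δ, h⟩
      exact ⟨γ⁻¹ * δ, by simpa [mul_assoc] using h⟩
  have hWS : ∀ i, W i ⊆ S i := fun i x hx => Set.mem_iUnion.2 ⟨1, by simpa using hx⟩
  refine ⟨⋃ i, (W i \ ⋃ j ∈ Finset.range i, S j), ?_, ?_⟩
  · refine MeasurableSet.iUnion fun i => (hWo i).measurableSet.diff ?_
    exact Finset.measurableSet_biUnion _ fun j _ => (hSo j).measurableSet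
  · intro x
    have hex : ∃ i, x ∈ S i := by
      have : x ∈ ⋃ y ∈ Set.range c, (fun z => y⁻¹ * z) ⁻¹' V := hsU ▸ Set.mem_univ x
      simp only [Set.mem_iUnion, Set.mem_range, exists_prop, exists_exists_eq_and] at this
      obtain ⟨i, hi⟩ := this
      exact ⟨i, hWS i hi⟩
    classical
    obtain ⟨γ, hγx⟩ := Set.mem_iUnion.1 (Nat.find_spec hex)
    refine ⟨γ, ?_, ?_⟩
    · refine Set.mem_iUnion.2 ⟨Nat.find hex, hγx, ?_⟩
      simp only [Set.mem_iUnion, not_exists, Finset.mem_range]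
      intro j hj h
      exact Nat.find_min hex hj ((hSinv j x γ).1 h)
    · intro δ hδ
      obtain ⟨i, hi, hi'⟩ := Set.mem_iUnion.1 hδ
      have hii : i = Nat.find hex := by
        refine le_antisymm ?_ (Nat.find_min' hex ((hSinv i x δ).1 (hWS i hi)))
        by_contra hlt
        push Not at hlt
        refine hi' ?_
        simp only [Set.mem_iUnion, Finset.mem_range]
        exact ⟨_, hlt, (hSinv _ x δ).2 (Nat.find_spec hex)⟩
      subst hii
      exact hWinj _ x _ _ hi hγx

end FundamentalDomain

/-- A Borel fundamental domain for the right multiplication action of `GL_n(ℤ)` on `GL_n(ℝ)`. -/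
noncomputable def fundamentalDomain (n : ℕ) : Set (GL (Fin n) ℝ) :=
  (exists_fundamentalDomain n).choose

theorem isFundamentalDomain (n : ℕ) (ν : Measure (GL (Fin n) ℝ)) :
    IsFundamentalDomain (glInt n).op (fundamentalDomain n) ν := by
  obtain ⟨hm, hu⟩ := (exists_fundamentalDomain n).choose_spec
  refine IsFundamentalDomain.mk' hm.nullMeasurableSet fun X => ?_
  obtain ⟨γ, hγ, huniq⟩ := hu X
  refine ⟨⟨MulOpposite.op γ, γ.2⟩, hγ, ?_⟩
  rintro ⟨δ, hδ⟩ h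
  have := huniq ⟨δ.unop, hδ⟩ h
  apply Subtype.ext
  apply MulOpposite.unop_injective
  exact congrArg Subtype.val this

/-- The measure on `GL_n(ℝ) / GL_n(ℤ)` induced by a measure `ν` on `GL_n(ℝ)`: integration over
the quotient is integration over a fundamental domain with respect to `ν`. When `ν` is a Haar
measure, which is bi-invariant, it does not depend on the fundamental domain. -/
noncomputable def inducedMeasure {n : ℕ} (ν : Measure (GL (Fin n) ℝ)) :
    Measure (LatticeSpace n) :=
  (ν.restrict (fundamentalDomain n)).map (QuotientGroup.mk : GL (Fin n) ℝ → LatticeSpace n)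

/-- The induced measure may be computed with any fundamental domain. -/
theorem inducedMeasure_eq {n : ℕ} (ν : Measure (GL (Fin n) ℝ)) [ν.IsMulRightInvariant]
    {F : Set (GL (Fin n) ℝ)} (hF : IsFundamentalDomain (glInt n).op F ν) :
    inducedMeasure ν =
      (ν.restrict F).map (QuotientGroup.mk : GL (Fin n) ℝ → LatticeSpace n) := by
  ext A hA
  have hmk : Measurable (QuotientGroup.mk : GL (Fin n) ℝ → LatticeSpace n) :=
    measurable_from_quotient.1 measurable_id
  rw [inducedMeasure, Measure.map_apply hmk hA, Measure.map_apply hmk hA,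
    Measure.restrict_apply (hmk hA), Measure.restrict_apply (hmk hA)]
  refine (isFundamentalDomain n ν).measure_set_eq hF (hmk hA) ?_
  rintro ⟨γ, hγ⟩
  ext X
  simp only [Set.mem_preimage]
  have : (QuotientGroup.mk (X * γ.unop) : LatticeSpace n) = QuotientGroup.mk X :=
    QuotientGroup.mk_mul_of_mem X hγ
  exact iff_of_eq (congrArg (· ∈ A) this)

/-- The closed unit ball `Ω` of Euclidean `ℝⁿ`. -/
def unitBall (n : ℕ) : Set (EuclideanSpace ℝ (Fin n)) := Metric.closedBall 0 1

/-- The linear action of a matrix `X` on Euclidean `ℝⁿ`. -/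
noncomputable def act {n : ℕ} (X : GL (Fin n) ℝ) :
    EuclideanSpace ℝ (Fin n) →ₗ[ℝ] EuclideanSpace ℝ (Fin n) :=
  Matrix.toEuclideanLin (X : Matrix (Fin n) (Fin n) ℝ)

/-- The set `ℤⁿ` of integer points of `ℝⁿ`. -/
def intPoints (n : ℕ) : Set (EuclideanSpace ℝ (Fin n)) :=
  {v | ∃ k : Fin n → ℤ, ∀ i, v i = (k i : ℝ)}

/-- The lattice `X ℤⁿ`. -/
def latticeSet {n : ℕ} (X : GL (Fin n) ℝ) : Set (EuclideanSpace ℝ (Fin n)) :=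
  act X '' intPoints n

/-- The ellipsoid `Ω_X = X⁻¹ Ω`. -/
def ellipsoid {n : ℕ} (X : GL (Fin n) ℝ) : Set (EuclideanSpace ℝ (Fin n)) :=
  act X⁻¹ '' unitBall n

/-- `N_X(t) = #(X ℤⁿ ∩ t Ω)`. -/
noncomputable def latticeCount {n : ℕ} (X : GL (Fin n) ℝ) (t : ℝ) : ℕ :=
  (latticeSet X ∩ t • unitBall n).ncard

/-- `E_X(t) = N_X(t) - vol (t Ω_X)`, for a matrix `X`. -/
noncomputable def remainderGL {n : ℕ} (X : GL (Fin n) ℝ) (t : ℝ) : ℝ :=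
  (latticeCount X t : ℝ) - (volume (t • ellipsoid X)).toReal

theorem act_mul {n : ℕ} (X Y : GL (Fin n) ℝ) (v : EuclideanSpace ℝ (Fin n)) :
    act (X * Y) v = act X (act Y v) := by
  simp [act, Matrix.toLpLin_apply]

theorem act_glInt_intPoints {n : ℕ} {γ : GL (Fin n) ℝ} (hγ : γ ∈ glInt n) :
    act γ '' intPoints n ⊆ intPoints n := by
  obtain ⟨g, rfl⟩ := hγ
  rintro _ ⟨v, ⟨k, hk⟩, rfl⟩
  refine ⟨(g : Matrix (Fin n) (Fin n) ℤ) *ᵥ k, fun i => ?_⟩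
  simp [act, Matrix.toLpLin_apply, Matrix.mulVec, dotProduct, hk]

theorem latticeSet_mul {n : ℕ} (X : GL (Fin n) ℝ) {γ : GL (Fin n) ℝ} (hγ : γ ∈ glInt n) :
    latticeSet (X * γ) = latticeSet X := by
  have key : ∀ (Y : GL (Fin n) ℝ) {δ : GL (Fin n) ℝ}, δ ∈ glInt n →
      latticeSet (Y * δ) ⊆ latticeSet Y := by
    rintro Y δ hδ _ ⟨v, hv, rfl⟩
    exact ⟨act δ v, act_glInt_intPoints hδ ⟨v, hv, rfl⟩, (act_mul Y δ v).symm⟩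
  refine (key X hγ).antisymm ?_
  have := key (X * γ) (inv_mem hγ)
  rwa [mul_inv_cancel_right] at this

theorem volume_ellipsoid {n : ℕ} (X : GL (Fin n) ℝ) (t : ℝ) :
    volume (t • ellipsoid X) =
      ENNReal.ofReal |t ^ n| * (ENNReal.ofReal |(X⁻¹).1.det| * volume (unitBall n)) := by
  have hdet : LinearMap.det (act X⁻¹) = (X⁻¹).1.det := by
    rw [act, Matrix.toEuclideanLin, Matrix.toLpLin_eq_toLin, LinearMap.det_toLin]
  rw [ellipsoid, Measure.addHaar_smul, Measure.addHaar_image_linearMap, hdet,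
    finrank_euclideanSpace_fin]

theorem abs_det_glInt {n : ℕ} {γ : GL (Fin n) ℝ} (hγ : γ ∈ glInt n) : |γ.1.det| = 1 := by
  obtain ⟨g, rfl⟩ := hγ
  have h : IsUnit (g : Matrix (Fin n) (Fin n) ℤ).det := (Matrix.isUnit_iff_isUnit_det _).1 g.isUnit
  have h2 : |(g : Matrix (Fin n) (Fin n) ℤ).det| = 1 := Int.isUnit_iff_abs_eq.1 h
  have h3 : (Matrix.GeneralLinearGroup.map (Int.castRingHom ℝ) g).1.det
      = ((g : Matrix (Fin n) (Fin n) ℤ).det : ℝ) := by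
    exact ((Int.castRingHom ℝ).map_det _).symm
  rw [h3, ← Int.cast_abs, h2, Int.cast_one]

theorem remainderGL_mul {n : ℕ} (X : GL (Fin n) ℝ) {γ : GL (Fin n) ℝ} (hγ : γ ∈ glInt n)
    (t : ℝ) : remainderGL (X * γ) t = remainderGL X t := by
  have h : |((X * γ)⁻¹).1.det| = |(X⁻¹).1.det| := by
    rw [_root_.mul_inv_rev, Units.val_mul, Matrix.det_mul, abs_mul, abs_det_glInt (inv_mem hγ), one_mul]
  rw [remainderGL, remainderGL, latticeCount, latticeCount, latticeSet_mul X hγ,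
    volume_ellipsoid, volume_ellipsoid, h]

/-- `E_X(t)` as a function of the class of `X` in `GL_n(ℝ) / GL_n(ℤ)`. -/
noncomputable def remainder {n : ℕ} (t : ℝ) : LatticeSpace n → ℝ :=
  Quotient.lift (fun X : GL (Fin n) ℝ => remainderGL X t) (by
    intro X Y h
    have h' : X⁻¹ * Y ∈ glInt n := QuotientGroup.leftRel_apply.1 h
    have := remainderGL_mul X h' t
    rw [mul_inv_cancel_left] at this
    exact this.symm)

end RandomLattice

/-!
The remainder is studied on a small neighbourhood `U` of a matrix in `GL_n(ℝ)`; compactness of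
`L₀` and the fact that the induced measure sees each lattice once reduce the theorem to such
neighbourhoods (`meanSquare_of_local`).

The indicator of the ball of radius `t` lies between the indicators of the balls of radii `t ± δ`
mollified at scale `δ = 1/t`. Poisson summation for a mollified ball and the lattice of `X`
(`tsum_smoothBall`) gives the volume as the term of frequency zero, and a sum of coefficients
`c(Yk)` over the nonzero `k ∈ ℤⁿ`, where `Y = X⁻ᵀ`. So the remainder is bounded by the two dual sums
and the difference of the volumes, of order `t^{n-2} ≤ t^{(n-1)/2}` for `n ≤ 3`
(`abs_remainderGL_le`). The coefficients `c(ξ)` are of size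
`t^{(n-1)/2} |ξ|^{-(n+1)/2} (1 + |ξ|/t)^{-4}` and oscillate like `e^{2πit|ξ|}` with slowly
varying amplitude, by the asymptotics of Bessel functions (`exists_amplitude`,
`exists_ray_amplitude`).

When the square of the dual sum is integrated over `Y` against a smooth weight, the products
`c(Yk) c(Yl)` have to be estimated. The terms `l = ±k` are bounded trivially. For `l ≠ ±k` the Haar
measure is invariant under `Y ↦ Y (1 + sD)`, where `D` is either a rank one matrix killing `k` with
eigenvector `l`, or the identity (`exists_direction`). Along these the phases `|Yk| ± |Yl|` are
linear in `s`, and one of the two choices of `D` makes the slope at least a multiple of `|k - l|`;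
integrating by parts in `s` gains a factor `1 / (t |k - l|)`, or `1 / (t |k + l|)` at an obtuse angle
(`abs_integral_correlation_le_div`). That the measure `ν` carried over by `X ↦ X⁻ᵀ` is invariant
under these right translations is the unimodularity of `GL_n(ℝ)` (`isMulRightInvariant_GL`).

With this gain the double sum over `k` and `l` is `O(t^{n-1})` times powers of
`Λ = ∑ (|k| (1 + |k|/t))^{-n} = O((log t)^n)` (`sum_sum_coeffSize_mul_gain_le`), so the mean square
of the remainder is `O(t^{n-1} (log t)^{2n})` and the exponent `m = n` works.
-/

namespace RandomLattice

open Matrix MeasureTheory Set Filter Topology Asymptotics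
open scoped Pointwise NNReal ENNReal FourierTransform

/-! ### Unimodularity of `GL_n(ℝ)` -/

instance instLocallyCompactSpaceGL (n : ℕ) : LocallyCompactSpace (GL (Fin n) ℝ) := by
  have : LocallyCompactSpace (Matrix (Fin n) (Fin n) ℝ) :=
    inferInstanceAs (LocallyCompactSpace (Fin n → Fin n → ℝ))
  have : T1Space (Matrix (Fin n) (Fin n) ℝ) := inferInstanceAs (T1Space (Fin n → Fin n → ℝ))
  infer_instance

/-- Diagonal matrices with invertible entries, as a homomorphism into `GL_n(ℝ)`. -/
noncomputable def diagGL (n : ℕ) : (Fin n → ℝˣ) →* GL (Fin n) ℝ :=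
  (Units.map (Matrix.diagonalRingHom (Fin n) ℝ).toMonoidHom).comp
    (MulEquiv.piUnits (M := fun _ : Fin n => ℝ)).symm.toMonoidHom

theorem val_diagGL {n : ℕ} (d : Fin n → ℝˣ) :
    (diagGL n d).1 = Matrix.diagonal fun i => (d i : ℝ) := rfl

theorem diagGL_comp_perm {n : ℕ} (φ : GL (Fin n) ℝ →* ℝ≥0) (d : Fin n → ℝˣ)
    (σ : Equiv.Perm (Fin n)) : φ (diagGL n (d ∘ σ)) = φ (diagGL n d) := by
  have hdet : (σ.permMatrix ℝ).det ≠ 0 := by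
    rw [Matrix.det_permutation]
    exact_mod_cast Units.ne_zero _
  let P : GL (Fin n) ℝ := Matrix.GeneralLinearGroup.mkOfDetNeZero _ hdet
  have h : diagGL n (d ∘ σ) * P = P * diagGL n d := by
    apply Units.ext
    ext i j
    simp only [Units.val_mul, val_diagGL]
    change (Matrix.diagonal (fun i => ((d (σ i) : ℝˣ) : ℝ)) * σ.permMatrix ℝ) i j
      = (σ.permMatrix ℝ * Matrix.diagonal fun i => ((d i : ℝˣ) : ℝ)) i j
    rw [Matrix.diagonal_mul, Matrix.mul_diagonal]
    by_cases hij : σ i = j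
    · subst hij; ring
    · simp [Equiv.Perm.permMatrix, PEquiv.toMatrix_apply, hij]
  have h2 := congrArg φ h
  rw [map_mul, map_mul, mul_comm] at h2
  have hP : φ P ≠ 0 := (IsUnit.map φ (Group.isUnit P)).ne_zero
  exact mul_left_cancel₀ hP h2

/-- A homomorphism from `GL_n(ℝ)` to the positive reals that is trivial on scalar matrices is
trivial: it kills transvections, which are commutators, and takes the same value on the matrices
`diag(1, …, u, …, 1)`, whose product is scalar. -/
theorem map_eq_one_of_scalar {n : ℕ} (φ : GL (Fin n) ℝ →* ℝ≥0)
    (hφ : ∀ u : ℝˣ, φ (diagGL n fun _ => u) = 1) (g : GL (Fin n) ℝ) : φ g = 1 := by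
  have hsingle : ∀ (i : Fin n) (u : ℝˣ), φ (diagGL n (Pi.mulSingle i u)) = 1 := by
    intro i u
    have hall : ∀ j, (φ.comp (diagGL n)) (Pi.mulSingle j u) = φ (diagGL n (Pi.mulSingle i u)) := by
      intro j
      rw [MonoidHom.comp_apply]
      rw [← diagGL_comp_perm φ (Pi.mulSingle i u) (Equiv.swap i j)]
      congr 2
      ext k
      by_cases hk : k = j
      · subst hk; simp
      · have : Equiv.swap i j k ≠ i := by
          rw [Ne, Equiv.swap_apply_eq_iff]; simpa using hk
        simp [Pi.mulSingle_eq_of_ne hk, Pi.mulSingle_eq_of_ne this]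
    have h1 := hφ u
    have h2 : (fun _ => u : Fin n → ℝˣ) = ∏ j, Pi.mulSingle j u :=
      (Finset.univ_prod_mulSingle (fun _ : Fin n => u)).symm
    change (φ.comp (diagGL n)) _ = 1 at h1
    rw [h2, map_prod, Finset.prod_congr rfl fun j _ => hall j, Finset.prod_const,
      Finset.card_univ, Fintype.card_fin] at h1
    exact (pow_eq_one_iff_of_nonneg (zero_le) (by have := i.2; omega)).1 h1
  have hdiag : ∀ d : Fin n → ℝˣ, φ (diagGL n d) = 1 := by
    intro d
    change (φ.comp (diagGL n)) d = 1
    rw [← Finset.univ_prod_mulSingle d, map_prod]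
    exact Finset.prod_eq_one fun i _ => hsingle i _
  have key : ∀ M : Matrix (Fin n) (Fin n) ℝ, M.det ≠ 0 →
      ∀ g : GL (Fin n) ℝ, g.1 = M → φ g = 1 := by
    intro M hM
    refine Matrix.diagonal_transvection_induction_of_det_ne_zero
      (fun M => ∀ g : GL (Fin n) ℝ, g.1 = M → φ g = 1) M hM ?_ ?_ ?_
    · intro D hD g hg
      have hne : ∀ i, D i ≠ 0 := by
        rw [Matrix.det_diagonal, Finset.prod_ne_zero_iff] at hD
        exact fun i => hD i (Finset.mem_univ i)
      have : g = diagGL n fun i => Units.mk0 (D i) (hne i) := Units.ext (by rw [hg]; rfl)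
      rw [this, hdiag]
    · rintro ⟨i, j, hij, c⟩ g hg
      let e : GL (Fin n) ℝ := diagGL n (Pi.mulSingle i (Units.mk0 2 two_ne_zero))
      -- conjugating by `diag(1, …, 2, …, 1)` squares the transvection
      have h : e * g = g * g * e := by
        apply Units.ext
        simp only [Units.val_mul, hg, TransvectionStruct.toMatrix]
        rw [Matrix.transvection_mul_transvection_same _ _ hij, val_diagGL]
        ext a b
        rw [Matrix.diagonal_mul, Matrix.mul_diagonal]
        simp only [transvection, Matrix.add_apply, Matrix.single_apply, Matrix.one_apply]
        by_cases ha : a = i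
        · subst ha
          by_cases hb : b = j
          · subst hb
            simp [hij]; ring
          · by_cases hab : a = b
            · subst hab; simp [Ne.symm hij]
            · simp [hab, Ne.symm hb]
        · by_cases hab : a = b
          · subst hab; simp [Ne.symm ha]
          · simp [hab, Ne.symm ha]
      have h2 := congrArg φ h
      rw [map_mul, map_mul, map_mul, mul_comm] at h2
      have he : φ e ≠ 0 := (IsUnit.map φ (Group.isUnit e)).ne_zero
      have hg' : φ g ≠ 0 := (IsUnit.map φ (Group.isUnit g)).ne_zero
      have h3 := mul_right_cancel₀ he h2
      exact (mul_eq_left₀ hg').1 h3.symm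
    · intro A B hA hB hPA hPB g hg
      have h1 := hPA (Matrix.GeneralLinearGroup.mkOfDetNeZero A hA) rfl
      have h2 := hPB (Matrix.GeneralLinearGroup.mkOfDetNeZero B hB) rfl
      have : g = Matrix.GeneralLinearGroup.mkOfDetNeZero A hA *
          Matrix.GeneralLinearGroup.mkOfDetNeZero B hB := Units.ext hg
      rw [this, map_mul, h1, h2, one_mul]
  exact key g.1 (by
    have := (Matrix.isUnit_iff_isUnit_det _).1 g.isUnit
    exact this.ne_zero) g rfl

/-- `GL_n(ℝ)` is unimodular: its modular character is trivial on the scalar matrices, which are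
central. -/
theorem isMulRightInvariant_GL {n : ℕ} (ν : Measure (GL (Fin n) ℝ)) [ν.IsHaarMeasure] :
    ν.IsMulRightInvariant := by
  have hΔ : ∀ g : GL (Fin n) ℝ, Measure.modularCharacter g = 1 := by
    refine map_eq_one_of_scalar _ fun u => ?_
    change Measure.modularCharacterFun _ = 1
    have hc : (fun g : GL (Fin n) ℝ => g * diagGL n fun _ => u) =
        fun g => (diagGL n fun _ => u) * g := by
      funext g
      apply Units.ext
      simp only [Units.val_mul, val_diagGL]
      ext i j
      rw [Matrix.diagonal_mul, Matrix.mul_diagonal, mul_comm]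
    have hm : ν.map (fun g => g * diagGL n fun _ => u) = ν := by
      rw [hc, map_mul_left_eq_self]
    have hs : ∀ (μ : Measure (GL (Fin n) ℝ)) [μ.IsHaarMeasure], μ = ν →
        Measure.haarScalarFactor μ ν = 1 := by
      rintro μ _ rfl
      exact Measure.haarScalarFactor_self μ
    rw [Measure.modularCharacterFun_eq_haarScalarFactor ν]
    exact hs _ hm
  refine ⟨fun g => ?_⟩
  rw [Measure.map_right_mul_eq_modularCharacterFun_smul ν g]
  have : Measure.modularCharacterFun g = 1 := hΔ g
  rw [this, one_smul]

/-! ### Counting lattice points by integer vectors -/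

/-- The inclusion of `ℤⁿ` into Euclidean `ℝⁿ`. -/
noncomputable def intVec {n : ℕ} (k : Fin n → ℤ) : EuclideanSpace ℝ (Fin n) :=
  WithLp.toLp 2 fun i => (k i : ℝ)

theorem intVec_apply {n : ℕ} (k : Fin n → ℤ) (i : Fin n) : intVec k i = (k i : ℝ) := rfl

theorem intVec_injective {n : ℕ} : Function.Injective (intVec (n := n)) := by
  intro k l h
  funext i
  have h' : (k i : ℝ) = l i := congrArg (fun v : EuclideanSpace ℝ (Fin n) => v i) h
  exact_mod_cast h'

theorem act_inv_act {n : ℕ} (X : GL (Fin n) ℝ) (v : EuclideanSpace ℝ (Fin n)) :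
    act X⁻¹ (act X v) = v := by
  rw [← act_mul, inv_mul_cancel]
  simp [act]

theorem act_injective {n : ℕ} (X : GL (Fin n) ℝ) : Function.Injective (act X) :=
  Function.LeftInverse.injective (act_inv_act X)

theorem intPoints_eq_range (n : ℕ) : intPoints n = Set.range (intVec (n := n)) := by
  ext v
  constructor
  · rintro ⟨k, hk⟩
    exact ⟨k, by ext i; exact (hk i).symm⟩
  · rintro ⟨k, rfl⟩
    exact ⟨k, fun i => rfl⟩

theorem smul_unitBall {n : ℕ} {t : ℝ} (ht : 0 < t) :
    t • unitBall n = Metric.closedBall (0 : EuclideanSpace ℝ (Fin n)) t := by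
  rw [unitBall, smul_unitClosedBall, Real.norm_of_nonneg ht.le]

theorem latticeCount_eq {n : ℕ} (X : GL (Fin n) ℝ) {t : ℝ} (ht : 0 < t) :
    latticeCount X t = {k : Fin n → ℤ | ‖act X (intVec k)‖ ≤ t}.ncard := by
  have : latticeSet X ∩ t • unitBall n =
      (fun k => act X (intVec k)) '' {k : Fin n → ℤ | ‖act X (intVec k)‖ ≤ t} := by
    rw [smul_unitBall ht, latticeSet, intPoints_eq_range]
    ext v
    simp only [mem_inter_iff, mem_image, mem_range, Metric.mem_closedBall, dist_zero_right,
      mem_ofPred_eq]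
    constructor
    · rintro ⟨⟨_, ⟨k, rfl⟩, rfl⟩, h⟩
      exact ⟨k, h, rfl⟩
    · rintro ⟨k, h, rfl⟩
      exact ⟨⟨_, ⟨k, rfl⟩, rfl⟩, h⟩
  rw [latticeCount, this, ncard_image_of_injective]
  exact (act_injective X).comp intVec_injective

theorem continuous_val_GL (n : ℕ) :
    Continuous (fun X : GL (Fin n) ℝ => (X : Matrix (Fin n) (Fin n) ℝ)) := Units.continuous_val

theorem continuous_act (n : ℕ) (v : EuclideanSpace ℝ (Fin n)) :
    Continuous (fun X : GL (Fin n) ℝ => act X v) := by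
  have h : Continuous fun X : GL (Fin n) ℝ => (X : Matrix (Fin n) (Fin n) ℝ) *ᵥ v.ofLp :=
    (continuous_val_GL n).matrix_mulVec continuous_const
  exact (PiLp.continuous_toLp 2 _).comp h

theorem measurable_latticeCount {n : ℕ} {t : ℝ} (ht : 0 < t) :
    Measurable fun X : GL (Fin n) ℝ => (latticeCount X t : ℝ) := by
  have h : ∀ X : GL (Fin n) ℝ, (latticeCount X t : ℝ) =
      (∑' k : Fin n → ℤ, {X : GL (Fin n) ℝ | ‖act X (intVec k)‖ ≤ t}.indicator
        (fun _ => (1 : ℝ≥0∞)) X).toReal := by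
    intro X
    rw [latticeCount_eq X ht]
    have : ∀ k : Fin n → ℤ, {X : GL (Fin n) ℝ | ‖act X (intVec k)‖ ≤ t}.indicator
        (fun _ => (1 : ℝ≥0∞)) X = {k : Fin n → ℤ | ‖act X (intVec k)‖ ≤ t}.indicator
        (fun _ => (1 : ℝ≥0∞)) k := fun k => rfl
    simp_rw [this]
    rw [← tsum_subtype, ENNReal.tsum_set_one, Set.ncard]
    rcases eq_or_ne ({k : Fin n → ℤ | ‖act X (intVec k)‖ ≤ t}.encard) ⊤ with h | h
    · rw [h]; simp
    · lift ({k : Fin n → ℤ | ‖act X (intVec k)‖ ≤ t}.encard) to ℕ using h with N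
      simp
  simp_rw [h]
  refine Measurable.ennreal_toReal (Measurable.tsum fun k => ?_)
  refine measurable_const.indicator ?_
  exact (isClosed_le (continuous_act n _).norm continuous_const).measurableSet

theorem toReal_volume_ellipsoid {n : ℕ} (X : GL (Fin n) ℝ) {t : ℝ} (ht : 0 < t) :
    (volume (t • ellipsoid X)).toReal =
      |(X⁻¹).1.det| * (t ^ n * (volume (unitBall n)).toReal) := by
  rw [volume_ellipsoid, ENNReal.toReal_mul, ENNReal.toReal_mul,
    ENNReal.toReal_ofReal (abs_nonneg _), ENNReal.toReal_ofReal (abs_nonneg _),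
    abs_of_pos (pow_pos ht n)]
  ring

theorem continuous_det_inv (n : ℕ) : Continuous fun X : GL (Fin n) ℝ => |(X⁻¹).1.det| :=
  ((continuous_val_GL n).comp continuous_inv).matrix_det.abs

theorem measurable_remainderGL {n : ℕ} {t : ℝ} (ht : 0 < t) :
    Measurable fun X : GL (Fin n) ℝ => remainderGL X t := by
  unfold remainderGL
  refine (measurable_latticeCount ht).sub ?_
  simp_rw [toReal_volume_ellipsoid _ ht]
  exact (continuous_det_inv n).measurable.mul_const _

theorem measurable_remainder {n : ℕ} {t : ℝ} (ht : 0 < t) :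
    Measurable (remainder (n := n) t) :=
  measurable_from_quotient.2 (measurable_remainderGL ht)

/-! ### From the space of lattices to the group -/

theorem measurable_mk_latticeSpace (n : ℕ) :
    Measurable (QuotientGroup.mk : GL (Fin n) ℝ → LatticeSpace n) :=
  measurable_from_quotient.1 measurable_id

/-- Integrals over the image of `U` in the space of lattices are dominated by integrals over
`U`, since the induced measure sees each class meeting `U` once. -/
theorem setLIntegral_image_mk_le {n : ℕ} (ν : Measure (GL (Fin n) ℝ)) [ν.IsMulRightInvariant]
    {U : Set (GL (Fin n) ℝ)} (hU : IsOpen U) {g : LatticeSpace n → ℝ≥0∞} (hg : Measurable g) :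
    ∫⁻ x in (QuotientGroup.mk : GL (Fin n) ℝ → LatticeSpace n) '' U, g x ∂(inducedMeasure ν) ≤
      ∫⁻ X in U, g (QuotientGroup.mk X) ∂ν := by
  have hmk := measurable_mk_latticeSpace n
  have hpre : (QuotientGroup.mk : GL (Fin n) ℝ → LatticeSpace n) ⁻¹'
      ((QuotientGroup.mk : GL (Fin n) ℝ → LatticeSpace n) '' U) =
      ⋃ γ : (glInt n).op, γ • U := by
    ext X
    simp only [mem_preimage, mem_image, mem_iUnion]
    constructor
    · rintro ⟨Z, hZ, h⟩
      refine ⟨⟨MulOpposite.op (Z⁻¹ * X), QuotientGroup.eq.1 h⟩, Z, hZ, ?_⟩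
      change Z * (Z⁻¹ * X) = X
      rw [mul_inv_cancel_left]
    · rintro ⟨γ, Z, hZ, rfl⟩
      refine ⟨Z, hZ, QuotientGroup.eq.2 ?_⟩
      change Z⁻¹ * (Z * γ.1.unop) ∈ _
      rw [inv_mul_cancel_left]
      exact γ.2
  have hUo : IsOpen ((QuotientGroup.mk : GL (Fin n) ℝ → LatticeSpace n) ⁻¹'
      ((QuotientGroup.mk : GL (Fin n) ℝ → LatticeSpace n) '' U)) := by
    rw [hpre]
    refine isOpen_iUnion fun γ => ?_
    have : γ • U = (fun Z => Z * γ.1.unop) '' U := rfl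
    rw [this]
    exact (Homeomorph.mulRight γ.1.unop).isOpenMap _ hU
  have hms : MeasurableSet ((QuotientGroup.mk : GL (Fin n) ℝ → LatticeSpace n) '' U) :=
    hUo.measurableSet
  have hF := isFundamentalDomain n ν
  rw [inducedMeasure, Measure.restrict_map hmk hms, lintegral_map hg hmk,
    Measure.restrict_restrict hUo.measurableSet, hpre, hF.setLIntegral_eq_tsum' _ U, iUnion_inter]
  refine (lintegral_iUnion_le _ _).trans (ENNReal.tsum_le_tsum fun γ => le_of_eq ?_)
  refine lintegral_congr fun X => congrArg g ?_
  exact (QuotientGroup.mk_mul_of_mem X (inv_mem γ.2 : γ.1⁻¹ ∈ (glInt n).op)).symm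

/-- It suffices to bound the mean square of the remainder in a neighbourhood of each matrix. -/
theorem meanSquare_of_local {n : ℕ} (hn : 0 < n) (ν : Measure (GL (Fin n) ℝ)) [ν.IsHaarMeasure]
    (hloc : ∀ X₀ : GL (Fin n) ℝ, ∃ U : Set (GL (Fin n) ℝ), IsOpen U ∧ X₀ ∈ U ∧ ν U < ∞ ∧
      (∀ t : ℝ, 0 < t → ∃ C : ℝ, ∀ X ∈ U, |remainderGL X t| ≤ C) ∧
      ∃ C : ℝ, 0 ≤ C ∧ ∀ t : ℝ, 2 ≤ t → ∫⁻ X in U, ENNReal.ofReal (|remainderGL X t| ^ 2) ∂ν ≤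
        ENNReal.ofReal (C * (t ^ ((n : ℝ) - 1) * Real.log t ^ (2 * n))))
    (L₀ : Set (LatticeSpace n)) (hL₀ : IsCompact L₀) :
    (∀ t : ℝ, 0 < t → IntegrableOn (fun X => |remainder t X| ^ 2) L₀ (inducedMeasure ν)) ∧
    ∃ m : ℕ, 0 < m ∧
      (fun t : ℝ => Real.sqrt (∫ X in L₀, |remainder t X| ^ 2 ∂(inducedMeasure ν)))
      =O[atTop] (fun t : ℝ => t ^ (((n : ℝ) - 1) / 2) * Real.log t ^ m) := by
  have := isMulRightInvariant_GL ν
  choose U hUo hUm hUf hUb C hC0 hC using hloc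
  obtain ⟨s, hs⟩ := hL₀.elim_finite_subcover
    (fun X => (QuotientGroup.mk : GL (Fin n) ℝ → LatticeSpace n) '' U X)
    (fun X => QuotientGroup.isOpenMap_coe _ (hUo X))
    (fun x _ => by
      obtain ⟨X, rfl⟩ := QuotientGroup.mk_surjective x
      exact mem_iUnion.2 ⟨X, mem_image_of_mem _ (hUm X)⟩)
  have hle : ∀ g : LatticeSpace n → ℝ≥0∞, Measurable g →
      ∫⁻ x in L₀, g x ∂(inducedMeasure ν) ≤
        ∑ X₀ ∈ s, ∫⁻ X in U X₀, g (QuotientGroup.mk X) ∂ν := by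
    intro g hg
    refine (lintegral_mono_set hs).trans ?_
    have hbi : (⋃ X₀ ∈ s, (QuotientGroup.mk : GL (Fin n) ℝ → LatticeSpace n) '' U X₀) =
        ⋃ X₀ : s, (QuotientGroup.mk : GL (Fin n) ℝ → LatticeSpace n) '' U X₀ := by
      ext x
      simp only [mem_iUnion, Subtype.exists, exists_prop]
    rw [hbi]
    refine (lintegral_iUnion_le _ _).trans ?_
    rw [tsum_fintype, Finset.sum_coe_sort s fun X₀ =>
      ∫⁻ x in (QuotientGroup.mk : GL (Fin n) ℝ → LatticeSpace n) '' U X₀, g x ∂(inducedMeasure ν)]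
    exact Finset.sum_le_sum fun X₀ _ => setLIntegral_image_mk_le ν (hUo X₀) hg
  have hmeas : ∀ t : ℝ, 0 < t → Measurable fun x : LatticeSpace n => |remainder t x| ^ 2 := by
    intro t ht
    exact ((measurable_remainder ht).abs).pow_const 2
  refine ⟨fun t ht => ⟨(hmeas t ht).aestronglyMeasurable, ?_⟩, n, hn, ?_⟩
  · rw [hasFiniteIntegral_iff_ofReal (ae_of_all _ fun x => by positivity)]
    refine (hle _ (hmeas t ht).ennreal_ofReal).trans_lt (ENNReal.sum_lt_top.2 fun X₀ _ => ?_)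
    obtain ⟨B, hB⟩ := hUb X₀ t ht
    calc ∫⁻ X in U X₀, ENNReal.ofReal (|remainderGL X t| ^ 2) ∂ν
        ≤ ∫⁻ X in U X₀, ENNReal.ofReal (B ^ 2) ∂ν := by
          refine setLIntegral_mono measurable_const fun X hX => ENNReal.ofReal_le_ofReal ?_
          exact pow_le_pow_left₀ (abs_nonneg _) (hB X hX) 2
      _ < ∞ := by
          rw [setLIntegral_const]
          exact ENNReal.mul_lt_top ENNReal.ofReal_lt_top (hUf X₀)
  · refine IsBigO.of_bound (Real.sqrt (∑ X₀ ∈ s, C X₀)) ?_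
    filter_upwards [eventually_ge_atTop 2] with t ht
    have ht0 : (0 : ℝ) < t := by linarith
    have hlog : 0 ≤ Real.log t := Real.log_nonneg (by linarith)
    have hS : 0 ≤ ∑ X₀ ∈ s, C X₀ := Finset.sum_nonneg fun X₀ _ => hC0 X₀
    have key : ∫ x in L₀, |remainder t x| ^ 2 ∂(inducedMeasure ν) ≤
        (∑ X₀ ∈ s, C X₀) * (t ^ ((n : ℝ) - 1) * Real.log t ^ (2 * n)) := by
      rw [integral_eq_lintegral_of_nonneg_ae (ae_of_all _ fun x => by positivity)
        (hmeas t ht0).aestronglyMeasurable]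
      refine ENNReal.toReal_le_of_le_ofReal (by positivity) ?_
      refine (hle _ (hmeas t ht0).ennreal_ofReal).trans ?_
      rw [Finset.sum_mul, ENNReal.ofReal_sum_of_nonneg fun X₀ _ => by
        have := hC0 X₀; positivity]
      exact Finset.sum_le_sum fun X₀ _ => hC X₀ t ht
    rw [Real.norm_of_nonneg (Real.sqrt_nonneg _), Real.norm_of_nonneg (by positivity)]
    refine (Real.sqrt_le_sqrt key).trans (le_of_eq ?_)
    rw [Real.sqrt_mul hS]
    congr 1
    rw [Real.sqrt_eq_iff_mul_self_eq (by positivity) (by positivity), mul_mul_mul_comm,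
      ← Real.rpow_add ht0, ← pow_add]
    ring_nf

/-! ### Poisson summation in several variables -/

section Poisson

variable {n : ℕ}

/-- For `x` in a bounded set only finitely many translates of a compactly supported function are
nonzero at `x`. -/
theorem apply_add_eq_zero_of_notMem {g : (Fin n → ℝ) → ℂ} {R S : ℝ}
    (hg : ∀ x, R < ‖x‖ → g x = 0) {x : Fin n → ℝ} (hx : ‖x‖ ≤ S) {m : Fin n → ℤ}
    (hm : m ∉ Finset.Icc (fun _ : Fin n => -⌈R + S⌉) (fun _ => ⌈R + S⌉)) :
    g (x + fun i => (m i : ℝ)) = 0 := by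
  apply hg
  by_contra h
  push Not at h
  refine hm ?_
  have h1 : ∀ i, |(m i : ℝ)| ≤ R + S := by
    intro i
    have h2 := (norm_le_pi_norm (x + fun i => (m i : ℝ)) i).trans h
    have h3 := (norm_le_pi_norm x i).trans hx
    rw [Real.norm_eq_abs] at h2 h3
    have h4 : (m i : ℝ) = (x + fun i => (m i : ℝ)) i - x i := by simp
    rw [h4]
    exact (abs_sub _ _).trans (by linarith)
  rw [Finset.mem_Icc]
  constructor
  · intro i
    have := (abs_le.1 (h1 i)).1
    have h5 : -(m i : ℝ) ≤ ⌈R + S⌉ := by linarith [Int.le_ceil (R + S)]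
    have : -(m i) ≤ ⌈R + S⌉ := by exact_mod_cast h5
    change -⌈R + S⌉ ≤ m i
    linarith
  · intro i
    have := ((abs_le.1 (h1 i)).2).trans (Int.le_ceil (R + S))
    exact_mod_cast this

theorem tsum_shift_eq_sum {g : (Fin n → ℝ) → ℂ} {R S : ℝ}
    (hg : ∀ x, R < ‖x‖ → g x = 0) {x : Fin n → ℝ} (hx : ‖x‖ ≤ S) :
    ∑' m : Fin n → ℤ, g (x + fun i => (m i : ℝ)) =
      ∑ m ∈ Finset.Icc (fun _ : Fin n => -⌈R + S⌉) (fun _ => ⌈R + S⌉),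
        g (x + fun i => (m i : ℝ)) :=
  tsum_eq_sum fun _ hm => apply_add_eq_zero_of_notMem hg hx hm

theorem continuous_tsum_shift {g : (Fin n → ℝ) → ℂ} (hc : Continuous g) {R : ℝ}
    (hg : ∀ x, R < ‖x‖ → g x = 0) :
    Continuous fun x => ∑' m : Fin n → ℤ, g (x + fun i => (m i : ℝ)) := by
  refine continuous_iff_continuousAt.2 fun x₀ => ?_
  have h1 : (fun x => ∑ m ∈ Finset.Icc (fun _ : Fin n => -⌈R + (‖x₀‖ + 1)⌉)
      (fun _ => ⌈R + (‖x₀‖ + 1)⌉), g (x + fun i => (m i : ℝ))) =ᶠ[𝓝 x₀]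
      fun x => ∑' m : Fin n → ℤ, g (x + fun i => (m i : ℝ)) := by
    filter_upwards [(continuous_norm.tendsto x₀).eventually_le_const
      (lt_add_one ‖x₀‖)] with x hx
    exact (tsum_shift_eq_sum hg hx).symm
  refine ContinuousAt.congr ?_ h1
  exact (continuous_finsetSum _ fun m _ =>
    hc.comp (continuous_id.add continuous_const)).continuousAt

theorem tsum_shift_periodic (g : (Fin n → ℝ) → ℂ) {x y : Fin n → ℝ}
    (h : (fun i => (x i : UnitAddCircle)) = fun i => (y i : UnitAddCircle)) :
    ∑' m : Fin n → ℤ, g (x + fun i => (m i : ℝ)) =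
      ∑' m : Fin n → ℤ, g (y + fun i => (m i : ℝ)) := by
  have h1 : ∀ i, ∃ k : ℤ, x i - y i = k := by
    intro i
    have := congrFun h i
    rw [← sub_eq_zero, ← AddCircle.coe_sub, AddCircle.coe_eq_zero_iff] at this
    obtain ⟨k, hk⟩ := this
    exact ⟨k, by rw [← hk]; simp⟩
  choose k hk using h1
  rw [← (Equiv.addRight k).tsum_eq fun m : Fin n → ℤ => g (y + fun i => (m i : ℝ))]
  refine tsum_congr fun m => congrArg g ?_
  funext i
  have := hk i
  simp only [Pi.add_apply, Equiv.coe_addRight, Int.cast_add]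
  linarith

/-- The unit cubes centred at the integer points tile space. -/
theorem integral_eq_tsum_cube {h : (Fin n → ℝ) → ℂ} (hi : Integrable h) :
    ∫ x, h x = ∑' m : Fin n → ℤ,
      ∫ x in {x : Fin n → ℝ | ∀ i, x i ∈ Ioc (0 : ℝ) (0 + 1)}, h (x + fun i => (m i : ℝ)) := by
  set Q : Set (Fin n → ℝ) := {x : Fin n → ℝ | ∀ i, x i ∈ Ioc (0 : ℝ) (0 + 1)} with hQ
  have hQm : MeasurableSet Q := MeasurableSet.univ_pi' fun i => measurableSet_Ioc
  let T : (Fin n → ℤ) → Set (Fin n → ℝ) := fun m => (fun x => x + fun i => -(m i : ℝ)) ⁻¹' Q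
  have hTm : ∀ m, MeasurableSet (T m) := fun m => hQm.preimage (measurable_add_const _)
  have hTu : ⋃ m, T m = univ := by
    refine eq_univ_of_forall fun x => mem_iUnion.2 ⟨fun i => ⌈x i⌉ - 1, fun i => ?_⟩
    simp only [Pi.add_apply, Int.cast_sub, Int.cast_one, mem_Ioc]
    constructor <;> linarith [Int.ceil_lt_add_one (x i), Int.le_ceil (x i)]
  have hTd : Pairwise (Function.onFun Disjoint T) := by
    intro m m' hmm
    refine disjoint_left.2 fun x hx hx' => hmm ?_
    funext i
    have h1 := hx i
    have h2 := hx' i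
    simp only [Pi.add_apply, mem_Ioc] at h1 h2
    have h3 : (m i : ℝ) < m' i + 1 := by linarith
    have h4 : (m' i : ℝ) < m i + 1 := by linarith
    have h3' : m i < m' i + 1 := by exact_mod_cast h3
    have h4' : m' i < m i + 1 := by exact_mod_cast h4
    linarith
  rw [← setIntegral_univ, ← hTu, integral_iUnion hTm hTd hi.integrableOn]
  refine tsum_congr fun m => ?_
  have := (measurePreserving_add_right volume (fun i => -(m i : ℝ))).setIntegral_preimage_emb
    (Homeomorph.addRight (fun i : Fin n => -(m i : ℝ))).measurableEmbedding
    (fun x => h (x + fun i => (m i : ℝ))) Q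
  rw [← this]
  refine setIntegral_congr_fun (hTm m) fun x _ => congrArg h ?_
  funext i
  simp

/-- **Poisson summation** for a continuous function of compact support on `ℝⁿ` whose Fourier
transform is summable over the integer points. -/
theorem hasSum_fourier_of_pi {g : (Fin n → ℝ) → ℂ} (hc : Continuous g) {R : ℝ}
    (hg : ∀ x, R < ‖x‖ → g x = 0)
    (hs : Summable fun k : Fin n → ℤ => ∫ x : Fin n → ℝ,
      Complex.exp (-(2 * Real.pi * Complex.I * ∑ i, (k i : ℂ) * x i)) * g x) :
    HasSum (fun k : Fin n → ℤ => ∫ x : Fin n → ℝ,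
      Complex.exp (-(2 * Real.pi * Complex.I * ∑ i, (k i : ℂ) * x i)) * g x)
      (∑' m : Fin n → ℤ, g fun i => (m i : ℝ)) := by
  let G : (Fin n → ℝ) → ℂ := fun x => ∑' m : Fin n → ℤ, g (x + fun i => (m i : ℝ))
  -- the periodization `G` descends to a continuous function `F` on the torus, whose Fourier series
  -- converges at `0` because its coefficients are the summable values of the transform of `g`
  have hq : IsQuotientMap (fun (x : Fin n → ℝ) i => (x i : UnitAddCircle)) :=
    (IsOpenQuotientMap.piMap fun _ : Fin n =>
      (QuotientAddGroup.isOpenQuotientMap_mk : IsOpenQuotientMap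
        (QuotientAddGroup.mk : ℝ → UnitAddCircle))).isQuotientMap
  let F : UnitAddTorus (Fin n) → ℂ := fun θ => G fun i => (θ i).out
  have hFG : ∀ x : Fin n → ℝ, F (fun i => (x i : UnitAddCircle)) = G x := by
    intro x
    refine tsum_shift_periodic g ?_
    funext i
    exact Quotient.out_eq' _
  have hFc : Continuous F := by
    rw [hq.continuous_iff]
    have : F ∘ (fun (x : Fin n → ℝ) i => (x i : UnitAddCircle)) = G := funext hFG
    rw [this]
    exact continuous_tsum_shift hc hg
  let e : (Fin n → ℤ) → (Fin n → ℝ) → ℂ := fun k x =>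
    Complex.exp (-(2 * Real.pi * Complex.I * ∑ i, (k i : ℂ) * x i))
  have hec : ∀ k, Continuous (e k) := fun k => by fun_prop
  have heF : ∀ (k : Fin n → ℤ) (x : Fin n → ℝ),
      UnitAddTorus.mFourier (-k) (fun i => (x i : UnitAddCircle)) = e k x := by
    intro k x
    simp only [UnitAddTorus.mFourier, ContinuousMap.coe_mk, fourier_coe_apply, e]
    rw [← Complex.exp_sum, Finset.mul_sum, ← Finset.sum_neg_distrib]
    congr 1
    refine Finset.sum_congr rfl fun i _ => ?_
    simp only [Pi.neg_apply, Int.cast_neg, Complex.ofReal_one, div_one]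
    ring
  have hep : ∀ (k m : Fin n → ℤ) (x : Fin n → ℝ), e k (x + fun i => (m i : ℝ)) = e k x := by
    intro k m x
    rw [← heF, ← heF]
    congr 1
    funext i
    simp
  have hcs : HasCompactSupport g := by
    refine HasCompactSupport.intro (isCompact_closedBall (0 : Fin n → ℝ) R) fun x hx => hg x ?_
    simpa using hx
  have hcoeff : ∀ k : Fin n → ℤ, UnitAddTorus.mFourierCoeff F k = ∫ x, e k x * g x := by
    intro k
    have hi : Integrable (fun x => e k x * g x) :=
      ((hec k).mul hc).integrable_of_hasCompactSupport hcs.mul_left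
    rw [UnitAddTorus.mFourierCoeff_eq_integral F k 0, integral_eq_tsum_cube hi]
    simp only [Pi.zero_apply]
    have hx1 : ∀ x ∈ {x : Fin n → ℝ | ∀ i, x i ∈ Ioc (0 : ℝ) (0 + 1)}, ‖x‖ ≤ 1 := by
      intro x hx
      refine (pi_norm_le_iff_of_nonneg zero_le_one).2 fun i => ?_
      have := hx i
      rw [mem_Ioc] at this
      rw [Real.norm_eq_abs, abs_le]
      constructor <;> linarith [this.1, this.2]
    have hQm : MeasurableSet {x : Fin n → ℝ | ∀ i, x i ∈ Ioc (0 : ℝ) (0 + 1)} :=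
      MeasurableSet.univ_pi' fun i => measurableSet_Ioc
    rw [tsum_eq_sum (s := Finset.Icc (fun _ : Fin n => -⌈R + 1⌉) (fun _ => ⌈R + 1⌉))]
    · rw [← integral_finsetSum]
      · refine setIntegral_congr_fun hQm fun x hx => ?_
        simp only [heF, hFG, G, smul_eq_mul, hep]
        rw [tsum_shift_eq_sum hg (hx1 x hx), Finset.mul_sum]
      · intro m _
        refine Integrable.integrableOn ?_
        exact hi.comp_add_right _
    · intro m hm
      rw [setIntegral_congr_fun (g := fun _ => 0) hQm, integral_zero]
      intro x hx
      simp only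
      rw [apply_add_eq_zero_of_notMem hg (hx1 x hx) hm, mul_zero]
  have hs' : Summable (UnitAddTorus.mFourierCoeff (⟨F, hFc⟩ : C(UnitAddTorus (Fin n), ℂ))) := by
    refine hs.congr fun k => ?_
    exact (hcoeff k).symm
  have := UnitAddTorus.hasSum_mFourier_series_apply_of_summable hs'
    (fun i => ((0 : ℝ) : UnitAddCircle))
  have h0 : F (fun i => ((0 : ℝ) : UnitAddCircle)) = ∑' m : Fin n → ℤ, g fun i => (m i : ℝ) := by
    rw [hFG (fun _ => 0)]
    refine tsum_congr fun m => congrArg g ?_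
    funext i
    simp
  simp only [ContinuousMap.coe_mk] at this
  rw [h0] at this
  refine this.congr_fun fun k => ?_
  have h1 : UnitAddTorus.mFourier k (fun _ : Fin n => ((0 : ℝ) : UnitAddCircle)) = 1 := by
    have := heF (-k) (fun _ => 0)
    rw [neg_neg] at this
    rw [this]
    simp [e]
  rw [h1, smul_eq_mul, mul_one]
  exact (hcoeff k).symm

/-- **Poisson summation** on Euclidean `ℝⁿ`. -/
theorem hasSum_fourier_intVec {g : EuclideanSpace ℝ (Fin n) → ℂ} (hc : Continuous g)
    (hg : HasCompactSupport g) (hs : Summable fun k : Fin n → ℤ => 𝓕 g (intVec k)) :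
    HasSum (fun k : Fin n → ℤ => 𝓕 g (intVec k)) (∑' m : Fin n → ℤ, g (intVec m)) := by
  have hF : ∀ k : Fin n → ℤ, 𝓕 g (intVec k) = ∫ x : Fin n → ℝ,
      Complex.exp (-(2 * Real.pi * Complex.I * ∑ i, (k i : ℂ) * x i)) * g (WithLp.toLp 2 x) := by
    intro k
    rw [Real.fourier_eq', ← (PiLp.volume_preserving_toLp (Fin n)).integral_comp
      (MeasurableEquiv.toLp 2 (Fin n → ℝ)).measurableEmbedding]
    refine integral_congr_ae (ae_of_all _ fun x => ?_)
    simp only [smul_eq_mul]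
    congr 2
    rw [PiLp.inner_apply]
    simp only [intVec, RCLike.inner_apply, conj_trivial]
    push_cast
    ring
  simp only [hF] at hs ⊢
  obtain ⟨R, hR⟩ := hg.isCompact.isBounded.subset_closedBall 0
  refine hasSum_fourier_of_pi (g := fun x => g (WithLp.toLp 2 x)) (R := R)
    (hc.comp (PiLp.continuous_toLp 2 _)) (fun x hx => ?_) hs
  by_contra hne
  have h1 := hR (subset_tsupport _ hne)
  rw [mem_closedBall_zero_iff] at h1
  have h2 : ‖x‖ ≤ ‖WithLp.toLp 2 x‖ := by
    refine (pi_norm_le_iff_of_nonneg (norm_nonneg _)).2 fun i => ?_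
    exact PiLp.norm_apply_le (WithLp.toLp 2 x) i
  linarith

end Poisson

/-! ### Bessel-type integrals -/

section Bessel

open Polynomial intervalIntegral

/-- The Bessel-type integral `∫₀^π sin^j θ · h(cos θ) · e^{ix cos θ} dθ`. -/
noncomputable def besselInt (j : ℕ) (h : ℝ[X]) (x : ℝ) : ℂ :=
  ∫ θ in (0 : ℝ)..Real.pi,
    ((Real.sin θ ^ j * h.eval (Real.cos θ) : ℝ) : ℂ) * Complex.exp (Complex.I * x * Real.cos θ)

theorem hasDerivAt_exp_cos (x θ : ℝ) :
    HasDerivAt (fun θ : ℝ => Complex.exp (Complex.I * x * Real.cos θ))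
      (-(Complex.I * x * Real.sin θ) * Complex.exp (Complex.I * x * Real.cos θ)) θ := by
  have h1 := ((Real.hasDerivAt_cos θ).ofReal_comp).const_mul (Complex.I * x)
  have h2 := h1.cexp
  convert! h2 using 1
  push_cast
  ring

theorem norm_exp_I_cos (x θ : ℝ) : ‖Complex.exp (Complex.I * x * Real.cos θ)‖ = 1 := by
  have : Complex.I * x * Real.cos θ = ((x * Real.cos θ : ℝ) : ℂ) * Complex.I := by
    push_cast; ring
  rw [this, Complex.norm_exp_ofReal_mul_I]

theorem hasDerivAt_eval_cos (h : ℝ[X]) (θ : ℝ) :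
    HasDerivAt (fun θ : ℝ => h.eval (Real.cos θ))
      (-(Real.sin θ * h.derivative.eval (Real.cos θ))) θ := by
  convert! (h.hasDerivAt (Real.cos θ)).comp θ (Real.hasDerivAt_cos θ) using 1
  ring

theorem exists_bound_eval_cos (h : ℝ[X]) : ∃ C : ℝ, 0 ≤ C ∧ ∀ θ : ℝ, |h.eval (Real.cos θ)| ≤ C := by
  obtain ⟨C, hC⟩ := (isCompact_Icc (a := (-1 : ℝ)) (b := 1)).exists_bound_of_continuousOn
    h.continuous.continuousOn
  refine ⟨max C 0, le_max_right _ _, fun θ => ?_⟩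
  exact (hC _ ⟨Real.neg_one_le_cos θ, Real.cos_le_one θ⟩).trans (le_max_left _ _)

/-- Integration by parts lowers the power of `sin` by two and gains a factor `1 / x`. -/
theorem besselInt_add_two (j : ℕ) (h : ℝ[X]) {x : ℝ} (hx : x ≠ 0) :
    besselInt (j + 2) h x = -(Complex.I / x) *
      besselInt j (C (j + 1 : ℝ) * X * h - (1 - X ^ 2) * derivative h) x := by
  have hxC : (x : ℂ) ≠ 0 := by exact_mod_cast hx
  let u : ℝ → ℂ := fun θ => ((Real.sin θ ^ (j + 1) * h.eval (Real.cos θ) : ℝ) : ℂ)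
  let u' : ℝ → ℂ := fun θ => (((Real.sin θ ^ j *
    (C (j + 1 : ℝ) * X * h - (1 - X ^ 2) * derivative h).eval (Real.cos θ) : ℝ)) : ℂ)
  let v : ℝ → ℂ := fun θ => Complex.exp (Complex.I * x * Real.cos θ)
  let v' : ℝ → ℂ := fun θ => -(Complex.I * x * Real.sin θ) * v θ
  have hu : ∀ θ, HasDerivAt u (u' θ) θ := by
    intro θ
    refine HasDerivAt.ofReal_comp ?_
    convert! ((Real.hasDerivAt_sin θ).pow (j + 1)).mul (hasDerivAt_eval_cos h θ) using 1
    simp only [Pi.pow_apply, eval_sub, eval_mul, eval_C, eval_X, eval_one, eval_pow, Nat.cast_add,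
      Nat.cast_one, add_tsub_cancel_right]
    have : 1 - Real.cos θ ^ 2 = Real.sin θ ^ 2 := by rw [Real.sin_sq]
    rw [this]; ring
  have hu'c : Continuous u' := by fun_prop
  have hv'c : Continuous v' := by fun_prop
  have key := integral_mul_deriv_eq_deriv_mul (a := 0) (b := Real.pi) (fun θ _ => hu θ)
    (fun θ _ => hasDerivAt_exp_cos x θ) (hu'c.intervalIntegrable _ _) (hv'c.intervalIntegrable _ _)
  have hb : u Real.pi = 0 := by simp [u]
  have ha : u 0 = 0 := by simp [u]
  rw [hb, ha] at key
  have h1 : ∫ θ in (0 : ℝ)..Real.pi, u θ * v' θ = -(Complex.I * x) * besselInt (j + 2) h x := by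
    rw [besselInt, ← intervalIntegral.integral_const_mul]
    refine integral_congr fun θ _ => ?_
    simp only [u, v', v]
    push_cast
    ring
  have h2 : ∫ θ in (0 : ℝ)..Real.pi, u' θ * v θ =
      besselInt j (C (j + 1 : ℝ) * X * h - (1 - X ^ 2) * derivative h) x := rfl
  change ∫ θ in (0 : ℝ)..Real.pi, u θ * v' θ = _ at key
  rw [h1] at key
  have h3 : -(Complex.I * x) * besselInt (j + 2) h x =
    -besselInt j (C (j + 1 : ℝ) * X * h - (1 - X ^ 2) * derivative h) x := by
    rw [key, ← h2]; simp [v]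
  have h4 : besselInt (j + 2) h x =
      -(Complex.I / x) * (-(-(Complex.I * x) * besselInt (j + 2) h x)) := by
    field_simp
    rw [Complex.I_sq]; ring
  rw [h4, h3, neg_neg]

theorem norm_besselInt_le (j : ℕ) (h : ℝ[X]) : ∃ C : ℝ, 0 ≤ C ∧ ∀ x, ‖besselInt j h x‖ ≤ C := by
  obtain ⟨C, hC0, hC⟩ := exists_bound_eval_cos h
  refine ⟨C * |Real.pi - 0|, by positivity, fun x => ?_⟩
  refine norm_integral_le_of_norm_le_const fun θ _ => ?_
  rw [norm_mul, norm_exp_I_cos, mul_one, Complex.norm_real, Real.norm_eq_abs, abs_mul, abs_pow]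
  calc |Real.sin θ| ^ j * |h.eval (Real.cos θ)| ≤ 1 * C := by
        gcongr
        · exact pow_le_one₀ (abs_nonneg _) (Real.abs_sin_le_one θ)
        · exact hC θ
    _ = C := one_mul C

/-- The factor `sin θ` is the derivative of the phase, and integration by parts applies at once. -/
theorem besselInt_one_le (h : ℝ[X]) :
    ∃ C : ℝ, 0 ≤ C ∧ ∀ x : ℝ, 0 < x → ‖besselInt 1 h x‖ ≤ C / x := by
  obtain ⟨C₀, hC0, hC⟩ := exists_bound_eval_cos h
  obtain ⟨C₁, hC10, hC1⟩ := norm_besselInt_le 1 (derivative h)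
  refine ⟨2 * C₀ + C₁, by positivity, fun x hx => ?_⟩
  have hxC : (x : ℂ) ≠ 0 := by exact_mod_cast hx.ne'
  let u : ℝ → ℂ := fun θ => ((h.eval (Real.cos θ) : ℝ) : ℂ)
  let u' : ℝ → ℂ := fun θ => ((-(Real.sin θ * (derivative h).eval (Real.cos θ)) : ℝ) : ℂ)
  let v : ℝ → ℂ := fun θ => Complex.exp (Complex.I * x * Real.cos θ)
  let v' : ℝ → ℂ := fun θ => -(Complex.I * x * Real.sin θ) * v θ
  have hu'c : Continuous u' := by fun_prop
  have hv'c : Continuous v' := by fun_prop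
  have key := integral_mul_deriv_eq_deriv_mul (a := 0) (b := Real.pi)
    (fun θ _ => (hasDerivAt_eval_cos h θ).ofReal_comp)
    (fun θ _ => hasDerivAt_exp_cos x θ) (hu'c.intervalIntegrable _ _) (hv'c.intervalIntegrable _ _)
  have h1 : ∫ θ in (0 : ℝ)..Real.pi, u θ * v' θ = -(Complex.I * x) * besselInt 1 h x := by
    rw [besselInt, ← intervalIntegral.integral_const_mul]
    refine integral_congr fun θ _ => ?_
    simp only [u, v', v]
    push_cast
    ring
  have h2 : ∫ θ in (0 : ℝ)..Real.pi, u' θ * v θ = -besselInt 1 (derivative h) x := by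
    rw [besselInt, ← intervalIntegral.integral_neg]
    refine integral_congr fun θ _ => ?_
    simp only [u', v]
    push_cast
    ring
  change ∫ θ in (0 : ℝ)..Real.pi, u θ * v' θ = u Real.pi * v Real.pi - u 0 * v 0 -
    ∫ θ in (0 : ℝ)..Real.pi, u' θ * v θ at key
  rw [h1, h2] at key
  have hn := congrArg norm key
  rw [norm_mul, norm_neg, norm_mul, Complex.norm_I, one_mul, Complex.norm_real,
    Real.norm_of_nonneg hx.le] at hn
  rw [le_div_iff₀ hx, mul_comm, hn]
  have hb : ∀ θ, ‖u θ * v θ‖ ≤ C₀ := by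
    intro θ
    rw [norm_mul, norm_exp_I_cos, mul_one, Complex.norm_real]
    exact hC θ
  calc _ ≤ ‖u Real.pi * v Real.pi‖ + ‖u 0 * v 0‖ + ‖-besselInt 1 (derivative h) x‖ :=
        (norm_sub_le _ _).trans (add_le_add_left (norm_sub_le _ _) _)
    _ ≤ C₀ + C₀ + C₁ := by
        rw [norm_neg]; exact add_le_add (add_le_add (hb _) (hb _)) (hC1 x)
    _ = 2 * C₀ + C₁ := by ring

/-- The endpoints `0` and `π`, where the phase is stationary, contribute `O(x^{-1/2})`. -/
theorem besselInt_zero_le (h : ℝ[X]) :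
    ∃ C : ℝ, 0 ≤ C ∧ ∀ x : ℝ, 1 ≤ x → ‖besselInt 0 h x‖ ≤ C / Real.sqrt x := by
  obtain ⟨C₀, hC0, hC⟩ := exists_bound_eval_cos h
  obtain ⟨C₁, hC10, hC1⟩ := exists_bound_eval_cos (derivative h)
  refine ⟨2 * C₀ + 2 * Real.pi * (C₀ + C₁) + 2 * Real.pi * C₀, by positivity, fun x hx => ?_⟩
  have hx0 : 0 < x := by linarith
  set d : ℝ := 1 / Real.sqrt x with hd
  -- the intervals of length `d = x^{-1/2}` at the endpoints are estimated trivially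
  have hs1 : 1 ≤ Real.sqrt x := Real.one_le_sqrt.2 hx
  have hs0 : 0 < Real.sqrt x := by linarith
  have hd0 : 0 < d := by positivity
  have hd1 : d ≤ 1 := by rw [hd, div_le_one hs0]; exact hs1
  have hpi := Real.pi_gt_three
  let f : ℝ → ℂ := fun θ => ((h.eval (Real.cos θ) : ℝ) : ℂ) *
    Complex.exp (Complex.I * x * Real.cos θ)
  have hfc : Continuous f := by fun_prop
  have hfb : ∀ θ, ‖f θ‖ ≤ C₀ := by
    intro θ
    rw [norm_mul, norm_exp_I_cos, mul_one, Complex.norm_real]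
    exact hC θ
  have hsplit : besselInt 0 h x = (∫ θ in (0 : ℝ)..d, f θ) + (∫ θ in d..(Real.pi - d), f θ) +
      ∫ θ in (Real.pi - d)..Real.pi, f θ := by
    rw [integral_add_adjacent_intervals (hfc.intervalIntegrable _ _) (hfc.intervalIntegrable _ _),
      integral_add_adjacent_intervals (hfc.intervalIntegrable _ _) (hfc.intervalIntegrable _ _)]
    simp [besselInt, f]
  have h1 : ‖∫ θ in (0 : ℝ)..d, f θ‖ ≤ C₀ * d := by
    have := norm_integral_le_of_norm_le_const (a := 0) (b := d) (f := f) fun θ _ => hfb θ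
    rwa [sub_zero, abs_of_pos hd0] at this
  have h3 : ‖∫ θ in (Real.pi - d)..Real.pi, f θ‖ ≤ C₀ * d := by
    have := norm_integral_le_of_norm_le_const (a := Real.pi - d) (b := Real.pi) (f := f)
      fun θ _ => hfb θ
    rwa [sub_sub_cancel, abs_of_pos hd0] at this
  have hsin : ∀ θ ∈ Icc d (Real.pi - d), 0 < Real.sin θ := fun θ hθ =>
    Real.sin_pos_of_pos_of_lt_pi (by linarith [hθ.1]) (by linarith [hθ.2])
  have hle : d ≤ Real.pi - d := by linarith
  have huIcc : uIcc d (Real.pi - d) = Icc d (Real.pi - d) := uIcc_of_le hle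
  have hsd : 2 / Real.pi * d ≤ Real.sin d :=
    Real.mul_le_sin hd0.le (by linarith)
  have hsd0 : 0 < Real.sin d := lt_of_lt_of_le (by positivity) hsd
  have hinv : 1 / Real.sin d ≤ Real.pi / (2 * d) := by
    rw [div_le_div_iff₀ hsd0 (by positivity)]
    have h5 : Real.pi * (2 / Real.pi * d) ≤ Real.pi * Real.sin d := by gcongr
    have h6 : Real.pi * (2 / Real.pi * d) = 2 * d := by field_simp
    linarith
  -- away from the endpoints `1 / sin` can be inserted, and the integration by parts costs
  -- `1 / sin d`, which is of order `√x`
  let u : ℝ → ℂ := fun θ => ((h.eval (Real.cos θ) / Real.sin θ : ℝ) : ℂ)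
  let u' : ℝ → ℝ := fun θ => ((-(Real.sin θ * (derivative h).eval (Real.cos θ))) * Real.sin θ -
    h.eval (Real.cos θ) * Real.cos θ) / Real.sin θ ^ 2
  let v : ℝ → ℂ := fun θ => Complex.exp (Complex.I * x * Real.cos θ)
  let v' : ℝ → ℂ := fun θ => -(Complex.I * x * Real.sin θ) * v θ
  have hu : ∀ θ ∈ uIcc d (Real.pi - d), HasDerivAt u ((u' θ : ℝ) : ℂ) θ := by
    intro θ hθ
    rw [huIcc] at hθ
    exact ((hasDerivAt_eval_cos h θ).div (Real.hasDerivAt_sin θ) (hsin θ hθ).ne').ofReal_comp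
  have hu'c : ContinuousOn u' (uIcc d (Real.pi - d)) := by
    rw [huIcc]
    refine ContinuousOn.div (by fun_prop) (by fun_prop) fun θ hθ => ?_
    exact pow_ne_zero 2 (hsin θ hθ).ne'
  have hu'c' : ContinuousOn (fun θ => ((u' θ : ℝ) : ℂ)) (uIcc d (Real.pi - d)) :=
    Complex.continuous_ofReal.comp_continuousOn hu'c
  have hv'c : Continuous v' := by fun_prop
  have key := integral_mul_deriv_eq_deriv_mul hu
    (fun θ _ => hasDerivAt_exp_cos x θ) hu'c'.intervalIntegrable (hv'c.intervalIntegrable _ _)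
  have h21 : ∫ θ in d..(Real.pi - d), u θ * v' θ =
      -(Complex.I * x) * ∫ θ in d..(Real.pi - d), f θ := by
    rw [← intervalIntegral.integral_const_mul]
    refine integral_congr fun θ hθ => ?_
    rw [huIcc] at hθ
    have : (Real.sin θ : ℂ) ≠ 0 := by exact_mod_cast (hsin θ hθ).ne'
    simp only [u, v', v, f]
    push_cast at this ⊢
    field_simp
  change ∫ θ in d..(Real.pi - d), u θ * v' θ = u (Real.pi - d) * v (Real.pi - d) - u d * v d -
    ∫ θ in d..(Real.pi - d), ((u' θ : ℝ) : ℂ) * v θ at key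
  rw [h21] at key
  have hub : ∀ θ, Real.sin θ = Real.sin d → ‖u θ * v θ‖ ≤ C₀ * (1 / Real.sin d) := by
    intro θ hθ
    rw [norm_mul, norm_exp_I_cos, mul_one, Complex.norm_real, norm_div, hθ,
      Real.norm_of_nonneg hsd0.le, ← div_eq_mul_one_div]
    gcongr
    exact hC θ
  have hint : ‖∫ θ in d..(Real.pi - d), ((u' θ : ℝ) : ℂ) * v θ‖ ≤
      (C₀ + C₁) * (2 * (1 / Real.sin d)) := by
    have hcot : ∀ θ ∈ uIcc d (Real.pi - d),
        HasDerivAt (fun θ => -(Real.cos θ / Real.sin θ)) (1 / Real.sin θ ^ 2) θ := by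
      intro θ hθ
      rw [huIcc] at hθ
      have := ((Real.hasDerivAt_cos θ).div (Real.hasDerivAt_sin θ) (hsin θ hθ).ne').neg
      convert! this using 1
      have := Real.sin_sq_add_cos_sq θ
      rw [← neg_div]
      congr 1
      linarith
    have hci : IntervalIntegrable (fun θ => 1 / Real.sin θ ^ 2) volume d (Real.pi - d) := by
      refine ContinuousOn.intervalIntegrable ?_
      rw [huIcc]
      exact ContinuousOn.div (by fun_prop) (by fun_prop)
        fun θ hθ => pow_ne_zero 2 (hsin θ hθ).ne'
    have hI := integral_eq_sub_of_hasDerivAt hcot hci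
    rw [Real.cos_pi_sub, Real.sin_pi_sub] at hI
    calc ‖∫ θ in d..(Real.pi - d), ((u' θ : ℝ) : ℂ) * v θ‖
        ≤ ∫ θ in d..(Real.pi - d), (C₀ + C₁) * (1 / Real.sin θ ^ 2) := by
          refine norm_integral_le_of_norm_le hle ?_ (hci.const_mul _)
          refine ae_of_all _ fun θ hθ => ?_
          have hs := hsin θ (Ioc_subset_Icc_self hθ)
          rw [norm_mul, norm_exp_I_cos, mul_one, Complex.norm_real, norm_div, norm_pow,
            Real.norm_of_nonneg hs.le, ← div_eq_mul_one_div]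
          gcongr
          rw [Real.norm_eq_abs]
          have e1 : |-(Real.sin θ * (derivative h).eval (Real.cos θ)) * Real.sin θ| ≤ C₁ := by
            rw [abs_mul, abs_neg, abs_mul]
            have a1 := Real.abs_sin_le_one θ
            have a2 := hC1 θ
            calc _ ≤ 1 * C₁ * 1 := by gcongr
              _ = C₁ := by ring
          have e2 : |h.eval (Real.cos θ) * Real.cos θ| ≤ C₀ := by
            rw [abs_mul]
            calc _ ≤ C₀ * 1 := by
                  gcongr
                  · exact hC θ
                  · exact Real.abs_cos_le_one θ
              _ = C₀ := by ring
          exact (abs_sub _ _).trans (by linarith)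
      _ = (C₀ + C₁) * (2 * (Real.cos d / Real.sin d)) := by
          rw [intervalIntegral.integral_const_mul, hI]; ring
      _ ≤ _ := by
          gcongr
          exact Real.cos_le_one d
  have hn := congrArg norm key
  rw [norm_mul, norm_neg, norm_mul, Complex.norm_I, one_mul, Complex.norm_real,
    Real.norm_of_nonneg hx0.le] at hn
  have h2 : ‖∫ θ in d..(Real.pi - d), f θ‖ ≤
      (2 * C₀ + 2 * (C₀ + C₁)) * (Real.pi / (2 * d)) / x := by
    rw [le_div_iff₀ hx0, mul_comm, hn]
    calc _ ≤ ‖u (Real.pi - d) * v (Real.pi - d)‖ + ‖u d * v d‖ + _ :=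
          (norm_sub_le _ _).trans (add_le_add_left (norm_sub_le _ _) _)
      _ ≤ C₀ * (1 / Real.sin d) + C₀ * (1 / Real.sin d) + (C₀ + C₁) * (2 * (1 / Real.sin d)) :=
          add_le_add (add_le_add (hub _ (Real.sin_pi_sub d)) (hub _ rfl)) hint
      _ = (2 * C₀ + 2 * (C₀ + C₁)) * (1 / Real.sin d) := by ring
      _ ≤ _ := by gcongr
  have h2' : (2 * C₀ + 2 * (C₀ + C₁)) * (Real.pi / (2 * d)) / x =
      (Real.pi * C₀ + Real.pi * (C₀ + C₁)) / Real.sqrt x := by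
    have : x = Real.sqrt x * Real.sqrt x := (Real.mul_self_sqrt hx0.le).symm
    rw [hd]
    nth_rewrite 2 [this]
    field_simp
  have hd' : C₀ * d = C₀ / Real.sqrt x := by rw [hd]; ring
  rw [hsplit]
  calc _ ≤ C₀ / Real.sqrt x + (Real.pi * C₀ + Real.pi * (C₀ + C₁)) / Real.sqrt x +
        C₀ / Real.sqrt x :=
        (norm_add₃_le).trans (add_le_add (add_le_add (hd' ▸ h1) (h2' ▸ h2)) (hd' ▸ h3))
    _ = (2 * C₀ + Real.pi * C₀ + Real.pi * (C₀ + C₁)) / Real.sqrt x := by ring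
    _ ≤ _ := by
        gcongr ?_ / _
        have := mul_nonneg Real.pi_pos.le hC0
        have := mul_nonneg Real.pi_pos.le hC10
        nlinarith

/-- Decay of the Bessel-type integrals: each power of `sin` vanishing at the stationary points
gains `x^{-1/2}`. -/
theorem besselInt_le (j : ℕ) (h : ℝ[X]) :
    ∃ C : ℝ, 0 ≤ C ∧ ∀ x : ℝ, 0 < x → ‖besselInt j h x‖ ≤ C * x ^ (-((j : ℝ) + 1) / 2) := by
  suffices H : ∀ (j : ℕ) (h : ℝ[X]), ∃ C : ℝ, 0 ≤ C ∧ ∀ x : ℝ, 1 ≤ x →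
      ‖besselInt j h x‖ ≤ C * x ^ (-((j : ℝ) + 1) / 2) by
    obtain ⟨C₁, hC1, h1⟩ := H j h
    obtain ⟨C₂, hC2, h2⟩ := norm_besselInt_le j h
    refine ⟨C₁ + C₂, by positivity, fun x hx => ?_⟩
    rcases le_total 1 x with hx1 | hx1
    · refine (h1 x hx1).trans ?_
      gcongr
      linarith
    · refine (h2 x).trans ?_
      have : 1 ≤ x ^ (-((j : ℝ) + 1) / 2) :=
        Real.one_le_rpow_of_pos_of_le_one_of_nonpos hx hx1 (by
          have : (0 : ℝ) ≤ j := j.cast_nonneg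
          linarith)
      nlinarith
  intro j
  induction j using Nat.twoStepInduction with
  | zero =>
    intro h
    obtain ⟨C, hC0, hC⟩ := besselInt_zero_le h
    refine ⟨C, hC0, fun x hx => (hC x hx).trans (le_of_eq ?_)⟩
    rw [div_eq_mul_inv, Real.sqrt_eq_rpow, ← Real.rpow_neg (by linarith)]
    norm_num
  | one =>
    intro h
    obtain ⟨C, hC0, hC⟩ := besselInt_one_le h
    refine ⟨C, hC0, fun x hx => (hC x (by linarith)).trans (le_of_eq ?_)⟩
    rw [div_eq_mul_inv, ← Real.rpow_neg_one]
    norm_num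
  | more j ih _ =>
    intro h
    obtain ⟨C', hC0, hC⟩ := ih (C (j + 1 : ℝ) * X * h - (1 - X ^ 2) * derivative h)
    refine ⟨C', hC0, fun x hx => ?_⟩
    have hx0 : 0 < x := by linarith
    rw [besselInt_add_two j h hx0.ne', norm_mul, norm_neg, norm_div, Complex.norm_I,
      Complex.norm_real, Real.norm_of_nonneg hx0.le]
    calc 1 / x * ‖besselInt j _ x‖ ≤ 1 / x * (C' * x ^ (-((j : ℝ) + 1) / 2)) := by
          gcongr
          exact hC x hx
      _ = C' * (x ^ (-1 : ℝ) * x ^ (-((j : ℝ) + 1) / 2)) := by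
          rw [Real.rpow_neg_one]; ring
      _ = _ := by
          rw [← Real.rpow_add hx0]
          push_cast
          ring_nf

/-- Differentiation under the integral sign multiplies `h` by `i cos θ`. -/
theorem hasDerivAt_besselInt (j : ℕ) (h : ℝ[X]) (x : ℝ) :
    HasDerivAt (besselInt j h) (Complex.I * besselInt j (X * h) x) x := by
  obtain ⟨C, hC0, hC⟩ := exists_bound_eval_cos h
  let f : ℝ → ℝ → ℂ := fun x θ => ((Real.sin θ ^ j * h.eval (Real.cos θ) : ℝ) : ℂ) *
    Complex.exp (Complex.I * x * Real.cos θ)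
  let f' : ℝ → ℝ → ℂ := fun x θ => ((Real.sin θ ^ j * h.eval (Real.cos θ) : ℝ) : ℂ) *
    (Complex.exp (Complex.I * x * Real.cos θ) * (Complex.I * Real.cos θ))
  have hf : ∀ x, Continuous (f x) := fun x => by fun_prop
  have hf' : ∀ x, Continuous (f' x) := fun x => by fun_prop
  have := intervalIntegral.hasDerivAt_integral_of_dominated_loc_of_deriv_le (𝕜 := ℝ) (μ := volume)
    (a := 0) (b := Real.pi) (F := f) (F' := f') (x₀ := x) (s := univ) (bound := fun _ => C)
    univ_mem (Eventually.of_forall fun x => (hf x).aestronglyMeasurable)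
    ((hf x).intervalIntegrable _ _) (hf' x).aestronglyMeasurable
    (ae_of_all _ fun θ _ y _ => by
      rw [norm_mul, norm_mul, norm_exp_I_cos, one_mul, norm_mul, Complex.norm_I, one_mul,
        Complex.norm_real, Complex.norm_real, Real.norm_eq_abs, Real.norm_eq_abs, abs_mul, abs_pow]
      have a1 := pow_le_one₀ (n := j) (abs_nonneg _) (Real.abs_sin_le_one θ)
      have a2 := Real.abs_cos_le_one θ
      have a3 := hC θ
      calc _ ≤ 1 * C * 1 := by gcongr
        _ = C := by ring)
    intervalIntegrable_const
    (ae_of_all _ fun θ _ y _ => by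
      refine HasDerivAt.const_mul _ (HasDerivAt.cexp ?_)
      have := ((hasDerivAt_id y).ofReal_comp.const_mul Complex.I).mul_const (Real.cos θ : ℂ)
      convert! this using 1
      simp)
  convert! this.2 using 1
  rw [besselInt, ← intervalIntegral.integral_const_mul]
  refine integral_congr fun θ _ => ?_
  simp only [f', eval_mul, eval_X]
  push_cast
  ring

/-- The function `F_n` with `\hat χ(ξ) = κ F_n(2π|ξ|)` for the indicator `χ` of the unit ball of
`ℝⁿ`. -/
noncomputable def besselF (n : ℕ) (x : ℝ) : ℝ := (besselInt n 1 x).re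

/-- `F_n` oscillates like `e^{ix}`, with an amplitude that varies slowly. The amplitude is
`(F - iF')e^{-ix}`, and its derivative involves only `F + F''`, in which the weight has two
more factors `sin`. -/
theorem exists_amplitude (n : ℕ) : ∃ (b b' : ℝ → ℂ) (C : ℝ), 0 ≤ C ∧
    (∀ x, besselF n x = (Complex.exp (Complex.I * x) * b x).re) ∧
    (∀ x, HasDerivAt b (b' x) x) ∧ Continuous b' ∧
    (∀ x, 0 < x → ‖b x‖ ≤ C * x ^ (-((n : ℝ) + 1) / 2)) ∧
    (∀ x, 0 < x → ‖b' x‖ ≤ C * x ^ (-((n : ℝ) + 3) / 2)) := by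
  obtain ⟨C₀, hC0, h0⟩ := besselInt_le n 1
  obtain ⟨C₁, hC1, h1⟩ := besselInt_le n X
  obtain ⟨C₂, hC2, h2⟩ := besselInt_le (n + 2) 1
  have hderiv : ∀ h x, HasDerivAt (fun x => (besselInt n h x).re)
      (Complex.I * besselInt n (X * h) x).re x := by
    intro h x
    exact Complex.reCLM.hasFDerivAt.comp_hasDerivAt x (hasDerivAt_besselInt n h x)
  have hderivI : ∀ h x, HasDerivAt (fun x => (besselInt n h x).im)
      (Complex.I * besselInt n (X * h) x).im x := by
    intro h x
    exact Complex.imCLM.hasFDerivAt.comp_hasDerivAt x (hasDerivAt_besselInt n h x)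
  have hexp : ∀ x : ℝ, HasDerivAt (fun x : ℝ => Complex.exp (-(Complex.I * x)))
      (Complex.exp (-(Complex.I * x)) * -Complex.I) x := by
    intro x
    refine HasDerivAt.cexp ?_
    have := ((hasDerivAt_id x).ofReal_comp.const_mul Complex.I).neg
    convert! this using 1
    simp
  have hnorm : ∀ x : ℝ, ‖Complex.exp (-(Complex.I * x))‖ = 1 := by
    intro x
    have : -(Complex.I * x) = ((-x : ℝ) : ℂ) * Complex.I := by push_cast; ring
    rw [this, Complex.norm_exp_ofReal_mul_I]
  have hsum : ∀ x, (besselInt n 1 x).re - (besselInt n (X * X) x).re =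
      (besselInt (n + 2) 1 x).re := by
    intro x
    rw [← Complex.sub_re]
    congr 1
    rw [besselInt, besselInt, besselInt, ← intervalIntegral.integral_sub]
    · refine integral_congr fun θ _ => ?_
      simp only [eval_one, eval_mul, eval_X]
      rw [pow_add, Real.sin_sq]
      push_cast
      ring
    · exact Continuous.intervalIntegrable (by fun_prop) _ _
    · exact Continuous.intervalIntegrable (by fun_prop) _ _
  refine ⟨fun x => (((besselInt n 1 x).re : ℂ) + Complex.I * ((besselInt n X x).im : ℂ)) *
      Complex.exp (-(Complex.I * x)),
    fun x => -Complex.I * ((besselInt (n + 2) 1 x).re : ℂ) * Complex.exp (-(Complex.I * x)),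
    C₀ + C₁ + C₂, by positivity, fun x => ?_, fun x => ?_, ?_, fun x hx => ?_, fun x hx => ?_⟩
  · rw [mul_comm, mul_assoc, ← Complex.exp_add]
    simp [besselF]
  · have hF := (hderiv 1 x).ofReal_comp
    have hF' := ((hderivI X x).ofReal_comp).const_mul Complex.I
    convert! (hF.add hF').mul (hexp x) using 1
    simp only [mul_one, Complex.I_mul_re, Complex.I_mul_im, Complex.ofReal_neg, Pi.add_apply]
    rw [← hsum x]
    push_cast
    linear_combination (((besselInt n X x).im : ℂ) * Complex.exp (-(Complex.I * x))) *
      Complex.I_sq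
  · have hc : Continuous (besselInt (n + 2) 1) :=
      continuous_iff_continuousAt.2 fun x => (hasDerivAt_besselInt _ _ x).continuousAt
    have := Complex.continuous_re.comp hc
    fun_prop
  · rw [norm_mul, hnorm, mul_one]
    refine (norm_add_le _ _).trans ?_
    rw [norm_mul, Complex.norm_I, one_mul, Complex.norm_real, Complex.norm_real]
    have a0 := (Complex.abs_re_le_norm (besselInt n 1 x)).trans (h0 x hx)
    have a1 := (Complex.abs_im_le_norm (besselInt n X x)).trans (h1 x hx)
    have a2 : 0 ≤ C₂ * x ^ (-((n : ℝ) + 1) / 2) := by positivity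
    rw [Real.norm_eq_abs, Real.norm_eq_abs]
    linarith
  · rw [norm_mul, hnorm, mul_one, norm_mul, norm_neg, Complex.norm_I, one_mul, Complex.norm_real]
    have a0 := (Complex.abs_re_le_norm (besselInt (n + 2) 1 x)).trans (h2 x hx)
    have e : (-(((n + 2 : ℕ) : ℝ) + 1) / 2) = -((n : ℝ) + 3) / 2 := by push_cast; ring
    rw [e] at a0
    have a2 : 0 ≤ (C₀ + C₁) * x ^ (-((n : ℝ) + 3) / 2) := by positivity
    rw [Real.norm_eq_abs]
    linarith

end Bessel

/-! ### The Fourier transform of a ball -/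

section Ball

variable {d : ℕ}

/-- The volume of the unit ball of `ℝ^d`. -/
noncomputable def ballVol (d : ℕ) : ℝ :=
  (volume : Measure (EuclideanSpace ℝ (Fin d))).real (Metric.ball 0 1)

theorem volume_real_sum_sq_le (d : ℕ) {r : ℝ} (hr : 0 ≤ r) :
    (volume : Measure (Fin d → ℝ)).real {y | ∑ i, y i ^ 2 ≤ r ^ 2} = r ^ d * ballVol d := by
  have h1 := Measure.addHaar_real_closedBall
    (volume : Measure (EuclideanSpace ℝ (Fin d))) 0 hr
  rw [finrank_euclideanSpace_fin] at h1
  rw [ballVol, ← h1, Measure.real, Measure.real]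
  congr 1
  rw [← (PiLp.volume_preserving_toLp (Fin d)).measure_preimage
    measurableSet_closedBall.nullMeasurableSet]
  congr 1
  ext y
  rw [mem_preimage, mem_closedBall_zero_iff, ← abs_of_nonneg hr, ← abs_norm, ← sq_le_sq,
    EuclideanSpace.real_norm_sq_eq, sq_abs]
  rfl

/-- Slicing a ball of `ℝ^{d+1}` perpendicularly to the first axis. -/
theorem setIntegral_closedBall_apply_zero {φ : ℝ → ℂ} (hφ : Continuous φ) (hd : 0 < d) {τ : ℝ}
    (hτ : 0 < τ) :
    ∫ v in Metric.closedBall (0 : EuclideanSpace ℝ (Fin (d + 1))) τ, φ (v 0) =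
      ballVol d * τ ^ (d + 1) *
        ∫ θ in (0 : ℝ)..Real.pi, ((Real.sin θ ^ (d + 1) : ℝ) : ℂ) * φ (τ * Real.cos θ) := by
  have hmp := (PiLp.volume_preserving_toLp (Fin (d + 1))).comp
    (volume_preserving_piFinSuccAbove (fun _ : Fin (d + 1) => ℝ) 0).symm
  have hme : MeasurableEmbedding (WithLp.toLp 2 ∘
      (MeasurableEquiv.piFinSuccAbove (fun _ : Fin (d + 1) => ℝ) 0).symm) :=
    (MeasurableEquiv.toLp 2 (Fin (d + 1) → ℝ)).measurableEmbedding.comp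
      (MeasurableEquiv.measurableEmbedding _)
  have hpre : (WithLp.toLp 2 ∘ (MeasurableEquiv.piFinSuccAbove (fun _ : Fin (d + 1) => ℝ) 0).symm)
      ⁻¹' (Metric.closedBall (0 : EuclideanSpace ℝ (Fin (d + 1))) τ) =
      {p : ℝ × (Fin d → ℝ) | p.1 ^ 2 + ∑ i, p.2 i ^ 2 ≤ τ ^ 2} := by
    ext p
    rw [mem_preimage, mem_closedBall_zero_iff, ← abs_of_pos hτ, ← abs_norm, ← sq_le_sq,
      EuclideanSpace.real_norm_sq_eq, sq_abs, Fin.sum_univ_succ]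
    rfl
  rw [← hmp.setIntegral_preimage_emb hme, hpre]
  have hval : ∀ p : ℝ × (Fin d → ℝ), ((WithLp.toLp 2 ∘
      (MeasurableEquiv.piFinSuccAbove (fun _ : Fin (d + 1) => ℝ) 0).symm) p).ofLp 0 = p.1 :=
    fun p => rfl
  simp only [hval]
  set S : Set (ℝ × (Fin d → ℝ)) := {p | p.1 ^ 2 + ∑ i, p.2 i ^ 2 ≤ τ ^ 2} with hS
  have hSc : IsClosed S := isClosed_le (by fun_prop) (by fun_prop)
  have hSb : S ⊆ Metric.closedBall 0 τ := by
    intro p hp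
    have hp' : p.1 ^ 2 + ∑ i, p.2 i ^ 2 ≤ τ ^ 2 := hp
    have hs : 0 ≤ ∑ i, p.2 i ^ 2 := Finset.sum_nonneg fun i _ => sq_nonneg _
    rw [mem_closedBall_zero_iff, Prod.norm_def, max_le_iff]
    refine ⟨abs_le_of_sq_le_sq (by linarith) hτ.le, ?_⟩
    refine (pi_norm_le_iff_of_nonneg hτ.le).2 fun i => abs_le_of_sq_le_sq ?_ hτ.le
    have := Finset.single_le_sum (f := fun i => p.2 i ^ 2) (fun i _ => sq_nonneg _)
      (Finset.mem_univ i)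
    nlinarith [sq_nonneg p.1]
  have hSk : IsCompact S := (isCompact_closedBall _ _).of_isClosed_subset hSc hSb
  have hint : Integrable (S.indicator fun p : ℝ × (Fin d → ℝ) => φ p.1) := by
    rw [integrable_indicator_iff hSc.measurableSet]
    exact ContinuousOn.integrableOn_compact hSk (by fun_prop)
  rw [← integral_indicator hSc.measurableSet, Measure.volume_eq_prod, integral_prod _ hint]
  have hin : ∀ u : ℝ, ∫ y : Fin d → ℝ, S.indicator (fun p : ℝ × (Fin d → ℝ) => φ p.1) (u, y) =
      (Ioc (-τ) τ).indicator
        (fun u => (Real.sqrt (τ ^ 2 - u ^ 2) ^ d * ballVol d : ℝ) * φ u) u := by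
    intro u
    have h1 : ∀ y : Fin d → ℝ, S.indicator (fun p : ℝ × (Fin d → ℝ) => φ p.1) (u, y) =
        {y : Fin d → ℝ | ∑ i, y i ^ 2 ≤ τ ^ 2 - u ^ 2}.indicator (fun _ => φ u) y := by
      intro y
      simp only [indicator, hS, mem_ofPred_eq, le_sub_iff_add_le']
    simp_rw [h1]
    have hm : MeasurableSet {y : Fin d → ℝ | ∑ i, y i ^ 2 ≤ τ ^ 2 - u ^ 2} :=
      (isClosed_le (by fun_prop) (by fun_prop)).measurableSet
    rw [integral_indicator hm, setIntegral_const, Complex.real_smul]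
    rcases le_or_gt 0 (τ ^ 2 - u ^ 2) with h0 | h0
    · have h2 := volume_real_sum_sq_le d (Real.sqrt_nonneg (τ ^ 2 - u ^ 2))
      rw [Real.sq_sqrt h0] at h2
      rw [h2]
      have h3 : |u| ≤ τ := abs_le_of_sq_le_sq (by linarith) hτ.le
      by_cases hu : u ∈ Ioc (-τ) τ
      · rw [indicator_of_mem hu]
      · have : u = -τ := by
          have h4 := abs_le.1 h3
          by_contra hne
          exact hu ⟨lt_of_le_of_ne h4.1 (Ne.symm hne), h4.2⟩
        rw [indicator_of_notMem hu, this]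
        simp [hd.ne']
    · have he : {y : Fin d → ℝ | ∑ i, y i ^ 2 ≤ τ ^ 2 - u ^ 2} = ∅ := by
        refine eq_empty_of_forall_notMem fun y hy => ?_
        have hy' : ∑ i, y i ^ 2 ≤ τ ^ 2 - u ^ 2 := hy
        have : 0 ≤ ∑ i, y i ^ 2 := Finset.sum_nonneg fun i _ => sq_nonneg _
        linarith
      have hu : u ∉ Ioc (-τ) τ := by
        rintro ⟨h1, h2⟩
        nlinarith
      rw [he, indicator_of_notMem hu]
      simp
  simp_rw [hin]
  rw [integral_indicator measurableSet_Ioc, ← intervalIntegral.integral_of_le (by linarith)]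
  have hsub := intervalIntegral.integral_deriv_smul_comp (a := 0) (b := Real.pi)
    (f := fun θ => τ * Real.cos θ) (f' := fun θ => τ * -Real.sin θ)
    (g := fun u => ((Real.sqrt (τ ^ 2 - u ^ 2) ^ d * ballVol d : ℝ) : ℂ) * φ u)
    (fun θ _ => (Real.hasDerivAt_cos θ).const_mul τ) (by fun_prop) (by fun_prop)
  simp only [Real.cos_zero, Real.cos_pi, mul_one, mul_neg] at hsub
  rw [intervalIntegral.integral_symm, ← hsub, ← intervalIntegral.integral_neg,
    ← intervalIntegral.integral_const_mul]
  refine intervalIntegral.integral_congr fun θ hθ => ?_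
  rw [uIcc_of_le Real.pi_pos.le] at hθ
  have hs : 0 ≤ Real.sin θ := Real.sin_nonneg_of_mem_Icc hθ
  have hsq : Real.sqrt (τ ^ 2 - (τ * Real.cos θ) ^ 2) = τ * Real.sin θ := by
    have : τ ^ 2 - (τ * Real.cos θ) ^ 2 = (τ * Real.sin θ) ^ 2 := by
      rw [mul_pow, mul_pow, Real.sin_sq]; ring
    rw [this, Real.sqrt_sq (by positivity)]
  simp only [Function.comp_apply, hsq, Complex.real_smul]
  push_cast
  ring

theorem besselInt_one_eq (n : ℕ) (x : ℝ) : besselInt n 1 x = besselF n x := by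
  have h : (starRingEnd ℂ) (besselInt n 1 x) = besselInt n 1 x := by
    have h1 : (starRingEnd ℂ) (besselInt n 1 x) = ∫ θ in (0 : ℝ)..Real.pi,
        ((Real.sin θ ^ n : ℝ) : ℂ) * Complex.exp (-(Complex.I * x * Real.cos θ)) := by
      rw [besselInt, intervalIntegral.integral_of_le Real.pi_pos.le,
        intervalIntegral.integral_of_le Real.pi_pos.le, ← integral_conj]
      refine integral_congr_ae (ae_of_all _ fun θ => ?_)
      simp only [Polynomial.eval_one, mul_one, map_mul, ← Complex.exp_conj, Complex.conj_I,
        Complex.conj_ofReal]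
      congr 2
      ring
    have h2 := intervalIntegral.integral_comp_sub_left (a := 0) (b := Real.pi)
      (fun θ => ((Real.sin θ ^ n : ℝ) : ℂ) * Complex.exp (Complex.I * x * Real.cos θ)) Real.pi
    simp only [Real.sin_pi_sub, Real.cos_pi_sub, sub_self, sub_zero] at h2
    rw [h1, besselInt]
    simp only [Polynomial.eval_one, mul_one]
    rw [← h2]
    refine intervalIntegral.integral_congr fun θ _ => ?_
    congr 2
    push_cast
    ring
  rw [besselF, Complex.conj_eq_iff_re.1 h]

/-- The Fourier transform of a ball of radius `τ` in `ℝ^{d+1}`. -/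
theorem fourier_indicator_closedBall (hd : 0 < d) {τ : ℝ} (hτ : 0 < τ)
    (ξ : EuclideanSpace ℝ (Fin (d + 1))) :
    𝓕 ((Metric.closedBall (0 : EuclideanSpace ℝ (Fin (d + 1))) τ).indicator fun _ => (1 : ℂ)) ξ =
      ((ballVol d * τ ^ (d + 1) * besselF (d + 1) (2 * Real.pi * τ * ‖ξ‖) : ℝ) : ℂ) := by
  let e : EuclideanSpace ℝ (Fin (d + 1)) := EuclideanSpace.single 0 1
  have he : ‖ξ‖ = ‖(-‖ξ‖) • e‖ := by simp [e, norm_smul]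
  let R := (ℝ ∙ (ξ - (-‖ξ‖) • e))ᗮ.reflection
  have hR : R ξ = (-‖ξ‖) • e := Submodule.reflection_sub he
  have h1 : ∀ v, inner ℝ v ξ = -(‖ξ‖ * (R v) 0) := by
    intro v
    rw [← R.inner_map_map v ξ, hR, inner_smul_right]
    simp [e, EuclideanSpace.inner_single_right]
  have h2 := R.measurePreserving.setIntegral_preimage_emb R.toHomeomorph.measurableEmbedding
    (fun v => Complex.exp (((-2 * Real.pi * -(‖ξ‖ * v 0) : ℝ) : ℂ) * Complex.I))
    (Metric.closedBall 0 τ)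
  rw [LinearIsometryEquiv.preimage_closedBall, map_zero] at h2
  have h3 := setIntegral_closedBall_apply_zero (d := d)
    (φ := fun u => Complex.exp (((-2 * Real.pi * -(‖ξ‖ * u) : ℝ) : ℂ) * Complex.I))
    (by fun_prop) hd hτ
  rw [Real.fourier_eq']
  have h4 : ∀ v : EuclideanSpace ℝ (Fin (d + 1)),
      Complex.exp (((-2 * Real.pi * inner ℝ v ξ : ℝ) : ℂ) * Complex.I) •
        (Metric.closedBall (0 : EuclideanSpace ℝ (Fin (d + 1))) τ).indicator
          (fun _ => (1 : ℂ)) v =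
      (Metric.closedBall (0 : EuclideanSpace ℝ (Fin (d + 1))) τ).indicator
        (fun v => Complex.exp (((-2 * Real.pi * -(‖ξ‖ * (R v) 0) : ℝ) : ℂ) * Complex.I)) v := by
    intro v
    simp only [indicator, h1]
    split_ifs <;> simp
  simp_rw [h4]
  rw [integral_indicator measurableSet_closedBall]
  refine h2.trans (h3.trans ?_)
  push_cast
  rw [← besselInt_one_eq, besselInt]
  congr 1
  refine intervalIntegral.integral_congr fun θ _ => ?_
  simp only [Polynomial.eval_one, mul_one]
  push_cast
  congr 2
  ring

end Ball

/-! ### Oscillatory integrals with linear phase -/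

section Oscillation

theorem norm_exp_I_mul_ofReal (x : ℝ) : ‖Complex.exp (Complex.I * x)‖ = 1 := by
  rw [mul_comm, Complex.norm_exp_ofReal_mul_I]

/-- A linear phase of slope `B` gains a factor `1 / |B|` against an amplitude with bounded
derivative. -/
theorem norm_integral_exp_mul_le {A A' : ℝ → ℂ} {K ε B c : ℝ} (hε : 0 ≤ ε) (hB : 0 < |B|)
    (hA : ∀ s ∈ Icc 0 ε, HasDerivAt A (A' s) s) (hA' : ContinuousOn A' (Icc 0 ε))
    (hAK : ∀ s ∈ Icc 0 ε, ‖A s‖ ≤ K) (hAK' : ∀ s ∈ Icc 0 ε, ‖A' s‖ ≤ K) :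
    ‖∫ s in (0 : ℝ)..ε, Complex.exp (Complex.I * ((c + B * s : ℝ) : ℂ)) * A s‖ ≤
      (2 + ε) * K / |B| := by
  have hB0 : B ≠ 0 := abs_pos.1 hB
  have hBC : (B : ℂ) ≠ 0 := by exact_mod_cast hB0
  have hu : uIcc 0 ε = Icc 0 ε := uIcc_of_le hε
  let v : ℝ → ℂ := fun s => Complex.exp (Complex.I * ((c + B * s : ℝ) : ℂ))
  have hv : ∀ s ∈ uIcc 0 ε, HasDerivAt v (Complex.I * B * v s) s := by
    intro s _
    have h1 : HasDerivAt (fun s : ℝ => c + B * s) B s := by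
      simpa using ((hasDerivAt_id s).const_mul B).const_add c
    have h2 := (h1.ofReal_comp.const_mul Complex.I).cexp
    convert! h2 using 1
    simp only [v]
    ring
  have hvn : ∀ s, ‖v s‖ = 1 := fun s => norm_exp_I_mul_ofReal _
  have hvc : Continuous v := by fun_prop
  have key := intervalIntegral.integral_mul_deriv_eq_deriv_mul (a := 0) (b := ε) (u := A) (v := v)
    (fun s hs => hA s (hu ▸ hs)) hv (by
      refine ContinuousOn.intervalIntegrable ?_
      rwa [hu]) (Continuous.intervalIntegrable (by fun_prop) _ _)
  have h1 : ∫ s in (0 : ℝ)..ε, A s * (Complex.I * B * v s) =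
      Complex.I * B * ∫ s in (0 : ℝ)..ε, v s * A s := by
    rw [← intervalIntegral.integral_const_mul]
    refine intervalIntegral.integral_congr fun s _ => ?_
    ring
  rw [h1] at key
  have hn := congrArg norm key
  rw [norm_mul, norm_mul, Complex.norm_I, one_mul, Complex.norm_real, Real.norm_eq_abs] at hn
  rw [le_div_iff₀ hB, mul_comm]
  refine hn.le.trans ?_
  have hb : ∀ s ∈ Icc 0 ε, ‖A s * v s‖ ≤ K := by
    intro s hs
    rw [norm_mul, hvn, mul_one]
    exact hAK s hs
  have hi : ‖∫ s in (0 : ℝ)..ε, A' s * v s‖ ≤ K * ε := by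
    have := intervalIntegral.norm_integral_le_of_norm_le_const (a := 0) (b := ε)
      (f := fun s => A' s * v s) (C := K) (fun s hs => by
        rw [uIoc_of_le hε] at hs
        rw [norm_mul, hvn, mul_one]
        exact hAK' s (Ioc_subset_Icc_self hs))
    rwa [sub_zero, abs_of_nonneg hε] at this
  calc _ ≤ ‖A ε * v ε‖ + ‖A 0 * v 0‖ + _ :=
        (norm_sub_le _ _).trans (add_le_add_left (norm_sub_le _ _) _)
    _ ≤ K + K + K * ε := add_le_add (add_le_add (hb ε ⟨hε, le_rfl⟩) (hb 0 ⟨le_rfl, hε⟩)) hi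
    _ = (2 + ε) * K := by ring

theorem re_mul_re (z w : ℂ) :
    z.re * w.re = (z * w).re / 2 + (z * (starRingEnd ℂ) w).re / 2 := by
  simp only [Complex.mul_re, Complex.conj_re, Complex.conj_im]
  ring

/-- The product of two real oscillating functions with linear phases of slopes `B₁`, `B₂` has
integral `O(1 / |B₁ ± B₂|)`. -/
theorem abs_integral_re_mul_re_le {w w' : ℝ → ℝ} {P P' Q Q' : ℝ → ℂ} {Kw KP KQ ε B B₁ B₂ c₁ c₂ : ℝ}
    (hε : 0 ≤ ε) (hB : 0 < B) (hB1 : B ≤ |B₁ + B₂|) (hB2 : B ≤ |B₁ - B₂|)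
    (hw : ∀ s ∈ Icc 0 ε, HasDerivAt w (w' s) s) (hwc : ContinuousOn w' (Icc 0 ε))
    (hP : ∀ s ∈ Icc 0 ε, HasDerivAt P (P' s) s) (hPc : ContinuousOn P' (Icc 0 ε))
    (hQ : ∀ s ∈ Icc 0 ε, HasDerivAt Q (Q' s) s) (hQc : ContinuousOn Q' (Icc 0 ε))
    (hwK : ∀ s ∈ Icc 0 ε, |w s| ≤ Kw) (hwK' : ∀ s ∈ Icc 0 ε, |w' s| ≤ Kw)
    (hPK : ∀ s ∈ Icc 0 ε, ‖P s‖ ≤ KP) (hPK' : ∀ s ∈ Icc 0 ε, ‖P' s‖ ≤ KP)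
    (hQK : ∀ s ∈ Icc 0 ε, ‖Q s‖ ≤ KQ) (hQK' : ∀ s ∈ Icc 0 ε, ‖Q' s‖ ≤ KQ) :
    |∫ s in (0 : ℝ)..ε, w s * ((Complex.exp (Complex.I * ((c₁ + B₁ * s : ℝ) : ℂ)) * P s).re *
      (Complex.exp (Complex.I * ((c₂ + B₂ * s : ℝ) : ℂ)) * Q s).re)| ≤
      (2 + ε) * (3 * (Kw * KP * KQ)) / B := by
  have h0 : (0 : ℝ) ∈ Icc 0 ε := ⟨le_rfl, hε⟩
  have hKw : 0 ≤ Kw := (abs_nonneg _).trans (hwK 0 h0)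
  have hKP : 0 ≤ KP := (norm_nonneg _).trans (hPK 0 h0)
  have hKQ : 0 ≤ KQ := (norm_nonneg _).trans (hQK 0 h0)
  have hK : 0 ≤ Kw * KP * KQ := by positivity
  have main : ∀ (R R' : ℝ → ℂ) (D c : ℝ), B ≤ |D| → (∀ s ∈ Icc 0 ε, HasDerivAt R (R' s) s) →
      ContinuousOn R' (Icc 0 ε) → (∀ s ∈ Icc 0 ε, ‖R s‖ ≤ KQ) → (∀ s ∈ Icc 0 ε, ‖R' s‖ ≤ KQ) →
      IntervalIntegrable (fun s => (Complex.exp (Complex.I * ((c + D * s : ℝ) : ℂ)) *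
        ((w s : ℂ) * P s * R s)).re) volume 0 ε ∧
      |∫ s in (0 : ℝ)..ε, (Complex.exp (Complex.I * ((c + D * s : ℝ) : ℂ)) *
        ((w s : ℂ) * P s * R s)).re| ≤ (2 + ε) * (3 * (Kw * KP * KQ)) / B := by
    intro R R' D c hD hR hRc hRK hRK'
    have hd : ∀ s ∈ Icc 0 ε, HasDerivAt (fun s => (w s : ℂ) * P s * R s)
        (((w' s : ℂ) * P s + w s * P' s) * R s + w s * P s * R' s) s :=
      fun s hs => ((hw s hs).ofReal_comp.mul (hP s hs)).mul (hR s hs)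
    have hwc0 : ContinuousOn w (Icc 0 ε) := fun s hs => (hw s hs).continuousAt.continuousWithinAt
    have hPc0 : ContinuousOn P (Icc 0 ε) := fun s hs => (hP s hs).continuousAt.continuousWithinAt
    have hRc0 : ContinuousOn R (Icc 0 ε) := fun s hs => (hR s hs).continuousAt.continuousWithinAt
    have hwC : ContinuousOn (fun s => (w s : ℂ)) (Icc 0 ε) :=
      Complex.continuous_ofReal.comp_continuousOn hwc0
    have hwC' : ContinuousOn (fun s => (w' s : ℂ)) (Icc 0 ε) :=
      Complex.continuous_ofReal.comp_continuousOn hwc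
    have hb := norm_integral_exp_mul_le (c := c) (B := D) (K := 3 * (Kw * KP * KQ)) hε
      (hB.trans_le hD) hd (by fun_prop)
      (fun s hs => by
        rw [norm_mul, norm_mul, Complex.norm_real]
        have a1 := hwK s hs
        have a2 := hPK s hs
        have a3 := hRK s hs
        calc _ ≤ Kw * KP * KQ := by
              rw [Real.norm_eq_abs]; gcongr
          _ ≤ _ := by linarith)
      (fun s hs => by
        have a1 := hwK s hs
        have a2 := hPK s hs
        have a3 := hRK s hs
        have a4 := hwK' s hs
        have a5 := hPK' s hs
        have a6 := hRK' s hs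
        rw [← Real.norm_eq_abs, ← Complex.norm_real] at a1 a4
        calc _ ≤ ‖((w' s : ℂ) * P s + w s * P' s) * R s‖ + ‖w s * P s * R' s‖ := norm_add_le _ _
          _ ≤ (‖(w' s : ℂ)‖ * ‖P s‖ + ‖(w s : ℂ)‖ * ‖P' s‖) * ‖R s‖ +
              ‖(w s : ℂ)‖ * ‖P s‖ * ‖R' s‖ := by
              rw [norm_mul, norm_mul, norm_mul]
              gcongr
              refine (norm_add_le _ _).trans ?_
              rw [norm_mul, norm_mul]
          _ ≤ (Kw * KP + Kw * KP) * KQ + Kw * KP * KQ := by gcongr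
          _ = _ := by ring)
    have hcont : ContinuousOn (fun s => Complex.exp (Complex.I * ((c + D * s : ℝ) : ℂ)) *
        ((w s : ℂ) * P s * R s)) (uIcc 0 ε) := by
      rw [uIcc_of_le hε]
      refine ContinuousOn.mul ?_ ((hwC.mul hPc0).mul hRc0)
      exact Continuous.continuousOn (by fun_prop)
    have hii := hcont.intervalIntegrable (μ := volume)
    have hre : ∫ s in (0 : ℝ)..ε, (Complex.exp (Complex.I * ((c + D * s : ℝ) : ℂ)) *
        ((w s : ℂ) * P s * R s)).re = (∫ s in (0 : ℝ)..ε, Complex.exp (Complex.I *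
          ((c + D * s : ℝ) : ℂ)) * ((w s : ℂ) * P s * R s)).re :=
      Complex.reCLM.intervalIntegral_comp_comm hii
    refine ⟨(Complex.continuous_re.comp_continuousOn hcont).intervalIntegrable, ?_⟩
    rw [hre]
    refine (Complex.abs_re_le_norm _).trans (hb.trans ?_)
    gcongr
  obtain ⟨i1, b1⟩ := main Q Q' (B₁ + B₂) (c₁ + c₂) hB1 hQ hQc hQK hQK'
  obtain ⟨i2, b2⟩ := main (fun s => (starRingEnd ℂ) (Q s)) (fun s => (starRingEnd ℂ) (Q' s))
    (B₁ - B₂) (c₁ - c₂) hB2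
    (fun s hs => Complex.conjCLE.hasFDerivAt.comp_hasDerivAt s (hQ s hs))
    (Complex.continuous_conj.comp_continuousOn hQc)
    (fun s hs => by simpa using hQK s hs) (fun s hs => by simpa using hQK' s hs)
  have hsplit : ∀ s, w s * ((Complex.exp (Complex.I * ((c₁ + B₁ * s : ℝ) : ℂ)) * P s).re *
      (Complex.exp (Complex.I * ((c₂ + B₂ * s : ℝ) : ℂ)) * Q s).re) =
      (Complex.exp (Complex.I * ((c₁ + c₂ + (B₁ + B₂) * s : ℝ) : ℂ)) *
        ((w s : ℂ) * P s * Q s)).re / 2 +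
      (Complex.exp (Complex.I * ((c₁ - c₂ + (B₁ - B₂) * s : ℝ) : ℂ)) *
        ((w s : ℂ) * P s * (starRingEnd ℂ) (Q s))).re / 2 := by
    intro s
    have e1 : Complex.exp (Complex.I * ((c₁ + c₂ + (B₁ + B₂) * s : ℝ) : ℂ)) *
        ((w s : ℂ) * P s * Q s) = w s * ((Complex.exp (Complex.I * ((c₁ + B₁ * s : ℝ) : ℂ)) * P s) *
        (Complex.exp (Complex.I * ((c₂ + B₂ * s : ℝ) : ℂ)) * Q s)) := by
      have : Complex.I * ((c₁ + c₂ + (B₁ + B₂) * s : ℝ) : ℂ) =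
          Complex.I * ((c₁ + B₁ * s : ℝ) : ℂ) + Complex.I * ((c₂ + B₂ * s : ℝ) : ℂ) := by
        push_cast; ring
      rw [this, Complex.exp_add]; ring
    have e2 : Complex.exp (Complex.I * ((c₁ - c₂ + (B₁ - B₂) * s : ℝ) : ℂ)) *
        ((w s : ℂ) * P s * (starRingEnd ℂ) (Q s)) =
        w s * ((Complex.exp (Complex.I * ((c₁ + B₁ * s : ℝ) : ℂ)) * P s) *
        (starRingEnd ℂ) (Complex.exp (Complex.I * ((c₂ + B₂ * s : ℝ) : ℂ)) * Q s)) := by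
      have : Complex.I * ((c₁ - c₂ + (B₁ - B₂) * s : ℝ) : ℂ) =
          Complex.I * ((c₁ + B₁ * s : ℝ) : ℂ) + -Complex.I * ((c₂ + B₂ * s : ℝ) : ℂ) := by
        push_cast; ring
      rw [this, Complex.exp_add, map_mul, ← Complex.exp_conj, map_mul, Complex.conj_I,
        Complex.conj_ofReal]
      ring
    rw [e1, e2, Complex.re_ofReal_mul, Complex.re_ofReal_mul, re_mul_re]
    ring
  simp_rw [hsplit]
  rw [intervalIntegral.integral_add (i1.div_const 2) (i2.div_const 2),
    intervalIntegral.integral_div, intervalIntegral.integral_div]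
  refine (abs_add_le _ _).trans ?_
  rw [abs_div, abs_div, abs_two]
  linarith

end Oscillation

/-! ### The Fourier coefficients of a mollified ball -/

section Coefficients

/-- A function `E` on `ℝⁿ`, such as the real part of the Fourier transform of a mollifier, that
decays together with its derivative at the rate needed for the lattice sums. The exponent `4`
suffices for `n ≤ 3`, where it is at least `n + 1`. -/
structure IsCutoff {n : ℕ} (E : EuclideanSpace ℝ (Fin n) → ℝ) (C : ℝ) : Prop where
  contDiff : ContDiff ℝ 1 E
  nonneg : 0 ≤ C
  even : ∀ ξ, E (-ξ) = E ξ
  bound : ∀ ξ, |E ξ| ≤ C / (1 + ‖ξ‖) ^ 4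
  bound_fderiv : ∀ ξ, ‖fderiv ℝ E ξ‖ ≤ C / (1 + ‖ξ‖) ^ 5

/-- The Fourier transform at `ξ` of the indicator of the ball of radius `τ` in `ℝ^{d+1}`, mollified
at scale `δ` with a mollifier of Fourier transform `E`. -/
noncomputable def ballCoeff {d : ℕ} (E : EuclideanSpace ℝ (Fin (d + 1)) → ℝ) (τ δ : ℝ)
    (ξ : EuclideanSpace ℝ (Fin (d + 1))) : ℝ :=
  ballVol d * τ ^ (d + 1) * besselF (d + 1) (2 * Real.pi * τ * ‖ξ‖) * E (δ • ξ)

/-- The size `|ξ|^{-(n+1)/2} (1 + δ|ξ|)^{-4}` of the coefficients, up to powers of `τ`. -/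
noncomputable def coeffSize (n : ℕ) (δ r : ℝ) : ℝ :=
  r ^ (-((n : ℝ) + 1) / 2) / (1 + δ * r) ^ 4

theorem continuous_besselF (n : ℕ) : Continuous (besselF n) := by
  have hc : Continuous (besselInt n 1) :=
    continuous_iff_continuousAt.2 fun x => (hasDerivAt_besselInt _ _ x).continuousAt
  exact Complex.continuous_re.comp hc

variable {d : ℕ} {E : EuclideanSpace ℝ (Fin (d + 1)) → ℝ} {C : ℝ}

theorem ballVol_nonneg (d : ℕ) : 0 ≤ ballVol d := measureReal_nonneg

theorem continuous_ballCoeff (hE : IsCutoff E C) (τ δ : ℝ) : Continuous (ballCoeff E τ δ) := by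
  have h1 := continuous_besselF (d + 1)
  have h2 := hE.contDiff.continuous
  unfold ballCoeff
  fun_prop

theorem ballCoeff_neg (hE : IsCutoff E C) (τ δ : ℝ) (ξ : EuclideanSpace ℝ (Fin (d + 1))) :
    ballCoeff E τ δ (-ξ) = ballCoeff E τ δ ξ := by
  rw [ballCoeff, ballCoeff, norm_neg, smul_neg, hE.even]

theorem exists_bound_ballCoeff (hE : IsCutoff E C) (τ δ : ℝ) :
    ∃ D : ℝ, ∀ ξ, |ballCoeff E τ δ ξ| ≤ D := by
  obtain ⟨B, hB0, hB⟩ := norm_besselInt_le (d + 1) 1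
  refine ⟨|ballVol d * τ ^ (d + 1)| * B * C, fun ξ => ?_⟩
  rw [ballCoeff, abs_mul, abs_mul]
  gcongr
  · exact (Complex.abs_re_le_norm _).trans (hB _)
  · refine (hE.bound _).trans (div_le_self hE.nonneg ?_)
    exact one_le_pow₀ (by linarith [norm_nonneg (δ • ξ)])

/-- Along a ray the coefficients oscillate with linear phase and slowly varying amplitude. -/
theorem exists_ray_amplitude (hE : IsCutoff E C) : ∃ D : ℝ, 0 ≤ D ∧
    ∀ (τ δ α : ℝ) (ξ : EuclideanSpace ℝ (Fin (d + 1))), 0 < τ → 0 < δ → 0 ≤ α → α ≤ 2 → ξ ≠ 0 →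
    ∃ P P' : ℝ → ℂ,
      (∀ s ∈ Icc (0 : ℝ) 1, ballCoeff E τ δ ((1 + α * s) • ξ) =
        (Complex.exp (Complex.I * ((2 * Real.pi * τ * ‖ξ‖ + 2 * Real.pi * τ * (α * ‖ξ‖) * s : ℝ) : ℂ))
          * P s).re) ∧
      (∀ s ∈ Icc (0 : ℝ) 1, HasDerivAt P (P' s) s) ∧ Continuous P' ∧
      (∀ s ∈ Icc (0 : ℝ) 1, ‖P s‖ ≤ D * (τ ^ ((d : ℝ) / 2) * coeffSize (d + 1) δ ‖ξ‖)) ∧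
      (∀ s ∈ Icc (0 : ℝ) 1, ‖P' s‖ ≤ D * (τ ^ ((d : ℝ) / 2) * coeffSize (d + 1) δ ‖ξ‖)) := by
  obtain ⟨b, b', B, hB0, hF, hb, hbc, hbB, hbB'⟩ := exists_amplitude (d + 1)
  have hκ := ballVol_nonneg d
  have hC := hE.nonneg
  refine ⟨4 * (ballVol d * B * C), by positivity, fun τ δ α ξ hτ hδ hα hα2 hξ => ?_⟩
  have hr : 0 < ‖ξ‖ := norm_pos_iff.2 hξ
  set r := ‖ξ‖ with hrdef
  have hπ := Real.pi_pos
  set x : ℝ := 2 * Real.pi * τ * r with hx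
  have hx0 : 0 < x := by positivity
  have hxr : τ * r ≤ x := by
    have : 1 ≤ 2 * Real.pi := by linarith [Real.pi_gt_three]
    calc τ * r = 1 * (τ * r) := (one_mul _).symm
      _ ≤ 2 * Real.pi * (τ * r) := by gcongr
      _ = x := by rw [hx]; ring
  let P : ℝ → ℂ := fun s => ((ballVol d * τ ^ (d + 1) : ℝ) : ℂ) *
    (b (x * (1 + α * s)) * ((E (((1 + α * s) * δ) • ξ) : ℝ) : ℂ))
  let P' : ℝ → ℂ := fun s => ((ballVol d * τ ^ (d + 1) : ℝ) : ℂ) *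
    (((x * α : ℝ) : ℂ) * b' (x * (1 + α * s)) * ((E (((1 + α * s) * δ) • ξ) : ℝ) : ℂ) +
      b (x * (1 + α * s)) * ((fderiv ℝ E (((1 + α * s) * δ) • ξ) ((α * δ) • ξ) : ℝ) : ℂ))
  have hlin : ∀ s, HasDerivAt (fun s : ℝ => 1 + α * s) α s := fun s => by
    simpa using ((hasDerivAt_id s).const_mul α).const_add 1
  have hnorm : ∀ s ∈ Icc (0 : ℝ) 1, ‖((1 + α * s) * δ) • ξ‖ = (1 + α * s) * δ * r := by
    intro s hs
    have : 0 ≤ α * s := mul_nonneg hα hs.1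
    rw [norm_smul, Real.norm_of_nonneg (by positivity)]
  have hge : ∀ s ∈ Icc (0 : ℝ) 1, 1 ≤ 1 + α * s := fun s hs => by
    have : 0 ≤ α * s := mul_nonneg hα hs.1
    linarith
  have hδr : 0 ≤ δ * r := by positivity
  have hden : ∀ s ∈ Icc (0 : ℝ) 1, 1 + δ * r ≤ 1 + ‖((1 + α * s) * δ) • ξ‖ := by
    intro s hs
    rw [hnorm s hs]
    have := hge s hs
    nlinarith
  -- `τ^{d+1}` times the decay of the Bessel function at `x ≥ τr` leaves `τ^{d/2}`
  have hpow : τ ^ (d + 1) * (x ^ (-(((d + 1 : ℕ) : ℝ) + 1) / 2)) ≤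
      τ ^ ((d : ℝ) / 2) * r ^ (-(((d + 1 : ℕ) : ℝ) + 1) / 2) := by
    have hexp : -(((d + 1 : ℕ) : ℝ) + 1) / 2 ≤ 0 := by
      have : (0 : ℝ) ≤ ((d + 1 : ℕ) : ℝ) := Nat.cast_nonneg _
      linarith
    calc _ ≤ τ ^ (d + 1) * ((τ * r) ^ (-(((d + 1 : ℕ) : ℝ) + 1) / 2)) := by
          gcongr 1
          exact Real.rpow_le_rpow_of_nonpos (by positivity) hxr hexp
      _ = _ := by
          rw [Real.mul_rpow hτ.le hr.le, ← mul_assoc, ← Real.rpow_natCast, ← Real.rpow_add hτ]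
          congr 2
          push_cast
          ring
  have hbb : ∀ s ∈ Icc (0 : ℝ) 1, ‖b (x * (1 + α * s))‖ ≤
      B * x ^ (-(((d + 1 : ℕ) : ℝ) + 1) / 2) := by
    intro s hs
    have h1 := hge s hs
    refine (hbB _ (by positivity)).trans ?_
    gcongr 1
    refine Real.rpow_le_rpow_of_nonpos hx0 (by nlinarith) ?_
    have : (0 : ℝ) ≤ ((d + 1 : ℕ) : ℝ) := Nat.cast_nonneg _
    linarith
  have hbb' : ∀ s ∈ Icc (0 : ℝ) 1, x * ‖b' (x * (1 + α * s))‖ ≤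
      B * x ^ (-(((d + 1 : ℕ) : ℝ) + 1) / 2) := by
    intro s hs
    have h1 := hge s hs
    have h2 : ‖b' (x * (1 + α * s))‖ ≤ B * x ^ (-(((d + 1 : ℕ) : ℝ) + 3) / 2) := by
      refine (hbB' _ (by positivity)).trans ?_
      gcongr 1
      refine Real.rpow_le_rpow_of_nonpos hx0 (by nlinarith) ?_
      have : (0 : ℝ) ≤ ((d + 1 : ℕ) : ℝ) := Nat.cast_nonneg _
      linarith
    calc _ ≤ x * (B * x ^ (-(((d + 1 : ℕ) : ℝ) + 3) / 2)) := by gcongr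
      _ = B * (x ^ (1 : ℝ) * x ^ (-(((d + 1 : ℕ) : ℝ) + 3) / 2)) := by rw [Real.rpow_one]; ring
      _ = _ := by
          rw [← Real.rpow_add hx0]
          congr 2
          ring
  have hEE : ∀ s ∈ Icc (0 : ℝ) 1, |E (((1 + α * s) * δ) • ξ)| ≤ C / (1 + δ * r) ^ 4 := by
    intro s hs
    refine (hE.bound _).trans ?_
    have := hden s hs
    gcongr
  have hEE' : ∀ s ∈ Icc (0 : ℝ) 1, |fderiv ℝ E (((1 + α * s) * δ) • ξ) ((α * δ) • ξ)| ≤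
      2 * (C / (1 + δ * r) ^ 4) := by
    intro s hs
    rw [← Real.norm_eq_abs]
    refine (ContinuousLinearMap.le_opNorm _ _).trans ?_
    have h1 : ‖(α * δ) • ξ‖ ≤ 2 * (1 + δ * r) := by
      rw [norm_smul, Real.norm_of_nonneg (by positivity)]
      nlinarith
    have h2 : ‖fderiv ℝ E (((1 + α * s) * δ) • ξ)‖ ≤ C / (1 + δ * r) ^ 5 := by
      refine (hE.bound_fderiv _).trans ?_
      have := hden s hs
      gcongr
    calc _ ≤ C / (1 + δ * r) ^ 5 * (2 * (1 + δ * r)) := by gcongr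
      _ = _ := by
          field_simp
  have hsize : B * x ^ (-(((d + 1 : ℕ) : ℝ) + 1) / 2) * (C / (1 + δ * r) ^ 4) *
      (ballVol d * τ ^ (d + 1)) ≤
      ballVol d * B * C * (τ ^ ((d : ℝ) / 2) * coeffSize (d + 1) δ r) := by
    rw [coeffSize]
    calc _ = ballVol d * B * C / (1 + δ * r) ^ 4 *
          (τ ^ (d + 1) * x ^ (-(((d + 1 : ℕ) : ℝ) + 1) / 2)) := by ring
      _ ≤ ballVol d * B * C / (1 + δ * r) ^ 4 *
          (τ ^ ((d : ℝ) / 2) * r ^ (-(((d + 1 : ℕ) : ℝ) + 1) / 2)) := by gcongr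
      _ = _ := by ring
  have hS0 : 0 ≤ ballVol d * B * C * (τ ^ ((d : ℝ) / 2) * coeffSize (d + 1) δ r) := by
    rw [coeffSize]; positivity
  have hcn : ‖((ballVol d * τ ^ (d + 1) : ℝ) : ℂ)‖ = ballVol d * τ ^ (d + 1) := by
    rw [Complex.norm_real, Real.norm_of_nonneg (by positivity)]
  refine ⟨P, P', fun s hs => ?_, fun s hs => ?_, ?_, fun s hs => ?_, fun s hs => ?_⟩
  · have h1 : 0 ≤ 1 + α * s := by linarith [hge s hs]
    have h2 : 2 * Real.pi * τ * ‖(1 + α * s) • ξ‖ = x * (1 + α * s) := by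
      rw [norm_smul, Real.norm_of_nonneg h1, hx]; ring
    rw [ballCoeff, h2, hF, smul_smul, mul_comm δ]
    have h3 : 2 * Real.pi * τ * r + 2 * Real.pi * τ * (α * r) * s = x * (1 + α * s) := by
      rw [hx]; ring
    rw [h3]
    simp only [P]
    rw [← Complex.re_ofReal_mul, mul_comm _ (E _), ← Complex.re_ofReal_mul]
    congr 1
    ring
  · have h1 : HasDerivAt (fun s : ℝ => b (x * (1 + α * s)))
        (((x * α : ℝ) : ℂ) * b' (x * (1 + α * s))) s := by
      have := (hb (x * (1 + α * s))).scomp s ((hlin s).const_mul x)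
      convert! this using 1
    have h2 : HasDerivAt (fun s : ℝ => E (((1 + α * s) * δ) • ξ))
        (fderiv ℝ E (((1 + α * s) * δ) • ξ) ((α * δ) • ξ)) s := by
      have h3 : HasDerivAt (fun s : ℝ => ((1 + α * s) * δ) • ξ) ((α * δ) • ξ) s :=
        ((hlin s).mul_const δ).smul_const ξ
      exact ((hE.contDiff.differentiable one_ne_zero) _).hasFDerivAt.comp_hasDerivAt s h3
    exact (h1.mul h2.ofReal_comp).const_mul _
  · have hbcont : Continuous b := continuous_iff_continuousAt.2 fun x => (hb x).continuousAt
    have h1 := hE.contDiff.continuous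
    have h2 := hE.contDiff.continuous_fderiv one_ne_zero
    have h3 : Continuous fun s : ℝ => fderiv ℝ E (((1 + α * s) * δ) • ξ) ((α * δ) • ξ) :=
      (h2.comp (by fun_prop)).clm_apply continuous_const
    have h4 : Continuous fun s : ℝ => ((fderiv ℝ E (((1 + α * s) * δ) • ξ) ((α * δ) • ξ) : ℝ) : ℂ) :=
      Complex.continuous_ofReal.comp h3
    fun_prop
  · simp only [P]
    rw [norm_mul, norm_mul, hcn, Complex.norm_real, Real.norm_eq_abs, mul_comm]
    have h1 := hbb s hs
    have h2 := hEE s hs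
    calc _ ≤ B * x ^ (-(((d + 1 : ℕ) : ℝ) + 1) / 2) * (C / (1 + δ * r) ^ 4) *
          (ballVol d * τ ^ (d + 1)) := by gcongr
      _ ≤ _ := hsize
      _ ≤ _ := by linarith
  · simp only [P']
    rw [norm_mul, hcn, mul_comm]
    have h1 := hbb s hs
    have h1' := hbb' s hs
    have h2 := hEE s hs
    have h3 := hEE' s hs
    have h4 : ‖((x * α : ℝ) : ℂ) * b' (x * (1 + α * s)) * ((E (((1 + α * s) * δ) • ξ) : ℝ) : ℂ) +
        b (x * (1 + α * s)) * ((fderiv ℝ E (((1 + α * s) * δ) • ξ) ((α * δ) • ξ) : ℝ) : ℂ)‖ ≤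
        4 * (B * x ^ (-(((d + 1 : ℕ) : ℝ) + 1) / 2) * (C / (1 + δ * r) ^ 4)) := by
      refine (norm_add_le _ _).trans ?_
      rw [norm_mul, norm_mul, norm_mul, Complex.norm_real, Complex.norm_real, Complex.norm_real,
        Real.norm_of_nonneg (by positivity : 0 ≤ x * α), Real.norm_eq_abs, Real.norm_eq_abs]
      calc _ = α * (x * ‖b' (x * (1 + α * s))‖) * |E (((1 + α * s) * δ) • ξ)| +
            ‖b (x * (1 + α * s))‖ * |fderiv ℝ E (((1 + α * s) * δ) • ξ) ((α * δ) • ξ)| := by ring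
        _ ≤ 2 * (B * x ^ (-(((d + 1 : ℕ) : ℝ) + 1) / 2)) * (C / (1 + δ * r) ^ 4) +
            (B * x ^ (-(((d + 1 : ℕ) : ℝ) + 1) / 2)) * (2 * (C / (1 + δ * r) ^ 4)) := by gcongr
        _ = _ := by ring
    calc _ ≤ 4 * (B * x ^ (-(((d + 1 : ℕ) : ℝ) + 1) / 2) * (C / (1 + δ * r) ^ 4)) *
          (ballVol d * τ ^ (d + 1)) := by gcongr
      _ ≤ _ := by linarith

end Coefficients

/-! ### Matrices as Euclidean vectors -/

section MatVec

variable {n : ℕ}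

/-- A matrix as a vector of Euclidean space, so that its norm is the Frobenius norm. -/
noncomputable def matVec (A : Matrix (Fin n) (Fin n) ℝ) : EuclideanSpace ℝ (Fin n × Fin n) :=
  WithLp.toLp 2 fun p => A p.1 p.2

theorem matVec_add (A B : Matrix (Fin n) (Fin n) ℝ) : matVec (A + B) = matVec A + matVec B := rfl

theorem matVec_smul (s : ℝ) (A : Matrix (Fin n) (Fin n) ℝ) : matVec (s • A) = s • matVec A := rfl

theorem continuous_matVec : Continuous (matVec (n := n)) := by
  refine (PiLp.continuous_toLp 2 _).comp (continuous_pi fun p => ?_)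
  exact continuous_id.matrix_elem p.1 p.2

theorem norm_matVec_sq (A : Matrix (Fin n) (Fin n) ℝ) : ‖matVec A‖ ^ 2 = ∑ i, ∑ j, A i j ^ 2 := by
  rw [EuclideanSpace.real_norm_sq_eq, Fintype.sum_prod_type]
  rfl

theorem toEuclideanLin_apply' (A : Matrix (Fin n) (Fin n) ℝ) (x : EuclideanSpace ℝ (Fin n))
    (i : Fin n) : (Matrix.toEuclideanLin A x) i = ∑ j, A i j * x j := rfl

theorem norm_toEuclideanLin_le (A : Matrix (Fin n) (Fin n) ℝ) (x : EuclideanSpace ℝ (Fin n)) :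
    ‖Matrix.toEuclideanLin A x‖ ≤ ‖matVec A‖ * ‖x‖ := by
  refine abs_le_of_sq_le_sq' ?_ (by positivity) |>.2
  rw [mul_pow, norm_matVec_sq, EuclideanSpace.real_norm_sq_eq, EuclideanSpace.real_norm_sq_eq,
    Finset.sum_mul]
  refine Finset.sum_le_sum fun i _ => ?_
  rw [toEuclideanLin_apply']
  exact Finset.sum_mul_sq_le_sq_mul_sq _ _ _

theorem norm_matVec_mul_le (A B : Matrix (Fin n) (Fin n) ℝ) :
    ‖matVec (A * B)‖ ≤ ‖matVec A‖ * ‖matVec B‖ := by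
  refine abs_le_of_sq_le_sq' ?_ (by positivity) |>.2
  rw [mul_pow, norm_matVec_sq, norm_matVec_sq, norm_matVec_sq, Finset.sum_mul]
  refine Finset.sum_le_sum fun i _ => ?_
  rw [Finset.sum_comm (f := fun i j => B i j ^ 2), Finset.mul_sum]
  refine Finset.sum_le_sum fun j _ => ?_
  rw [Matrix.mul_apply]
  exact Finset.sum_mul_sq_le_sq_mul_sq _ _ _

theorem isCompact_setOf_norm_matVec_le (A₀ : Matrix (Fin n) (Fin n) ℝ) {r : ℝ}
    (h : ∀ A, ‖matVec A - matVec A₀‖ ≤ r → A.det ≠ 0) :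
    IsCompact {Y : GL (Fin n) ℝ | ‖matVec Y.1 - matVec A₀‖ ≤ r} := by
  let S : Set (Matrix (Fin n) (Fin n) ℝ) := {A | ‖matVec A - matVec A₀‖ ≤ r}
  have hS : IsCompact S := by
    have h1 : S = (fun v : EuclideanSpace ℝ (Fin n × Fin n) =>
        (Matrix.of fun i j => v (i, j) : Matrix (Fin n) (Fin n) ℝ)) ''
          Metric.closedBall (matVec A₀) r := by
      ext A
      constructor
      · intro hA
        exact ⟨matVec A, by rwa [Metric.mem_closedBall, dist_eq_norm], rfl⟩
      · rintro ⟨v, hv, rfl⟩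
        rwa [Metric.mem_closedBall, dist_eq_norm] at hv
    rw [h1]
    refine (isCompact_closedBall _ _).image ?_
    exact continuous_matrix fun i j => by simp only [Matrix.of_apply]; fun_prop
  have : CompactSpace S := isCompact_iff_compactSpace.1 hS
  have hd : Continuous fun A : S => A.1.det := continuous_subtype_val.matrix_det
  let g : S → GL (Fin n) ℝ := fun A =>
    { val := A.1
      inv := (A.1.det)⁻¹ • A.1.adjugate
      val_inv := by
        rw [Matrix.mul_smul, Matrix.mul_adjugate, smul_smul, inv_mul_cancel₀ (h _ A.2), one_smul]
      inv_val := by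
        rw [Matrix.smul_mul, Matrix.adjugate_mul, smul_smul, inv_mul_cancel₀ (h _ A.2), one_smul] }
  have hg : Continuous g := by
    refine Units.continuous_iff.2 ⟨continuous_subtype_val, ?_⟩
    exact (hd.inv₀ fun A => h _ A.2).smul continuous_subtype_val.matrix_adjugate
  have hr : {Y : GL (Fin n) ℝ | ‖matVec Y.1 - matVec A₀‖ ≤ r} = range g := by
    ext Y
    constructor
    · intro hY
      exact ⟨⟨Y.1, hY⟩, Units.ext rfl⟩
    · rintro ⟨A, rfl⟩
      exact A.2
  rw [hr]
  exact isCompact_range hg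

/-- Near `Y₀` matrices are invertible and distort lengths by bounded factors. -/
theorem exists_uniform_bounds (Y₀ : GL (Fin n) ℝ) : ∃ ρ m M : ℝ, 0 < ρ ∧ 0 < m ∧ m ≤ 1 ∧ 0 < M ∧
    (∀ A : Matrix (Fin n) (Fin n) ℝ, ‖matVec A - matVec Y₀.1‖ ≤ 2 * ρ →
      ∀ x, m * ‖x‖ ≤ ‖Matrix.toEuclideanLin A x‖ ∧ ‖Matrix.toEuclideanLin A x‖ ≤ M * ‖x‖) ∧
    IsCompact {Y : GL (Fin n) ℝ | ‖matVec Y.1 - matVec Y₀.1‖ ≤ 2 * ρ} := by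
  set a := ‖matVec (Y₀⁻¹).1‖ + 1 with ha
  have ha0 : 1 ≤ a := by rw [ha]; linarith [norm_nonneg (matVec (Y₀⁻¹).1)]
  have hbd : ∀ A : Matrix (Fin n) (Fin n) ℝ, ‖matVec A - matVec Y₀.1‖ ≤ 2 * (1 / (4 * a)) →
      ∀ x, 1 / (2 * a) * ‖x‖ ≤ ‖Matrix.toEuclideanLin A x‖ ∧
        ‖Matrix.toEuclideanLin A x‖ ≤ (‖matVec Y₀.1‖ + 1) * ‖x‖ := by
    intro A hA x
    have h1 : ‖x‖ ≤ a * ‖act Y₀ x‖ := by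
      calc ‖x‖ = ‖act Y₀⁻¹ (act Y₀ x)‖ := by rw [act_inv_act]
        _ ≤ ‖matVec (Y₀⁻¹).1‖ * ‖act Y₀ x‖ := norm_toEuclideanLin_le _ _
        _ ≤ a * ‖act Y₀ x‖ := by gcongr; linarith
    have h2 : ‖Matrix.toEuclideanLin A x - act Y₀ x‖ ≤ 1 / (2 * a) * ‖x‖ := by
      have h3 : Matrix.toEuclideanLin A x - act Y₀ x = Matrix.toEuclideanLin (A - Y₀.1) x := by
        rw [map_sub, LinearMap.sub_apply]; rfl
      rw [h3]
      refine (norm_toEuclideanLin_le _ _).trans ?_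
      gcongr
      have h4 : matVec (A - Y₀.1) = matVec A - matVec Y₀.1 := rfl
      rw [h4]
      refine hA.trans (le_of_eq ?_)
      field_simp
      norm_num
    constructor
    · have h5 : 1 / a * ‖x‖ ≤ ‖act Y₀ x‖ := by
        rw [div_mul_eq_mul_div, one_mul, div_le_iff₀ (by linarith)]
        linarith
      have h6 := norm_sub_norm_le (act Y₀ x) (Matrix.toEuclideanLin A x)
      rw [norm_sub_rev] at h6
      have h7 : 1 / a * ‖x‖ = 1 / (2 * a) * ‖x‖ + 1 / (2 * a) * ‖x‖ := by field_simp; norm_num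
      linarith
    · have h6 := norm_sub_norm_le (Matrix.toEuclideanLin A x) (act Y₀ x)
      have h7 : ‖act Y₀ x‖ ≤ ‖matVec Y₀.1‖ * ‖x‖ := norm_toEuclideanLin_le _ _
      have h8 : 1 / (2 * a) * ‖x‖ ≤ 1 * ‖x‖ := by
        gcongr
        rw [div_le_one (by linarith)]
        linarith
      linarith
  refine ⟨1 / (4 * a), 1 / (2 * a), ‖matVec Y₀.1‖ + 1, by positivity, by positivity, ?_,
    by positivity, hbd, ?_⟩
  · rw [div_le_one (by linarith)]
    linarith
  · refine isCompact_setOf_norm_matVec_le Y₀.1 fun A hA hdet => ?_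
    obtain ⟨v, hv, hv0⟩ := Matrix.exists_mulVec_eq_zero_iff.2 hdet
    have h1 := (hbd A hA (WithLp.toLp 2 v)).1
    have h2 : Matrix.toEuclideanLin A (WithLp.toLp 2 v) = 0 := by
      ext i
      exact congrFun hv0 i
    rw [h2, norm_zero] at h1
    have h3 : 0 < ‖WithLp.toLp 2 v‖ := norm_pos_iff.2 (by simpa using hv)
    have : 0 < 1 / (2 * a) * ‖WithLp.toLp 2 v‖ := by positivity
    linarith

end MatVec

/-! ### Moving apart two lattice vectors -/

section Direction

variable {n : ℕ}

open scoped RealInnerProductSpace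

/-- For vectors `k ≠ l` at an acute angle there is a matrix `D` of bounded size having both as
eigenvectors, such that along `Y ↦ Y (1 + sD)` the difference `|Yk| - |Yl|` changes linearly at
rate at least `c |k - l|`. If `l - k` is not almost parallel to `k`, then `D` is a shear that kills
`k`; otherwise `|Yk|` and `|Yl|` are far apart and `D = 1` will do. -/
theorem exists_direction {m M : ℝ} (hm : 0 < m) (hM : 0 < M) : ∃ c K : ℝ, 0 < c ∧ 0 ≤ K ∧
    ∀ k l : EuclideanSpace ℝ (Fin n), k ≠ 0 → ‖k‖ ≤ ‖l‖ → 0 ≤ ⟪k, l⟫ →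
    ∃ (D : Matrix (Fin n) (Fin n) ℝ) (α β : ℝ), 0 ≤ α ∧ α ≤ 2 ∧ 0 ≤ β ∧ β ≤ 2 ∧ ‖matVec D‖ ≤ K ∧
      Matrix.toEuclideanLin D k = α • k ∧ Matrix.toEuclideanLin D l = β • l ∧
      ∀ A : EuclideanSpace ℝ (Fin n) →ₗ[ℝ] EuclideanSpace ℝ (Fin n),
        (∀ x, m * ‖x‖ ≤ ‖A x‖) → (∀ x, ‖A x‖ ≤ M * ‖x‖) →
        c * ‖k - l‖ ≤ |α * ‖A k‖ - β * ‖A l‖| := by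
  set c₁ : ℝ := m / (2 * (m + M)) with hc₁
  have hc10 : 0 < c₁ := by positivity
  refine ⟨m / 2, 1 / c₁ + ‖matVec (1 : Matrix (Fin n) (Fin n) ℝ)‖, by positivity, by positivity,
    fun k l hk hkl hi => ?_⟩
  have hk0 : 0 < ‖k‖ := norm_pos_iff.2 hk
  have hl0 : 0 < ‖l‖ := hk0.trans_le hkl
  set w := l - k with hw
  set lam : ℝ := ⟪k, w⟫ / ‖k‖ ^ 2 with hlam
  set q := w - lam • k with hq
  have hkq : ⟪k, q⟫ = 0 := by
    rw [hq, inner_sub_right, inner_smul_right, real_inner_self_eq_norm_sq, hlam]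
    field_simp
    ring
  have hqk : ⟪q, k⟫ = 0 := by rw [real_inner_comm]; exact hkq
  have hkw : ‖k - l‖ = ‖w‖ := norm_sub_rev _ _
  rcases le_or_gt (c₁ * ‖w‖) ‖q‖ with hcase | hcase
  · -- the shear has rank one, with image spanned by `l`, and is scaled so that its eigenvalue at
    -- `l` is `|w| / |l|`
    rcases eq_or_ne w 0 with hw0 | hw0
    · refine ⟨0, 0, 0, le_rfl, by norm_num, le_rfl, by norm_num, ?_, by simp, by simp, ?_⟩
      · have : matVec (0 : Matrix (Fin n) (Fin n) ℝ) = 0 := rfl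
        rw [this, norm_zero]; positivity
      · intro A _ _
        rw [hkw, hw0]; simp
    have hwn : 0 < ‖w‖ := norm_pos_iff.2 hw0
    have hqn : 0 < ‖q‖ := lt_of_lt_of_le (by positivity) hcase
    set p := (‖w‖ / ‖q‖ ^ 2) • q with hp
    have hpk : ⟪p, k⟫ = 0 := by
      rw [hp, inner_smul_left, hqk, mul_zero]
    have hqw : ⟪q, w⟫ = ‖q‖ ^ 2 := by
      have : w = q + lam • k := by rw [hq]; abel
      rw [this, inner_add_right, inner_smul_right, hqk,
        real_inner_self_eq_norm_sq]
      ring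
    have hpl : ⟪p, l⟫ = ‖w‖ := by
      have : l = w + k := by rw [hw]; abel
      rw [this, inner_add_right, hpk, add_zero, hp, inner_smul_left, hqw]
      simp only [conj_trivial]
      field_simp
    have hpn : ‖p‖ = ‖w‖ / ‖q‖ := by
      rw [hp, norm_smul, Real.norm_of_nonneg (by positivity)]
      field_simp
    let D : Matrix (Fin n) (Fin n) ℝ := Matrix.of fun i j => l i * p j / ‖l‖
    have hD : ∀ x, Matrix.toEuclideanLin D x = (⟪p, x⟫ / ‖l‖) • l := by
      intro x
      ext i
      rw [toEuclideanLin_apply']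
      simp only [D, Matrix.of_apply, PiLp.smul_apply, smul_eq_mul, PiLp.inner_apply,
        RCLike.inner_apply, conj_trivial, Finset.sum_div, Finset.sum_mul]
      refine Finset.sum_congr rfl fun j _ => ?_
      ring
    refine ⟨D, 0, ‖w‖ / ‖l‖, le_rfl, by norm_num, by positivity, ?_, ?_, ?_, ?_, ?_⟩
    · rw [div_le_iff₀ hl0, hw]
      exact (norm_sub_le _ _).trans (by linarith)
    · have h1 : ‖matVec D‖ = ‖p‖ := by
        rw [← sq_eq_sq₀ (norm_nonneg _) (norm_nonneg _), norm_matVec_sq,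
          EuclideanSpace.real_norm_sq_eq p]
        have : ∀ i j, D i j ^ 2 = l i ^ 2 * (p j ^ 2 / ‖l‖ ^ 2) := by
          intro i j
          simp only [D, Matrix.of_apply]
          ring
        simp_rw [this, ← Finset.mul_sum, ← Finset.sum_mul, ← EuclideanSpace.real_norm_sq_eq l,
          ← Finset.sum_div]
        field_simp
      rw [h1, hpn]
      have h2 : ‖w‖ / ‖q‖ ≤ 1 / c₁ := by
        rw [div_le_div_iff₀ hqn hc10]
        linarith
      linarith [norm_nonneg (matVec (1 : Matrix (Fin n) (Fin n) ℝ))]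
    · rw [hD, hpk, zero_div, zero_smul, zero_smul]
    · rw [hD, hpl]
    · intro A hA _
      have h1 := hA l
      rw [zero_mul, zero_sub, abs_neg, hkw, abs_of_nonneg (by positivity)]
      calc m / 2 * ‖w‖ ≤ m * ‖w‖ := by gcongr; linarith
        _ = ‖w‖ / ‖l‖ * (m * ‖l‖) := by field_simp
        _ ≤ _ := by gcongr
  · -- here `w` is almost a multiple of `k`, so `|Al| - |Ak|` is about `lam |Ak|`
    refine ⟨1, 1, 1, by norm_num, by norm_num, by norm_num, by norm_num, ?_, ?_, ?_, ?_⟩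
    · have : 0 ≤ 1 / c₁ := by positivity
      linarith
    · ext i
      simp
    · ext i
      simp
    · intro A hA hA'
      have hl : l = (1 + lam) • k + q := by rw [hq, hw, add_smul, one_smul]; abel
      have hlam1 : 0 ≤ 1 + lam := by
        have : 1 + lam = ⟪k, l⟫ / ‖k‖ ^ 2 := by
          rw [hlam, hw, inner_sub_right, real_inner_self_eq_norm_sq]
          field_simp
          ring
        rw [this]
        positivity
      have hAl : A l = (1 + lam) • A k + A q := by
        conv_lhs => rw [hl]
        rw [map_add, map_smul]
      have hn1 : ‖(1 + lam) • A k‖ = (1 + lam) * ‖A k‖ := by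
        rw [norm_smul, Real.norm_of_nonneg hlam1]
      have h1 : |‖A l‖ - (1 + lam) * ‖A k‖| ≤ ‖A q‖ := by
        rw [← hn1]
        refine (abs_norm_sub_norm_le _ _).trans (le_of_eq ?_)
        rw [hAl, add_sub_cancel_left]
      have h2 : ‖A q‖ ≤ M * (c₁ * ‖w‖) := (hA' q).trans (by gcongr)
      have h3 : m * ((1 - c₁) * ‖w‖) ≤ |lam| * ‖A k‖ := by
        have h4 : ‖w‖ - ‖q‖ ≤ |lam| * ‖k‖ := by
          rw [← Real.norm_eq_abs, ← norm_smul]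
          have : lam • k = w - q := by rw [hq]; abel
          rw [this]
          exact norm_sub_norm_le _ _
        calc m * ((1 - c₁) * ‖w‖) ≤ m * (|lam| * ‖k‖) :=
              mul_le_mul_of_nonneg_left (by linarith) hm.le
          _ = |lam| * (m * ‖k‖) := by ring
          _ ≤ _ := by gcongr; exact hA k
      have h5 : |lam| * ‖A k‖ ≤ |1 * ‖A k‖ - 1 * ‖A l‖| + ‖A q‖ := by
        rw [← abs_norm (A k), ← abs_mul, abs_norm]
        have : lam * ‖A k‖ = -(1 * ‖A k‖ - 1 * ‖A l‖) + -(‖A l‖ - (1 + lam) * ‖A k‖) := by ring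
        rw [this]
        refine (abs_add_le _ _).trans ?_
        rw [abs_neg, abs_neg]
        linarith
      have h6 : m * ((1 - c₁) * ‖w‖) - M * (c₁ * ‖w‖) = m / 2 * ‖w‖ := by
        rw [hc₁]
        field_simp
        ring
      rw [hkw]
      linarith

end Direction

/-! ### Correlations of two Fourier coefficients -/

section Correlation

open scoped RealInnerProductSpace

theorem coeffSize_nonneg (n : ℕ) {δ r : ℝ} (hδ : 0 < δ) (hr : 0 ≤ r) : 0 ≤ coeffSize n δ r := by
  rw [coeffSize]; positivity

/-- Distorting lengths by a bounded factor changes the size of a coefficient by a bounded factor. -/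
theorem coeffSize_le (n : ℕ) {δ m r r' : ℝ} (hδ : 0 < δ) (hm : 0 < m) (hm1 : m ≤ 1) (hr : 0 < r)
    (h : m * r ≤ r') :
    coeffSize n δ r' ≤ m ^ (-((n : ℝ) + 1) / 2) / m ^ 4 * coeffSize n δ r := by
  have hr' : 0 < r' := lt_of_lt_of_le (by positivity) h
  have h1 : r' ^ (-((n : ℝ) + 1) / 2) ≤
      m ^ (-((n : ℝ) + 1) / 2) * r ^ (-((n : ℝ) + 1) / 2) := by
    rw [← Real.mul_rpow hm.le hr.le]
    refine Real.rpow_le_rpow_of_nonpos (by positivity) h ?_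
    have : (0 : ℝ) ≤ n := n.cast_nonneg
    linarith
  have h2 : m * (1 + δ * r) ≤ 1 + δ * r' := by nlinarith
  rw [coeffSize, coeffSize]
  calc _ ≤ m ^ (-((n : ℝ) + 1) / 2) * r ^ (-((n : ℝ) + 1) / 2) / (m * (1 + δ * r)) ^ 4 := by gcongr
    _ = _ := by rw [mul_pow]; field_simp

variable {d : ℕ} {E : EuclideanSpace ℝ (Fin (d + 1)) → ℝ} {C₀ : ℝ}

/-- The pointwise bound for the coefficients, from the decay of the Bessel function. -/
theorem abs_ballCoeff_le (hE : IsCutoff E C₀) : ∃ D : ℝ, 0 ≤ D ∧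
    ∀ (τ δ : ℝ) (ξ : EuclideanSpace ℝ (Fin (d + 1))), 0 < τ → 0 < δ → ξ ≠ 0 →
      |ballCoeff E τ δ ξ| ≤ D * (τ ^ ((d : ℝ) / 2) * coeffSize (d + 1) δ ‖ξ‖) := by
  obtain ⟨D, hD0, hD⟩ := exists_ray_amplitude hE
  refine ⟨D, hD0, fun τ δ ξ hτ hδ hξ => ?_⟩
  obtain ⟨P, P', h1, -, -, h2, -⟩ := hD τ δ 0 ξ hτ hδ le_rfl zero_le_two hξ
  have h0 : (0 : ℝ) ∈ Icc (0 : ℝ) 1 := ⟨le_rfl, zero_le_one⟩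
  have h3 := h1 0 h0
  rw [zero_mul, add_zero, one_smul] at h3
  rw [h3]
  refine (Complex.abs_re_le_norm _).trans ?_
  rw [norm_mul, norm_exp_I_mul_ofReal, one_mul]
  exact h2 0 h0

/-- A smooth weight on matrices supported in the ball of radius `ρ` about `Y₀`, where matrices in
the ball of radius `2ρ` are invertible and distort lengths by factors between `m` and `M`. -/
structure IsLocalWeight {n : ℕ} (Y₀ : GL (Fin n) ℝ)
    (f : EuclideanSpace ℝ (Fin n × Fin n) → ℝ) (ρ m M : ℝ) : Prop where
  contDiff : ContDiff ℝ 1 f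
  compact : HasCompactSupport f
  nonneg : ∀ a, 0 ≤ f a
  le_one : ∀ a, f a ≤ 1
  support : ∀ a, f a ≠ 0 → ‖a - matVec Y₀.1‖ ≤ ρ
  pos_rho : 0 < ρ
  pos_m : 0 < m
  m_le_one : m ≤ 1
  pos_M : 0 < M
  bounds : ∀ A : Matrix (Fin n) (Fin n) ℝ, ‖matVec A - matVec Y₀.1‖ ≤ 2 * ρ →
      ∀ x, m * ‖x‖ ≤ ‖Matrix.toEuclideanLin A x‖ ∧ ‖Matrix.toEuclideanLin A x‖ ≤ M * ‖x‖
  isCompact : IsCompact {Y : GL (Fin n) ℝ | ‖matVec Y.1 - matVec Y₀.1‖ ≤ 2 * ρ}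

theorem exists_isLocalWeight {n : ℕ} (Y₀ : GL (Fin n) ℝ) : ∃ f ρ m M, IsLocalWeight Y₀ f ρ m M ∧
    ∀ a, ‖a - matVec Y₀.1‖ ≤ ρ / 2 → f a = 1 := by
  obtain ⟨ρ, m, M, hρ, hm, hm1, hM, hb, hK⟩ := exists_uniform_bounds Y₀
  let f : ContDiffBump (matVec Y₀.1) :=
    { rIn := ρ / 2, rOut := ρ, rIn_pos := by positivity, rIn_lt_rOut := by linarith }
  refine ⟨f, ρ, m, M, ⟨f.contDiff, f.hasCompactSupport, fun a => f.nonneg, fun a => f.le_one,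
    fun a ha => ?_, hρ, hm, hm1, hM, hb, hK⟩, fun a ha => ?_⟩
  · have : a ∈ Function.support f := ha
    rw [f.support_eq, Metric.mem_ball, dist_eq_norm] at this
    exact this.le
  · refine f.one_of_mem_closedBall ?_
    rw [Metric.mem_closedBall, dist_eq_norm]
    exact ha

variable {Y₀ : GL (Fin (d + 1)) ℝ} {f : EuclideanSpace ℝ (Fin (d + 1) × Fin (d + 1)) → ℝ}
  {ρ m M : ℝ} (μ : Measure (GL (Fin (d + 1)) ℝ))

theorem coeffSize_act_le (hf : IsLocalWeight Y₀ f ρ m M) {Y : GL (Fin (d + 1)) ℝ}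
    (hY : ‖matVec Y.1 - matVec Y₀.1‖ ≤ 2 * ρ) {δ : ℝ} (hδ : 0 < δ)
    {k : EuclideanSpace ℝ (Fin (d + 1))} (hk : k ≠ 0) :
    act Y k ≠ 0 ∧ coeffSize (d + 1) δ ‖act Y k‖ ≤
      m ^ (-(((d + 1 : ℕ) : ℝ) + 1) / 2) / m ^ 4 * coeffSize (d + 1) δ ‖k‖ := by
  have hk0 := norm_pos_iff.2 hk
  have h1 := (hf.bounds Y.1 hY k).1
  have hm := hf.pos_m
  refine ⟨?_, coeffSize_le _ hδ hf.pos_m hf.m_le_one hk0 h1⟩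
  rw [← norm_pos_iff]
  exact lt_of_lt_of_le (by positivity) h1

/-- The trivial bound for a correlation. -/
theorem abs_integral_correlation_le [IsFiniteMeasureOnCompacts μ]
    (hf : IsLocalWeight Y₀ f ρ m M) (hE : IsCutoff E C₀) : ∃ C : ℝ, 0 ≤ C ∧
    ∀ (τ δ : ℝ) (k l : EuclideanSpace ℝ (Fin (d + 1))), 0 < τ → 0 < δ → k ≠ 0 → l ≠ 0 →
      |∫ Y, f (matVec Y.1) * (ballCoeff E τ δ (act Y k) * ballCoeff E τ δ (act Y l)) ∂μ| ≤
        C * (τ ^ d * (coeffSize (d + 1) δ ‖k‖ * coeffSize (d + 1) δ ‖l‖)) := by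
  obtain ⟨D, hD0, hD⟩ := abs_ballCoeff_le hE
  set κ := m ^ (-(((d + 1 : ℕ) : ℝ) + 1) / 2) / m ^ 4 with hκ
  have hm := hf.pos_m
  have hκ0 : 0 ≤ κ := by positivity
  set K := {Y : GL (Fin (d + 1)) ℝ | ‖matVec Y.1 - matVec Y₀.1‖ ≤ 2 * ρ} with hK
  refine ⟨(D * κ) ^ 2 * μ.real K, by positivity, fun τ δ k l hτ hδ hk hl => ?_⟩
  have hzero : ∀ Y, Y ∉ K →
      f (matVec Y.1) * (ballCoeff E τ δ (act Y k) * ballCoeff E τ δ (act Y l)) = 0 := by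
    intro Y hY
    by_contra hne
    have h1 := hf.support _ (left_ne_zero_of_mul hne)
    exact hY (h1.trans (by linarith [hf.pos_rho]))
  rw [← setIntegral_eq_integral_of_forall_compl_eq_zero hzero, ← Real.norm_eq_abs]
  refine (norm_setIntegral_le_of_norm_le_const (C := (D * κ) ^ 2 *
    (τ ^ d * (coeffSize (d + 1) δ ‖k‖ * coeffSize (d + 1) δ ‖l‖)))
    hf.isCompact.measure_lt_top fun Y hY => ?_).trans (le_of_eq (by ring))
  obtain ⟨hk1, hk2⟩ := coeffSize_act_le hf hY hδ hk
  obtain ⟨hl1, hl2⟩ := coeffSize_act_le hf hY hδ hl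
  have h1 := hD τ δ _ hτ hδ hk1
  have h2 := hD τ δ _ hτ hδ hl1
  have hsk := coeffSize_nonneg (d + 1) hδ (norm_nonneg k)
  have hsl := coeffSize_nonneg (d + 1) hδ (norm_nonneg l)
  have hsl' := coeffSize_nonneg (d + 1) hδ (norm_nonneg (act Y l))
  rw [norm_mul, norm_mul, Real.norm_of_nonneg (hf.nonneg _), Real.norm_eq_abs, Real.norm_eq_abs]
  have hp : τ ^ d = τ ^ ((d : ℝ) / 2) * τ ^ ((d : ℝ) / 2) := by
    rw [← Real.rpow_add hτ, add_halves, Real.rpow_natCast]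
  calc _ ≤ 1 * ((D * (τ ^ ((d : ℝ) / 2) * (κ * coeffSize (d + 1) δ ‖k‖))) *
        (D * (τ ^ ((d : ℝ) / 2) * (κ * coeffSize (d + 1) δ ‖l‖)))) := by
        gcongr
        · exact hf.le_one _
        · exact h1.trans (by gcongr)
        · exact h2.trans (by gcongr)
    _ = _ := by rw [hp]; ring

set_option maxHeartbeats 1000000 in
/-- The correlation of the coefficients at `k`, `l` at an acute angle is averaged over the shears
or homotheties of `exists_direction`; the phase is linear along them, and integration by parts
gains a factor `1 / (τ|k - l|)`. -/
theorem abs_integral_correlation_le_of_acute [μ.IsMulRightInvariant] [IsFiniteMeasureOnCompacts μ]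
    (hf : IsLocalWeight Y₀ f ρ m M) (hE : IsCutoff E C₀) : ∃ C : ℝ, 0 ≤ C ∧
    ∀ (τ δ : ℝ) (k l : EuclideanSpace ℝ (Fin (d + 1))), 0 < τ → 0 < δ → k ≠ 0 → ‖k‖ ≤ ‖l‖ →
      k ≠ l → 0 ≤ ⟪k, l⟫ →
      |∫ Y, f (matVec Y.1) * (ballCoeff E τ δ (act Y k) * ballCoeff E τ δ (act Y l)) ∂μ| ≤
        C * (τ ^ d * (coeffSize (d + 1) δ ‖k‖ * coeffSize (d + 1) δ ‖l‖) / (τ * ‖k - l‖)) := by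
  obtain ⟨D, hD0, hD⟩ := exists_ray_amplitude hE
  obtain ⟨c, K, hc, hK0, hdir⟩ := exists_direction (n := d + 1) hf.pos_m hf.pos_M
  have hm := hf.pos_m
  have hρ := hf.pos_rho
  set κ := m ^ (-(((d + 1 : ℕ) : ℝ) + 1) / 2) / m ^ 4 with hκ
  have hκ0 : 0 ≤ κ := by positivity
  set S := {Y : GL (Fin (d + 1)) ℝ | ‖matVec Y.1 - matVec Y₀.1‖ ≤ 2 * ρ} with hS
  set N := ‖matVec Y₀.1‖ with hN
  have hN0 : 0 ≤ N := norm_nonneg _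
  obtain ⟨Cf, hCf⟩ := (hf.contDiff.continuous_fderiv one_ne_zero).bounded_above_of_compact_support
    (hf.compact.fderiv (𝕜 := ℝ))
  have hCf0 : 0 ≤ Cf := (norm_nonneg _).trans (hCf 0)
  -- `ε` is small enough that the translates of the support stay within `S`
  obtain ⟨ε, hε0, hε1, hεK, hεN⟩ : ∃ ε : ℝ, 0 < ε ∧ ε ≤ 1 ∧ ε * K ≤ 1 / 4 ∧ ε * K * N ≤ ρ / 4 := by
    refine ⟨min 1 (min (1 / (4 * (K + 1))) (ρ / (4 * (K + 1) * (N + 1)))), ?_, min_le_left _ _,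
      ?_, ?_⟩
    · refine lt_min one_pos (lt_min ?_ ?_) <;> positivity
    · calc _ ≤ 1 / (4 * (K + 1)) * (K + 1) := by
            gcongr
            · exact (min_le_right _ _).trans (min_le_left _ _)
            · linarith
        _ = _ := by field_simp
    · calc _ ≤ ρ / (4 * (K + 1) * (N + 1)) * (K + 1) * (N + 1) := by
            gcongr
            · exact (min_le_right _ _).trans (min_le_right _ _)
            · linarith
            · linarith
        _ = _ := by field_simp
  set Kw := 1 + Cf * ((N + 2 * ρ) * K) with hKw
  have hKw0 : 0 ≤ Kw := by positivity
  refine ⟨1 / ε * ((2 + ε) * (3 * (Kw * (D * κ) * (D * κ))) / c * μ.real S), by positivity,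
    fun τ δ k l hτ hδ hk hkl hne hi => ?_⟩
  have hl : l ≠ 0 := norm_pos_iff.1 ((norm_pos_iff.2 hk).trans_le hkl)
  have hsk := coeffSize_nonneg (d + 1) hδ (norm_nonneg k)
  have hsl := coeffSize_nonneg (d + 1) hδ (norm_nonneg l)
  obtain ⟨V, α, β, hα, hα2, hβ, hβ2, hVK, hVk, hVl, hslope⟩ := hdir k l hk hkl hi
  have hkl0 : 0 < ‖k - l‖ := norm_pos_iff.2 (sub_ne_zero.2 hne)
  let H : GL (Fin (d + 1)) ℝ → ℝ := fun Y =>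
    f (matVec Y.1) * (ballCoeff E τ δ (act Y k) * ballCoeff E τ δ (act Y l))
  let G : GL (Fin (d + 1)) ℝ → ℝ → ℝ := fun Y s =>
    f (matVec (Y.1 * (1 + s • V))) * (ballCoeff E τ δ ((1 + α * s) • act Y k) *
      ballCoeff E τ δ ((1 + β * s) • act Y l))
  have hmat : ∀ (Y : GL (Fin (d + 1)) ℝ) (s : ℝ),
      matVec (Y.1 * (1 + s • V)) = matVec Y.1 + s • matVec (Y.1 * V) := by
    intro Y s
    rw [mul_add, mul_one, Matrix.mul_smul, matVec_add, matVec_smul]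
  have hYV : ∀ Y : GL (Fin (d + 1)) ℝ, ‖matVec (Y.1 * V)‖ ≤ ‖matVec Y.1‖ * K := fun Y =>
    (norm_matVec_mul_le _ _).trans (by gcongr)
  -- right translation by `1 + sV` turns `H` into `G · s`, so that `∫ H` is an average of `∫ G · s`
  have hGH : ∀ s ∈ Icc 0 ε, ∫ Y, G Y s ∂μ = ∫ Y, H Y ∂μ := by
    intro s hs
    have hdet : (1 + s • V).det ≠ 0 := by
      intro hdet
      obtain ⟨v, hv, hv0⟩ := Matrix.exists_mulVec_eq_zero_iff.2 hdet
      have h1 : Matrix.toEuclideanLin (1 + s • V) (WithLp.toLp 2 v) = 0 := by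
        ext i
        exact congrFun hv0 i
      rw [map_add, LinearMap.add_apply, map_smul, LinearMap.smul_apply] at h1
      have h2 : Matrix.toEuclideanLin (1 : Matrix (Fin (d + 1)) (Fin (d + 1)) ℝ)
          (WithLp.toLp 2 v) = WithLp.toLp 2 v := by
        ext i; simp
      rw [h2, add_eq_zero_iff_eq_neg] at h1
      have h3 : 0 < ‖WithLp.toLp 2 v‖ := norm_pos_iff.2 (by simpa using hv)
      have h4 : ‖WithLp.toLp 2 v‖ ≤ ε * (K * ‖WithLp.toLp 2 v‖) := by
        conv_lhs => rw [h1]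
        rw [norm_neg, norm_smul, Real.norm_of_nonneg hs.1]
        have := norm_toEuclideanLin_le V (WithLp.toLp 2 v)
        have h5 : ‖Matrix.toEuclideanLin V (WithLp.toLp 2 v)‖ ≤ K * ‖WithLp.toLp 2 v‖ :=
          this.trans (by gcongr)
        have := hs.2
        gcongr
      nlinarith
    let g : GL (Fin (d + 1)) ℝ := Matrix.GeneralLinearGroup.mkOfDetNeZero _ hdet
    have hact : ∀ (v : EuclideanSpace ℝ (Fin (d + 1))) (a : ℝ),
        Matrix.toEuclideanLin V v = a • v → act g v = (1 + a * s) • v := by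
      intro v a hv
      change Matrix.toEuclideanLin (1 + s • V) v = _
      rw [map_add, LinearMap.add_apply, map_smul, LinearMap.smul_apply, hv]
      have h2 : Matrix.toEuclideanLin (1 : Matrix (Fin (d + 1)) (Fin (d + 1)) ℝ) v = v := by
        ext i; simp
      rw [h2, smul_smul, add_smul, one_smul, mul_comm]
    rw [← integral_mul_right_eq_self H g]
    refine integral_congr_ae (ae_of_all _ fun Y => ?_)
    simp only [G, H, act_mul, hact k α hVk, hact l β hVl, map_smul]
    rfl
  -- all the translates are supported in the compact set `S`
  have hsupp : ∀ s ∈ Icc 0 ε, ∀ Y, Y ∉ S → G Y s = 0 := by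
    intro s hs Y hY
    by_contra hne
    have h1 := hf.support _ (left_ne_zero_of_mul hne)
    rw [hmat] at h1
    refine hY ?_
    have h2 : ‖matVec Y.1 - matVec Y₀.1‖ ≤ ρ + ε * (‖matVec Y.1‖ * K) := by
      have h3 : matVec Y.1 - matVec Y₀.1 = (matVec Y.1 + s • matVec (Y.1 * V) - matVec Y₀.1) -
          s • matVec (Y.1 * V) := by abel
      rw [h3]
      refine (norm_sub_le _ _).trans (add_le_add h1 ?_)
      rw [norm_smul, Real.norm_of_nonneg hs.1]
      have := hYV Y
      have := hs.2
      gcongr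
    have h4 : ‖matVec Y.1‖ ≤ ‖matVec Y.1 - matVec Y₀.1‖ + N := by
      have := norm_add_le (matVec Y.1 - matVec Y₀.1) (matVec Y₀.1)
      rwa [sub_add_cancel] at this
    have h5 : ε * (‖matVec Y.1‖ * K) ≤ 1 / 4 * ‖matVec Y.1 - matVec Y₀.1‖ + ρ / 4 := by
      calc _ ≤ ε * ((‖matVec Y.1 - matVec Y₀.1‖ + N) * K) := by gcongr
        _ = ε * K * ‖matVec Y.1 - matVec Y₀.1‖ + ε * K * N := by ring
        _ ≤ _ := by gcongr
    change ‖matVec Y.1 - matVec Y₀.1‖ ≤ 2 * ρ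
    linarith
  -- for each `Y` the phases along the segment are linear with slopes `2πτα|Yk|` and `2πτβ|Yl|`,
  -- and both their sum and their difference are at least `2πτc|k - l|`
  have hline : ∀ Y ∈ S, |∫ s in (0 : ℝ)..ε, G Y s| ≤ (2 + ε) * (3 * (Kw * (D * κ) * (D * κ))) / c *
      (τ ^ d * (coeffSize (d + 1) δ ‖k‖ * coeffSize (d + 1) δ ‖l‖) / (τ * ‖k - l‖)) := by
    intro Y hY
    obtain ⟨hk1, hk2⟩ := coeffSize_act_le hf hY hδ hk
    obtain ⟨hl1, hl2⟩ := coeffSize_act_le hf hY hδ hl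
    obtain ⟨P, P', hP, hPd, hPc, hPK, hPK'⟩ := hD τ δ α (act Y k) hτ hδ hα hα2 hk1
    obtain ⟨Q, Q', hQ, hQd, hQc, hQK, hQK'⟩ := hD τ δ β (act Y l) hτ hδ hβ hβ2 hl1
    have hI : ∀ s ∈ Icc (0 : ℝ) ε, s ∈ Icc (0 : ℝ) 1 := fun s hs => ⟨hs.1, hs.2.trans hε1⟩
    have hsl1 := hslope (act Y) (fun x => (hf.bounds Y.1 hY x).1)
      (fun x => (hf.bounds Y.1 hY x).2)
    have hπ : 1 ≤ 2 * Real.pi := by linarith [Real.pi_gt_three]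
    have hB0 : 0 < τ * (c * ‖k - l‖) := by positivity
    have hBm : τ * (c * ‖k - l‖) ≤ |2 * Real.pi * τ * (α * ‖act Y k‖) -
        2 * Real.pi * τ * (β * ‖act Y l‖)| := by
      rw [← mul_sub, abs_mul, abs_of_pos (by positivity)]
      calc _ ≤ τ * |α * ‖act Y k‖ - β * ‖act Y l‖| := by gcongr
        _ ≤ _ := by
            gcongr
            nlinarith
    have hBp : τ * (c * ‖k - l‖) ≤ |2 * Real.pi * τ * (α * ‖act Y k‖) +
        2 * Real.pi * τ * (β * ‖act Y l‖)| := by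
      refine hBm.trans ?_
      have a1 : 0 ≤ 2 * Real.pi * τ * (α * ‖act Y k‖) := by positivity
      have a2 : 0 ≤ 2 * Real.pi * τ * (β * ‖act Y l‖) := by positivity
      rw [abs_of_nonneg (add_nonneg a1 a2), abs_le]
      constructor <;> linarith
    have hYn : ‖matVec Y.1‖ ≤ N + 2 * ρ := by
      have h1 := norm_add_le (matVec Y.1 - matVec Y₀.1) (matVec Y₀.1)
      rw [sub_add_cancel] at h1
      have h2 : ‖matVec Y.1 - matVec Y₀.1‖ ≤ 2 * ρ := hY
      linarith
    have hwd : ∀ s : ℝ, HasDerivAt (fun s : ℝ => f (matVec Y.1 + s • matVec (Y.1 * V)))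
        (fderiv ℝ f (matVec Y.1 + s • matVec (Y.1 * V)) (matVec (Y.1 * V))) s := by
      intro s
      have h1 : HasDerivAt (fun s : ℝ => matVec Y.1 + s • matVec (Y.1 * V))
          (matVec (Y.1 * V)) s := by
        simpa using ((hasDerivAt_id s).smul_const (matVec (Y.1 * V))).const_add (matVec Y.1)
      exact ((hf.contDiff.differentiable one_ne_zero) _).hasFDerivAt.comp_hasDerivAt s h1
    have hwc : Continuous fun s : ℝ =>
        fderiv ℝ f (matVec Y.1 + s • matVec (Y.1 * V)) (matVec (Y.1 * V)) :=
      ((hf.contDiff.continuous_fderiv one_ne_zero).comp (by fun_prop)).clm_apply continuous_const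
    have key := abs_integral_re_mul_re_le (Kw := Kw)
      (KP := D * κ * (τ ^ ((d : ℝ) / 2) * coeffSize (d + 1) δ ‖k‖))
      (KQ := D * κ * (τ ^ ((d : ℝ) / 2) * coeffSize (d + 1) δ ‖l‖))
      (c₁ := 2 * Real.pi * τ * ‖act Y k‖) (c₂ := 2 * Real.pi * τ * ‖act Y l‖)
      hε0.le hB0 hBp hBm
      (fun s _ => hwd s) hwc.continuousOn
      (fun s hs => hPd s (hI s hs)) hPc.continuousOn (fun s hs => hQd s (hI s hs)) hQc.continuousOn
      (fun s _ => by
        rw [abs_of_nonneg (hf.nonneg _)]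
        have : 0 ≤ Cf * ((N + 2 * ρ) * K) := by positivity
        exact (hf.le_one _).trans (by linarith))
      (fun s _ => by
        rw [← Real.norm_eq_abs]
        refine (ContinuousLinearMap.le_opNorm _ _).trans ?_
        have h1 := hCf (matVec Y.1 + s • matVec (Y.1 * V))
        have h2 := hYV Y
        calc _ ≤ Cf * ((N + 2 * ρ) * K) := by
              gcongr
              exact h2.trans (by gcongr)
          _ ≤ Kw := by rw [hKw]; linarith)
      (fun s hs => (hPK s (hI s hs)).trans (by
        calc _ ≤ D * (τ ^ ((d : ℝ) / 2) * (κ * coeffSize (d + 1) δ ‖k‖)) := by gcongr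
          _ = _ := by ring))
      (fun s hs => (hPK' s (hI s hs)).trans (by
        calc _ ≤ D * (τ ^ ((d : ℝ) / 2) * (κ * coeffSize (d + 1) δ ‖k‖)) := by gcongr
          _ = _ := by ring))
      (fun s hs => (hQK s (hI s hs)).trans (by
        calc _ ≤ D * (τ ^ ((d : ℝ) / 2) * (κ * coeffSize (d + 1) δ ‖l‖)) := by gcongr
          _ = _ := by ring))
      (fun s hs => (hQK' s (hI s hs)).trans (by
        calc _ ≤ D * (τ ^ ((d : ℝ) / 2) * (κ * coeffSize (d + 1) δ ‖l‖)) := by gcongr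
          _ = _ := by ring))
    have hcongr : ∫ s in (0 : ℝ)..ε, G Y s = ∫ s in (0 : ℝ)..ε,
        f (matVec Y.1 + s • matVec (Y.1 * V)) *
        ((Complex.exp (Complex.I * ((2 * Real.pi * τ * ‖act Y k‖ +
            2 * Real.pi * τ * (α * ‖act Y k‖) * s : ℝ) : ℂ)) * P s).re *
        (Complex.exp (Complex.I * ((2 * Real.pi * τ * ‖act Y l‖ +
            2 * Real.pi * τ * (β * ‖act Y l‖) * s : ℝ) : ℂ)) * Q s).re) := by
      refine intervalIntegral.integral_congr fun s hs => ?_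
      rw [uIcc_of_le hε0.le] at hs
      simp only [G]
      rw [hmat, hP s (hI s hs), hQ s (hI s hs)]
    rw [hcongr]
    refine key.trans (le_of_eq ?_)
    have hp : τ ^ d = τ ^ ((d : ℝ) / 2) * τ ^ ((d : ℝ) / 2) := by
      rw [← Real.rpow_add hτ, add_halves, Real.rpow_natCast]
    rw [hp]
    field_simp
  -- the average over `s` may be taken first
  have hGc : Continuous fun p : GL (Fin (d + 1)) ℝ × ℝ => G p.1 p.2 := by
    have h1 : Continuous fun p : GL (Fin (d + 1)) ℝ × ℝ => p.1.1 :=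
      (continuous_val_GL _).comp continuous_fst
    have h2 : ∀ v, Continuous fun p : GL (Fin (d + 1)) ℝ × ℝ => act p.1 v := fun v =>
      (continuous_act _ v).comp continuous_fst
    have h3 : Continuous fun p : GL (Fin (d + 1)) ℝ × ℝ => matVec (p.1.1 * (1 + p.2 • V)) := by
      refine continuous_matVec.comp (h1.matrix_mul ?_)
      exact continuous_const.add (continuous_snd.smul continuous_const)
    have h4 : ∀ a : ℝ, Continuous fun p : GL (Fin (d + 1)) ℝ × ℝ => 1 + a * p.2 := fun a =>
      continuous_const.add (continuous_const.mul continuous_snd)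
    exact (hf.contDiff.continuous.comp h3).mul
      (((continuous_ballCoeff hE τ δ).comp ((h4 α).smul (h2 k))).mul
        ((continuous_ballCoeff hE τ δ).comp ((h4 β).smul (h2 l))))
  have : IsFiniteMeasure (μ.restrict S) := ⟨by
    rw [Measure.restrict_apply_univ]; exact hf.isCompact.measure_lt_top⟩
  have hGi : Integrable (Function.uncurry fun Y s => G Y s)
      ((μ.restrict S).prod (volume.restrict (Ioc 0 ε))) := by
    obtain ⟨B, hB⟩ := exists_bound_ballCoeff hE τ δ
    have hB0 : 0 ≤ B := (abs_nonneg _).trans (hB 0)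
    refine Integrable.of_bound hGc.aestronglyMeasurable (1 * (B * B)) (ae_of_all _ fun p => ?_)
    simp only [Function.uncurry, G]
    rw [norm_mul, norm_mul, Real.norm_of_nonneg (hf.nonneg _)]
    gcongr
    · exact hf.le_one _
    · exact hB _
    · exact hB _
  have hswap : ε * ∫ Y, H Y ∂μ = ∫ Y in S, (∫ s in (0 : ℝ)..ε, G Y s) ∂μ := by
    have h1 : ∀ s ∈ Ioc 0 ε, ∫ Y in S, G Y s ∂μ = ∫ Y, H Y ∂μ := by
      intro s hs
      have hs' := Ioc_subset_Icc_self hs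
      rw [setIntegral_eq_integral_of_forall_compl_eq_zero (hsupp s hs'), hGH s hs']
    simp only [intervalIntegral.integral_of_le hε0.le]
    rw [integral_integral_swap hGi, setIntegral_congr_fun measurableSet_Ioc h1, setIntegral_const]
    simp [hε0.le]
  have hfin : |ε * ∫ Y, H Y ∂μ| ≤ (2 + ε) * (3 * (Kw * (D * κ) * (D * κ))) / c *
      (τ ^ d * (coeffSize (d + 1) δ ‖k‖ * coeffSize (d + 1) δ ‖l‖) / (τ * ‖k - l‖)) * μ.real S := by
    rw [hswap, ← Real.norm_eq_abs]
    exact norm_setIntegral_le_of_norm_le_const hf.isCompact.measure_lt_top hline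
  rw [abs_mul, abs_of_pos hε0] at hfin
  calc |∫ Y, H Y ∂μ| = 1 / ε * (ε * |∫ Y, H Y ∂μ|) := by field_simp
    _ ≤ _ := mul_le_mul_of_nonneg_left hfin (by positivity)
    _ = _ := by ring

/-- The correlation of the coefficients at `k ≠ ±l` is smaller than trivial by a factor
`τ min(|k - l|, |k + l|)`. -/
theorem abs_integral_correlation_le_div [μ.IsMulRightInvariant] [IsFiniteMeasureOnCompacts μ]
    (hf : IsLocalWeight Y₀ f ρ m M) (hE : IsCutoff E C₀) : ∃ C : ℝ, 0 ≤ C ∧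
    ∀ (τ δ : ℝ) (k l : EuclideanSpace ℝ (Fin (d + 1))), 0 < τ → 0 < δ → k ≠ 0 → l ≠ 0 →
      k ≠ l → k ≠ -l →
      |∫ Y, f (matVec Y.1) * (ballCoeff E τ δ (act Y k) * ballCoeff E τ δ (act Y l)) ∂μ| ≤
        C * (τ ^ d * (coeffSize (d + 1) δ ‖k‖ * coeffSize (d + 1) δ ‖l‖) / τ *
          (1 / ‖k - l‖ + 1 / ‖k + l‖)) := by
  obtain ⟨C, hC0, hC⟩ := abs_integral_correlation_le_of_acute μ hf hE
  refine ⟨C, hC0, fun τ δ k l hτ hδ hk hl hne hne' => ?_⟩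
  have acute : ∀ k l : EuclideanSpace ℝ (Fin (d + 1)), k ≠ 0 → l ≠ 0 → k ≠ l → 0 ≤ ⟪k, l⟫ →
      |∫ Y, f (matVec Y.1) * (ballCoeff E τ δ (act Y k) * ballCoeff E τ δ (act Y l)) ∂μ| ≤
        C * (τ ^ d * (coeffSize (d + 1) δ ‖k‖ * coeffSize (d + 1) δ ‖l‖) / (τ * ‖k - l‖)) := by
    intro k l hk hl hne hi
    rcases le_total ‖k‖ ‖l‖ with h | h
    · exact hC τ δ k l hτ hδ hk h hne hi
    · have := hC τ δ l k hτ hδ hl h hne.symm (by rwa [real_inner_comm])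
      rw [norm_sub_rev l k, mul_comm (coeffSize _ _ ‖l‖)] at this
      simp_rw [mul_comm (ballCoeff E τ δ (act _ l))] at this
      exact this
  have hsk := coeffSize_nonneg (d + 1) hδ (norm_nonneg k)
  have hsl := coeffSize_nonneg (d + 1) hδ (norm_nonneg l)
  rcases le_total 0 ⟪k, l⟫ with h | h
  · refine (acute k l hk hl hne h).trans ?_
    gcongr
    rw [← div_div, div_eq_mul_one_div _ ‖k - l‖]
    gcongr
    have : 0 ≤ 1 / ‖k + l‖ := by positivity
    linarith
  · have h1 := acute k (-l) hk (neg_ne_zero.2 hl) hne' (by rw [inner_neg_right]; linarith)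
    simp only [map_neg, ballCoeff_neg hE, norm_neg, sub_neg_eq_add] at h1
    refine h1.trans ?_
    gcongr
    rw [← div_div, div_eq_mul_one_div _ ‖k + l‖]
    gcongr
    have : 0 ≤ 1 / ‖k - l‖ := by positivity
    linarith

end Correlation

/-! ### Lattice sums -/

section LatticeSums

theorem sum_range_inv_mul_inv_le {t : ℝ} (ht : 2 ≤ t) (N : ℕ) :
    ∑ a ∈ Finset.range N, 1 / ((1 + (a : ℝ)) * (1 + t⁻¹ * a)) ≤ 6 * Real.log t := by
  have ht0 : 0 < t := by linarith
  -- the partial sums are compared with `log ((1 + a) / (t + a + 1))`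
  have tele : ∀ M : ℕ, ∑ a ∈ Finset.range M, (1 / (2 + (a : ℝ)) - 1 / (t + 1 + a)) ≤
      Real.log (1 + M) + Real.log (t + 1) - Real.log (t + 1 + M) := by
    intro M
    induction M with
    | zero => simp
    | succ M ih =>
      rw [Finset.sum_range_succ]
      have hM : (0 : ℝ) ≤ M := M.cast_nonneg
      have h1 : 1 / (2 + (M : ℝ)) ≤ Real.log (2 + M) - Real.log (1 + M) := by
        have := Real.one_sub_inv_le_log_of_pos (x := (2 + (M : ℝ)) / (1 + M)) (by positivity)
        rw [Real.log_div (by positivity) (by positivity)] at this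
        refine le_trans (le_of_eq ?_) this
        field_simp
        ring
      have h2 : Real.log (t + 2 + M) - Real.log (t + 1 + M) ≤ 1 / (t + 1 + M) := by
        have := Real.log_le_sub_one_of_pos (x := (t + 2 + (M : ℝ)) / (t + 1 + M)) (by positivity)
        rw [Real.log_div (by positivity) (by positivity)] at this
        refine this.trans (le_of_eq ?_)
        field_simp
        ring
      push_cast
      have e1 : 1 + ((M : ℝ) + 1) = 2 + M := by ring
      have e2 : t + 1 + ((M : ℝ) + 1) = t + 2 + M := by ring
      rw [e1, e2]
      linarith
  have hlog1 : 1 ≤ 2 * Real.log t := by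
    have := Real.log_two_gt_d9
    have h2 : Real.log 2 ≤ Real.log t := Real.log_le_log (by norm_num) ht
    linarith
  have hlog2 : Real.log (t + 1) ≤ 2 * Real.log t := by
    rw [← Real.log_rpow ht0]
    refine Real.log_le_log (by linarith) ?_
    norm_cast
    nlinarith
  rcases N with _ | M
  · simp; linarith
  rw [Finset.sum_range_succ']
  have hterm : ∀ a : ℕ, 1 / ((1 + ((a + 1 : ℕ) : ℝ)) * (1 + t⁻¹ * ((a + 1 : ℕ) : ℝ))) ≤
      2 * (1 / (2 + (a : ℝ)) - 1 / (t + 1 + a)) := by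
    intro a
    have ha : (0 : ℝ) ≤ a := a.cast_nonneg
    have e : 2 * (1 / (2 + (a : ℝ)) - 1 / (t + 1 + a)) =
        2 * (t - 1) / ((2 + a) * (t + 1 + a)) := by
      field_simp
      ring
    have e' : 1 / ((1 + ((a + 1 : ℕ) : ℝ)) * (1 + t⁻¹ * ((a + 1 : ℕ) : ℝ))) =
        t / ((2 + a) * (t + 1 + a)) := by
      push_cast
      field_simp
      ring
    rw [e, e']
    gcongr
    linarith
  have hsum := Finset.sum_le_sum fun a (_ : a ∈ Finset.range M) => hterm a
  rw [← Finset.mul_sum] at hsum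
  have h3 : Real.log (1 + M) ≤ Real.log (t + 1 + M) :=
    Real.log_le_log (by positivity) (by linarith)
  have := tele M
  simp only [Nat.cast_zero, add_zero, mul_zero, mul_one, div_one]
  linarith

theorem sum_int_inv_mul_inv_le {t : ℝ} (ht : 2 ≤ t) (T : Finset ℤ) :
    ∑ a ∈ T, 1 / ((1 + |(a : ℝ)|) * (1 + t⁻¹ * |(a : ℝ)|)) ≤ 12 * Real.log t := by
  have ht0 : 0 < t := by linarith
  have h := sum_range_inv_mul_inv_le ht (T.sup Int.natAbs + 1)
  set R := Finset.range (T.sup Int.natAbs + 1) with hR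
  have hsub : T ⊆ R.image (fun a : ℕ => (a : ℤ)) ∪ R.image (fun a : ℕ => -(a : ℤ)) := by
    intro a ha
    have h1 : a.natAbs ∈ R := by
      rw [hR, Finset.mem_range, Nat.lt_succ_iff]
      exact Finset.le_sup (f := Int.natAbs) ha
    rw [Finset.mem_union, Finset.mem_image, Finset.mem_image]
    rcases Int.natAbs_eq a with h2 | h2
    · exact Or.inl ⟨_, h1, h2.symm⟩
    · exact Or.inr ⟨_, h1, h2.symm⟩
  have hnn : ∀ a : ℤ, 0 ≤ 1 / ((1 + |(a : ℝ)|) * (1 + t⁻¹ * |(a : ℝ)|)) := fun a => by positivity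
  refine (Finset.sum_le_sum_of_subset_of_nonneg hsub fun a _ _ => hnn a).trans ?_
  refine (le_add_of_nonneg_right (Finset.sum_nonneg fun a _ => hnn a)).trans
    (Finset.sum_union_inter (s₁ := R.image fun a : ℕ => (a : ℤ))
      (s₂ := R.image fun a : ℕ => -(a : ℤ))).le |>.trans ?_
  rw [Finset.sum_image (by intro a _ b _ h; simpa using h),
    Finset.sum_image (by intro a _ b _ h; simpa using h)]
  simp only [Int.cast_neg, abs_neg, Int.cast_natCast, Nat.abs_cast]
  linarith

theorem abs_le_norm_intVec {n : ℕ} (k : Fin n → ℤ) (i : Fin n) :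
    |(k i : ℝ)| ≤ ‖intVec k‖ := by
  have := PiLp.norm_apply_le (intVec k) i
  rwa [intVec_apply, Real.norm_eq_abs] at this

theorem one_le_norm_intVec {n : ℕ} {k : Fin n → ℤ} (hk : k ≠ 0) : 1 ≤ ‖intVec k‖ := by
  obtain ⟨i, hi⟩ := Function.ne_iff.1 hk
  refine le_trans ?_ (abs_le_norm_intVec k i)
  exact_mod_cast Int.one_le_abs hi

/-- The comparison weight `(r (1 + δr))^{-n}`, whose sum over `ℤⁿ` diverges only
logarithmically as `δ → 0`. -/
noncomputable def logWeight (n : ℕ) (δ r : ℝ) : ℝ := 1 / (r * (1 + δ * r)) ^ n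

theorem logWeight_nonneg (n : ℕ) {δ r : ℝ} (hδ : 0 < δ) (hr : 0 ≤ r) : 0 ≤ logWeight n δ r := by
  rw [logWeight]; positivity

/-- Each coordinate of `k` contributes a factor `log t`, since `|k|` is at least `1` and at least
every `|kᵢ|`. -/
theorem sum_logWeight_le {n : ℕ} {t : ℝ} (ht : 2 ≤ t) (T : Finset (Fin n → ℤ)) (hT : 0 ∉ T) :
    ∑ k ∈ T, logWeight n t⁻¹ ‖intVec k‖ ≤ (24 * Real.log t) ^ n := by
  have ht0 : 0 < t := by linarith
  have hb : ∀ k ∈ T, logWeight n t⁻¹ ‖intVec k‖ ≤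
      ∏ i, 2 * (1 / ((1 + |(k i : ℝ)|) * (1 + t⁻¹ * |(k i : ℝ)|))) := by
    intro k hk
    have h1 : 1 ≤ ‖intVec k‖ := one_le_norm_intVec fun h => hT (h ▸ hk)
    have h2 : logWeight n t⁻¹ ‖intVec k‖ =
        ∏ _i : Fin n, 1 / (‖intVec k‖ * (1 + t⁻¹ * ‖intVec k‖)) := by
      rw [Finset.prod_const, Finset.card_univ, Fintype.card_fin, logWeight, div_pow, one_pow]
    rw [h2]
    refine Finset.prod_le_prod (fun i _ => by positivity) fun i _ => ?_
    have h3 := abs_le_norm_intVec k i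
    have h4 : 2 * (1 / ((1 + |(k i : ℝ)|) * (1 + t⁻¹ * |(k i : ℝ)|))) =
        1 / ((1 + |(k i : ℝ)|) / 2 * (1 + t⁻¹ * |(k i : ℝ)|)) := by
      field_simp
    rw [h4]
    gcongr
    linarith
  refine (Finset.sum_le_sum hb).trans ?_
  have hsub : T ⊆ Fintype.piFinset fun i => T.image fun k => k i := by
    intro k hk
    rw [Fintype.mem_piFinset]
    exact fun i => Finset.mem_image_of_mem (fun k => k i) hk
  refine (Finset.sum_le_sum_of_subset_of_nonneg hsub fun k _ _ =>
    Finset.prod_nonneg fun i _ => by positivity).trans ?_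
  rw [← Finset.prod_univ_sum (fun i => T.image fun k => k i)
    fun _ (a : ℤ) => 2 * (1 / ((1 + |(a : ℝ)|) * (1 + t⁻¹ * |(a : ℝ)|)))]
  calc _ ≤ ∏ _i : Fin n, 24 * Real.log t := by
        refine Finset.prod_le_prod (fun i _ => Finset.sum_nonneg fun a _ => by positivity)
          fun i _ => ?_
        rw [← Finset.mul_sum]
        linarith [sum_int_inv_mul_inv_le ht (T.image fun k => k i)]
    _ = _ := by rw [Finset.prod_const, Finset.card_univ, Fintype.card_fin]

theorem coeffSize_antitone (n : ℕ) {δ r r' : ℝ} (hδ : 0 < δ) (hr : 0 < r) (h : r ≤ r') :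
    coeffSize n δ r' ≤ coeffSize n δ r := by
  have := coeffSize_le n hδ one_pos le_rfl hr (r' := r') (by rwa [one_mul])
  rwa [Real.one_rpow, one_pow, div_one, one_mul] at this

theorem coeffSize_div_le_logWeight {n : ℕ} (hn : n ≤ 3) {δ r : ℝ} (hδ : 0 < δ) (hr : 1 ≤ r) :
    coeffSize n δ r / r ≤ logWeight n δ r := by
  have hr0 : 0 < r := by linarith
  have hn' : (n : ℝ) ≤ 3 := by exact_mod_cast hn
  have h0 : 0 < δ * r := by positivity
  have h1 : 1 ≤ 1 + δ * r := by linarith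
  have h2 : r ^ (-((n : ℝ) + 1) / 2) / r ≤ r ^ (-(n : ℝ)) := by
    rw [← Real.rpow_sub_one hr0.ne']
    exact Real.rpow_le_rpow_of_exponent_le hr (by linarith)
  rw [Real.rpow_neg hr0.le, Real.rpow_natCast] at h2
  rw [coeffSize, logWeight, div_right_comm, mul_pow, ← div_div, one_div]
  gcongr
  omega

theorem coeffSize_sq_le_logWeight {n : ℕ} (hn : n ≤ 3) {δ r : ℝ} (hδ : 0 < δ) (hr : 1 ≤ r) :
    coeffSize n δ r * coeffSize n δ r ≤ logWeight n δ r := by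
  have hr0 : 0 < r := by linarith
  have h0 : 0 < δ * r := by positivity
  have h1 : 1 ≤ 1 + δ * r := by linarith
  have h2 : r ^ (-((n : ℝ) + 1) / 2) * r ^ (-((n : ℝ) + 1) / 2) ≤ r ^ (-(n : ℝ)) := by
    rw [← Real.rpow_add hr0]
    exact Real.rpow_le_rpow_of_exponent_le hr (by linarith)
  rw [Real.rpow_neg hr0.le, Real.rpow_natCast] at h2
  rw [coeffSize, logWeight, div_mul_div_comm, ← pow_add, mul_pow, ← div_div, one_div]
  gcongr
  omega

/-- For `n ≤ 3` and `r ≥ 1` one has `r^{(n-1)/2} ≤ r ≤ δ⁻¹ (1 + δr)`. -/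
theorem coeffSize_le_logWeight {n : ℕ} (hn : n ≤ 3) {δ r : ℝ} (hδ : 0 < δ) (hr : 1 ≤ r) :
    coeffSize n δ r ≤ δ⁻¹ * logWeight n δ r := by
  have hr0 : 0 < r := by linarith
  have hn' : (n : ℝ) ≤ 3 := by exact_mod_cast hn
  have h0 : 0 < δ * r := by positivity
  have h1 : 1 ≤ 1 + δ * r := by linarith
  have h2 : r ^ (-((n : ℝ) + 1) / 2) ≤ r ^ (-(n : ℝ)) * r := by
    rw [← Real.rpow_add_one hr0.ne']
    exact Real.rpow_le_rpow_of_exponent_le hr (by linarith)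
  rw [Real.rpow_neg hr0.le, Real.rpow_natCast] at h2
  have h3 : δ * r ≤ 1 + δ * r := by linarith
  rw [coeffSize, logWeight]
  calc _ ≤ (r ^ n)⁻¹ * r / ((1 + δ * r) ^ n * (1 + δ * r)) := by
        rw [← pow_succ]
        gcongr
        omega
    _ ≤ (r ^ n)⁻¹ * r / ((1 + δ * r) ^ n * (δ * r)) := by gcongr
    _ = _ := by rw [mul_pow]; field_simp

/-- Both factors are decreasing, so the product is at most its value with both arguments equal to
the smaller of `r` and `s`. -/
theorem coeffSize_div_norm_le {n : ℕ} (hn : n ≤ 3) {δ r s : ℝ} (hδ : 0 < δ) (hr : 1 ≤ r)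
    (hs : 1 ≤ s) : coeffSize n δ r / s ≤ logWeight n δ r + logWeight n δ s := by
  have hr0 : 0 < r := by linarith
  have hs0 : 0 < s := by linarith
  have h1 := logWeight_nonneg n hδ hr0.le
  have h2 := logWeight_nonneg n hδ hs0.le
  have h3 := coeffSize_nonneg n hδ hr0.le
  rcases le_total r s with h | h
  · have : coeffSize n δ r / s ≤ coeffSize n δ r / r := by gcongr
    linarith [coeffSize_div_le_logWeight hn hδ hr]
  · have : coeffSize n δ r / s ≤ coeffSize n δ s / s := by
      gcongr
      exact coeffSize_antitone n hδ hs0 h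
    linarith [coeffSize_div_le_logWeight hn hδ hs]

/-- The factor by which the correlation of two coefficients is smaller than trivial, when their
indices differ by `v`; there is no gain for equal indices. -/
noncomputable def gain {n : ℕ} (τ : ℝ) (v : Fin n → ℤ) : ℝ :=
  if v = 0 then 1 else 1 / (τ * ‖intVec v‖)

/-- One row of the double sum. The permutation `g` is `l ↦ k - l` or `l ↦ k + l`, and its zero
produces the diagonal term. -/
theorem sum_coeffSize_mul_gain_le {n : ℕ} (hn : n ≤ 3) {t τ : ℝ} (ht : 2 ≤ t) (hτ : t / 2 ≤ τ)
    (T : Finset (Fin n → ℤ)) (hT : 0 ∉ T) {k : Fin n → ℤ} (g : Equiv.Perm (Fin n → ℤ))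
    (hg : ∀ l ∈ T, g l = 0 → l = k ∨ l = -k) (hg1 : ∀ l l', g l = 0 → g l' = 0 → l = l') :
    ∑ l ∈ T, coeffSize n t⁻¹ ‖intVec l‖ * gain τ (g l) ≤
      coeffSize n t⁻¹ ‖intVec k‖ + 4 / t * (24 * Real.log t) ^ n := by
  have ht0 : 0 < t := by linarith
  have hδ : 0 < t⁻¹ := by positivity
  have hτ0 : 0 < τ := by linarith
  have hsplit : ∀ l ∈ T, coeffSize n t⁻¹ ‖intVec l‖ * gain τ (g l) ≤
      (if g l = 0 then coeffSize n t⁻¹ ‖intVec k‖ else 0) + 2 / t * (logWeight n t⁻¹ ‖intVec l‖ +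
        if g l = 0 then 0 else logWeight n t⁻¹ ‖intVec (g l)‖) := by
    intro l hl
    have hl1 := one_le_norm_intVec (k := l) fun h => hT (h ▸ hl)
    have hw := logWeight_nonneg n hδ (norm_nonneg (intVec l))
    rw [gain]
    split_ifs with h
    · have : ‖intVec l‖ = ‖intVec k‖ := by
        rcases hg l hl h with h | h
        · rw [h]
        · have : intVec (-k) = -intVec k := by ext i; simp [intVec_apply]
          rw [h, this, norm_neg]
      rw [this, mul_one]
      have : 0 ≤ 2 / t * (logWeight n t⁻¹ ‖intVec k‖ + 0) := by
        have := logWeight_nonneg n hδ (norm_nonneg (intVec k)); positivity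
      linarith
    · rw [zero_add]
      have hg1 := one_le_norm_intVec h
      have h1 := coeffSize_div_norm_le hn hδ hl1 hg1
      have h0 := coeffSize_nonneg n hδ (norm_nonneg (intVec l))
      calc coeffSize n t⁻¹ ‖intVec l‖ * (1 / (τ * ‖intVec (g l)‖))
          = 1 / τ * (coeffSize n t⁻¹ ‖intVec l‖ / ‖intVec (g l)‖) := by field_simp
        _ ≤ 2 / t * _ := by
          refine mul_le_mul ?_ h1 (by positivity) (by positivity)
          rw [div_le_div_iff₀ hτ0 ht0]
          linarith
  refine (Finset.sum_le_sum hsplit).trans ?_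
  rw [Finset.sum_add_distrib, ← Finset.mul_sum, Finset.sum_add_distrib]
  have h1 := sum_logWeight_le ht T hT
  have h2 : ∑ l ∈ T, (if g l = 0 then 0 else logWeight n t⁻¹ ‖intVec (g l)‖) ≤
      (24 * Real.log t) ^ n := by
    refine le_trans (le_of_eq ?_) (sum_logWeight_le ht ((T.filter fun l => g l ≠ 0).map
      g.toEmbedding) ?_)
    · rw [Finset.sum_map, Finset.sum_filter]
      refine Finset.sum_congr rfl fun l _ => ?_
      by_cases h : g l = 0 <;> simp [h]
    · simp
  have h3 : ∑ l ∈ T, (if g l = 0 then coeffSize n t⁻¹ ‖intVec k‖ else 0) ≤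
      coeffSize n t⁻¹ ‖intVec k‖ := by
    have h0 := coeffSize_nonneg n hδ (norm_nonneg (intVec k))
    rw [← Finset.sum_filter, Finset.sum_const, nsmul_eq_mul]
    have : (T.filter fun l => g l = 0).card ≤ 1 := by
      refine Finset.card_le_one.2 fun a ha b hb => ?_
      exact hg1 a b (Finset.mem_filter.1 ha).2 (Finset.mem_filter.1 hb).2
    have : ((T.filter fun l => g l = 0).card : ℝ) ≤ 1 := by exact_mod_cast this
    nlinarith
  have h4 : 2 / t * (∑ l ∈ T, logWeight n t⁻¹ ‖intVec l‖ +
      ∑ l ∈ T, (if g l = 0 then 0 else logWeight n t⁻¹ ‖intVec (g l)‖)) ≤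
      2 / t * ((24 * Real.log t) ^ n + (24 * Real.log t) ^ n) := by gcongr
  have h5 : 2 / t * ((24 * Real.log t) ^ n + (24 * Real.log t) ^ n) =
      4 / t * (24 * Real.log t) ^ n := by ring
  linarith

/-- The double sum that bounds the mean square is at most a power of `log t`. -/
theorem sum_sum_coeffSize_mul_gain_le {n : ℕ} (hn : n ≤ 3) : ∃ C : ℝ, 0 ≤ C ∧
    ∀ (t τ : ℝ), 2 ≤ t → t / 2 ≤ τ → ∀ T : Finset (Fin n → ℤ), 0 ∉ T →
      ∑ k ∈ T, ∑ l ∈ T, coeffSize n t⁻¹ ‖intVec k‖ * coeffSize n t⁻¹ ‖intVec l‖ *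
        (gain τ (k - l) + gain τ (k + l)) ≤ C * Real.log t ^ (2 * n) := by
  refine ⟨2 * 24 ^ n * 2 ^ n + 8 * 24 ^ n * 24 ^ n, by positivity, fun t τ ht hτ T hT => ?_⟩
  have ht0 : 0 < t := by linarith
  have hδ : 0 < t⁻¹ := by positivity
  have hlog1 : 1 ≤ 2 * Real.log t := by
    have := Real.log_two_gt_d9
    have h2 : Real.log 2 ≤ Real.log t := Real.log_le_log (by norm_num) ht
    linarith
  have hlog0 : 0 ≤ Real.log t := by linarith
  set Λ := (24 * Real.log t) ^ n with hΛ
  have hΛ0 : 0 ≤ Λ := by positivity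
  have hrow : ∀ k ∈ T, ∑ l ∈ T, coeffSize n t⁻¹ ‖intVec k‖ * coeffSize n t⁻¹ ‖intVec l‖ *
        (gain τ (k - l) + gain τ (k + l)) ≤ (2 + 8 * Λ) * logWeight n t⁻¹ ‖intVec k‖ := by
    intro k hk
    have hk0 : k ≠ 0 := fun h => hT (h ▸ hk)
    have hk1 := one_le_norm_intVec hk0
    have a1 := sum_coeffSize_mul_gain_le hn ht hτ T hT (k := k) (Equiv.subLeft k)
      (fun l _ h => Or.inl (sub_eq_zero.1 h).symm)
      (fun l l' h h' => (sub_eq_zero.1 h).symm.trans (sub_eq_zero.1 h'))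
    have a2 := sum_coeffSize_mul_gain_le hn ht hτ T hT (k := k) (Equiv.addLeft k)
      (fun l _ h => Or.inr (eq_neg_of_add_eq_zero_right h))
      (fun l l' h h' => (eq_neg_of_add_eq_zero_right h).trans (eq_neg_of_add_eq_zero_right h').symm)
    simp only [Equiv.subLeft_apply, Equiv.coe_addLeft] at a1 a2
    have h0 := coeffSize_nonneg n hδ (norm_nonneg (intVec k))
    have b1 := coeffSize_sq_le_logWeight hn hδ hk1
    have b2 := coeffSize_le_logWeight hn hδ hk1
    rw [inv_inv] at b2
    calc _ = coeffSize n t⁻¹ ‖intVec k‖ *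
          (∑ l ∈ T, coeffSize n t⁻¹ ‖intVec l‖ * gain τ (k - l) +
            ∑ l ∈ T, coeffSize n t⁻¹ ‖intVec l‖ * gain τ (k + l)) := by
          rw [← Finset.sum_add_distrib, Finset.mul_sum]
          exact Finset.sum_congr rfl fun l _ => by ring
      _ ≤ coeffSize n t⁻¹ ‖intVec k‖ * (2 * coeffSize n t⁻¹ ‖intVec k‖ + 8 / t * Λ) := by
          refine mul_le_mul_of_nonneg_left ?_ h0
          have : 8 / t * Λ = 4 / t * Λ + 4 / t * Λ := by ring
          linarith
      _ = 2 * (coeffSize n t⁻¹ ‖intVec k‖ * coeffSize n t⁻¹ ‖intVec k‖) +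
          coeffSize n t⁻¹ ‖intVec k‖ * (8 / t * Λ) := by ring
      _ ≤ 2 * logWeight n t⁻¹ ‖intVec k‖ + t * logWeight n t⁻¹ ‖intVec k‖ * (8 / t * Λ) := by
          gcongr
      _ = _ := by field_simp
  refine (Finset.sum_le_sum hrow).trans ?_
  rw [← Finset.mul_sum]
  calc _ ≤ (2 + 8 * Λ) * Λ := by
        gcongr
        exact sum_logWeight_le ht T hT
    _ = 2 * 24 ^ n * Real.log t ^ n * 1 ^ n + 8 * 24 ^ n * 24 ^ n * Real.log t ^ (2 * n) := by
        rw [hΛ, mul_pow, two_mul n, pow_add, one_pow]; ring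
    _ ≤ 2 * 24 ^ n * Real.log t ^ n * (2 * Real.log t) ^ n +
        8 * 24 ^ n * 24 ^ n * Real.log t ^ (2 * n) := by gcongr
    _ = _ := by rw [mul_pow, two_mul n, pow_add]; ring

theorem summable_logWeight {n : ℕ} {t : ℝ} (ht : 2 ≤ t) :
    Summable fun k : {k : Fin n → ℤ // k ≠ 0} => logWeight n t⁻¹ ‖intVec k.1‖ := by
  have hδ : 0 < t⁻¹ := inv_pos.2 (by linarith)
  refine summable_of_sum_le (c := (24 * Real.log t) ^ n)
    (fun k => logWeight_nonneg n hδ (norm_nonneg _)) fun T => ?_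
  have := sum_logWeight_le ht (T.map (Function.Embedding.subtype _)) (by simp)
  rwa [Finset.sum_map] at this

end LatticeSums

/-! ### Mollified balls -/

section Mollifier

variable {d : ℕ}

/-- The fixed bump from which the mollifier is built; it is supported in the unit ball. -/
noncomputable def unitBump (n : ℕ) : ContDiffBump (0 : EuclideanSpace ℝ (Fin n)) :=
  { rIn := 1 / 2, rOut := 1, rIn_pos := by norm_num, rIn_lt_rOut := by norm_num }

/-- A smooth even probability density on `ℝⁿ` supported in the unit ball. -/
noncomputable def mollifier (n : ℕ) : EuclideanSpace ℝ (Fin n) → ℝ := (unitBump n).normed volume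

/-- The rescaled density `δ⁻ⁿ η(x / δ)`, supported in the ball of radius `δ`. -/
noncomputable def mollifierAt (n : ℕ) (δ : ℝ) (x : EuclideanSpace ℝ (Fin n)) : ℝ :=
  (δ ^ n)⁻¹ * mollifier n (δ⁻¹ • x)

/-- The Fourier transform of the mollifier; it is real because the mollifier is even. -/
noncomputable def mollifierFourier (n : ℕ) (ξ : EuclideanSpace ℝ (Fin n)) : ℝ :=
  (𝓕 (fun x => (mollifier n x : ℂ)) ξ).re

theorem mollifier_neg (n : ℕ) (x : EuclideanSpace ℝ (Fin n)) :
    mollifier n (-x) = mollifier n x := (unitBump n).normed_neg x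

theorem mollifier_nonneg (n : ℕ) (x : EuclideanSpace ℝ (Fin n)) : 0 ≤ mollifier n x :=
  (unitBump n).nonneg_normed x

theorem contDiff_mollifier (n : ℕ) {m : ℕ∞} : ContDiff ℝ m (mollifier n) :=
  (unitBump n).contDiff_normed

theorem hasCompactSupport_mollifier (n : ℕ) : HasCompactSupport (mollifier n) :=
  (unitBump n).hasCompactSupport_normed

theorem fourier_mollifier_neg (n : ℕ) (ξ : EuclideanSpace ℝ (Fin n)) :
    𝓕 (fun x => (mollifier n x : ℂ)) (-ξ) = 𝓕 (fun x => (mollifier n x : ℂ)) ξ := by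
  have h := Real.fourier_comp_linearIsometry (LinearIsometryEquiv.neg ℝ)
    (fun x : EuclideanSpace ℝ (Fin n) => (mollifier n x : ℂ)) ξ
  have h2 : (fun x : EuclideanSpace ℝ (Fin n) => (mollifier n x : ℂ)) ∘
      (LinearIsometryEquiv.neg ℝ : EuclideanSpace ℝ (Fin n) ≃ₗᵢ[ℝ] _) =
      fun x => (mollifier n x : ℂ) := by
    funext x
    simp [mollifier_neg]
  rw [h2] at h
  simpa using h.symm

theorem fourier_mollifier (n : ℕ) (ξ : EuclideanSpace ℝ (Fin n)) :
    𝓕 (fun x => (mollifier n x : ℂ)) ξ = (mollifierFourier n ξ : ℂ) := by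
  refine (Complex.conj_eq_iff_re.1 ?_).symm
  conv_rhs => rw [← fourier_mollifier_neg]
  rw [Real.fourier_eq', Real.fourier_eq', ← integral_conj]
  refine integral_congr_ae (ae_of_all _ fun x => ?_)
  simp only [smul_eq_mul, map_mul, Complex.conj_ofReal, ← Complex.exp_conj, Complex.conj_I,
    inner_neg_right]
  congr 2
  push_cast
  ring

theorem exists_isCutoff_mollifierFourier (n : ℕ) : ∃ C, IsCutoff (mollifierFourier n) C := by
  have hs : HasCompactSupport fun x => (mollifier n x : ℂ) :=
    (hasCompactSupport_mollifier n).comp_left (g := fun r : ℝ => (r : ℂ)) (by simp)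
  have hd : ContDiff ℝ ((⊤ : ℕ∞) : WithTop ℕ∞) fun x => (mollifier n x : ℂ) :=
    Complex.ofRealCLM.contDiff.comp (contDiff_mollifier n)
  let g := 𝓕 (hs.toSchwartzMap hd)
  have hg : ∀ ξ, g ξ = 𝓕 (fun x => (mollifier n x : ℂ)) ξ := fun ξ => by
    simp only [g]
    rw [SchwartzMap.fourier_coe]
    rfl
  have hE : mollifierFourier n = fun ξ => Complex.reCLM (g ξ) := by
    funext ξ
    rw [hg]
    rfl
  obtain ⟨A, hA⟩ : ∃ A : ℝ, ∀ ξ, (1 + ‖ξ‖) ^ 4 * ‖g ξ‖ ≤ A := by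
    have := SchwartzMap.one_add_le_sup_seminorm_apply (𝕜 := ℝ) (m := (4, 0)) (k := 4) (n := 0)
      le_rfl le_rfl g
    simp only [norm_iteratedFDeriv_zero] at this
    exact ⟨_, this⟩
  obtain ⟨B, hB⟩ : ∃ B : ℝ, ∀ ξ, (1 + ‖ξ‖) ^ 5 * ‖fderiv ℝ g ξ‖ ≤ B := by
    have := SchwartzMap.one_add_le_sup_seminorm_apply (𝕜 := ℝ) (m := (5, 1)) (k := 5) (n := 1)
      le_rfl le_rfl g
    simp only [norm_iteratedFDeriv_one] at this
    exact ⟨_, this⟩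
  have hpos : ∀ ξ : EuclideanSpace ℝ (Fin n), 0 < 1 + ‖ξ‖ := fun ξ => by positivity
  refine ⟨max (max A B) 0, ?_, le_max_right _ _, fun ξ => ?_, fun ξ => ?_, fun ξ => ?_⟩
  · rw [hE]
    exact Complex.reCLM.contDiff.comp (g.smooth 1)
  · rw [mollifierFourier, fourier_mollifier_neg]
    rfl
  · rw [le_div_iff₀ (pow_pos (hpos ξ) 4), mul_comm]
    refine le_trans ?_ ((hA ξ).trans ((le_max_left A B).trans (le_max_left _ _)))
    gcongr
    rw [hE]
    exact Complex.abs_re_le_norm _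
  · rw [le_div_iff₀ (pow_pos (hpos ξ) 5), mul_comm]
    refine le_trans ?_ ((hB ξ).trans ((le_max_right A B).trans (le_max_left _ _)))
    gcongr
    have h1 : HasFDerivAt (mollifierFourier n) (Complex.reCLM.comp (fderiv ℝ g ξ)) ξ := by
      rw [hE]
      exact Complex.reCLM.hasFDerivAt.comp ξ (g.differentiable.differentiableAt).hasFDerivAt
    rw [h1.fderiv]
    refine (ContinuousLinearMap.opNorm_comp_le _ _).trans ?_
    rw [Complex.reCLM_norm, one_mul]

theorem mollifierFourier_zero (n : ℕ) : mollifierFourier n 0 = 1 := by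
  have h : 𝓕 (fun x => (mollifier n x : ℂ)) 0 = 1 := by
    rw [Real.fourier_eq']
    simp only [inner_zero_right, mul_zero, Complex.ofReal_zero, zero_mul, Complex.exp_zero, one_smul]
    rw [integral_complex_ofReal, mollifier, ContDiffBump.integral_normed, Complex.ofReal_one]
  rw [mollifierFourier, h, Complex.one_re]

theorem mollifierAt_nonneg (n : ℕ) {δ : ℝ} (hδ : 0 < δ) (x : EuclideanSpace ℝ (Fin n)) :
    0 ≤ mollifierAt n δ x := by
  have := mollifier_nonneg n (δ⁻¹ • x)
  rw [mollifierAt]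
  positivity

theorem mollifierAt_eq_zero (n : ℕ) {δ : ℝ} (hδ : 0 < δ) {x : EuclideanSpace ℝ (Fin n)}
    (hx : δ ≤ ‖x‖) : mollifierAt n δ x = 0 := by
  have : δ⁻¹ • x ∉ Function.support (mollifier n) := by
    rw [mollifier, ContDiffBump.support_normed_eq, Metric.mem_ball, dist_zero_right, norm_smul,
      norm_inv, Real.norm_of_nonneg hδ.le, not_lt]
    change 1 ≤ δ⁻¹ * ‖x‖
    rw [inv_mul_eq_div, one_le_div hδ]
    exact hx
  rw [mollifierAt, Function.notMem_support.1 this, mul_zero]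

theorem continuous_mollifierAt (n : ℕ) (δ : ℝ) : Continuous (mollifierAt n δ) := by
  have := (contDiff_mollifier n (m := 0)).continuous
  unfold mollifierAt
  fun_prop

theorem hasCompactSupport_mollifierAt (n : ℕ) {δ : ℝ} (hδ : 0 < δ) :
    HasCompactSupport (mollifierAt n δ) := by
  refine HasCompactSupport.intro (isCompact_closedBall 0 δ) fun x hx => ?_
  rw [Metric.mem_closedBall, dist_zero_right, not_le] at hx
  exact mollifierAt_eq_zero n hδ hx.le

theorem integral_comp_inv_smul_mul {n : ℕ} {δ : ℝ} (hδ : 0 < δ)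
    (F : EuclideanSpace ℝ (Fin n) → ℂ) :
    ∫ x, F (δ⁻¹ • x) = ((δ ^ n : ℝ) : ℂ) * ∫ x, F x := by
  rw [Measure.integral_comp_smul, finrank_euclideanSpace_fin, inv_pow, inv_inv,
    abs_of_pos (by positivity), Complex.real_smul]

theorem fourier_mollifierAt (n : ℕ) {δ : ℝ} (hδ : 0 < δ) (ξ : EuclideanSpace ℝ (Fin n)) :
    𝓕 (fun x => (mollifierAt n δ x : ℂ)) ξ = (mollifierFourier n (δ • ξ) : ℂ) := by
  rw [← fourier_mollifier, Real.fourier_eq', Real.fourier_eq']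
  have h := integral_comp_inv_smul_mul (n := n) hδ fun x =>
    Complex.exp (((-2 * Real.pi * inner ℝ x (δ • ξ) : ℝ) : ℂ) * Complex.I) • (mollifier n x : ℂ)
  have hδn : ((δ ^ n : ℝ) : ℂ) ≠ 0 := by exact_mod_cast (pow_pos hδ n).ne'
  rw [← mul_right_inj' hδn, ← h, ← integral_const_mul]
  refine integral_congr_ae (ae_of_all _ fun x => ?_)
  simp only [mollifierAt, smul_eq_mul, inner_smul_left, inner_smul_right, conj_trivial]
  rw [mul_inv_cancel_left₀ hδ.ne', mul_left_comm, ← Complex.ofReal_mul,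
    mul_inv_cancel_left₀ (pow_pos hδ n).ne']

theorem integral_mollifierAt (n : ℕ) {δ : ℝ} (hδ : 0 < δ) : ∫ x, mollifierAt n δ x = 1 := by
  have h := fourier_mollifierAt n hδ 0
  rw [smul_zero, mollifierFourier_zero, Real.fourier_eq'] at h
  simp only [inner_zero_right, mul_zero, Complex.ofReal_zero, zero_mul, Complex.exp_zero,
    one_smul] at h
  rw [integral_complex_ofReal] at h
  exact_mod_cast h

/-- The indicator of the ball of radius `τ`, mollified at scale `δ`. -/
noncomputable def smoothBall (n : ℕ) (τ δ : ℝ) (x : EuclideanSpace ℝ (Fin n)) : ℝ :=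
  ∫ y in Metric.closedBall 0 τ, mollifierAt n δ (x - y)

theorem integrable_mollifierAt_sub (n : ℕ) {δ : ℝ} (hδ : 0 < δ) (x : EuclideanSpace ℝ (Fin n)) :
    Integrable fun y => mollifierAt n δ (x - y) :=
  ((continuous_mollifierAt n δ).integrable_of_hasCompactSupport
    (hasCompactSupport_mollifierAt n hδ)).comp_sub_left x

theorem smoothBall_nonneg (n : ℕ) (τ : ℝ) {δ : ℝ} (hδ : 0 < δ) (x : EuclideanSpace ℝ (Fin n)) :
    0 ≤ smoothBall n τ δ x :=
  integral_nonneg fun _ => mollifierAt_nonneg n hδ _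

theorem smoothBall_le_one (n : ℕ) (τ : ℝ) {δ : ℝ} (hδ : 0 < δ) (x : EuclideanSpace ℝ (Fin n)) :
    smoothBall n τ δ x ≤ 1 := by
  refine (setIntegral_le_integral (integrable_mollifierAt_sub n hδ x)
    (ae_of_all _ fun _ => mollifierAt_nonneg n hδ _)).trans ?_
  rw [integral_sub_left_eq_self (mollifierAt n δ), integral_mollifierAt n hδ]

theorem smoothBall_eq_one (n : ℕ) {τ δ : ℝ} (hδ : 0 < δ) {x : EuclideanSpace ℝ (Fin n)}
    (hx : ‖x‖ + δ ≤ τ) : smoothBall n τ δ x = 1 := by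
  rw [smoothBall, setIntegral_eq_integral_of_forall_compl_eq_zero,
    integral_sub_left_eq_self (mollifierAt n δ), integral_mollifierAt n hδ]
  intro y hy
  rw [Metric.mem_closedBall, dist_zero_right, not_le] at hy
  refine mollifierAt_eq_zero n hδ ?_
  have := norm_sub_norm_le y x
  rw [norm_sub_rev] at this
  linarith

theorem smoothBall_eq_zero (n : ℕ) {τ δ : ℝ} (hδ : 0 < δ) {x : EuclideanSpace ℝ (Fin n)}
    (hx : τ + δ ≤ ‖x‖) : smoothBall n τ δ x = 0 := by
  refine setIntegral_eq_zero_of_forall_eq_zero fun y hy => mollifierAt_eq_zero n hδ ?_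
  rw [Metric.mem_closedBall, dist_zero_right] at hy
  have := norm_sub_norm_le x y
  linarith

theorem smoothBall_eq_convolution (n : ℕ) (τ δ : ℝ) :
    (fun x => (smoothBall n τ δ x : ℂ)) =
      convolution ((Metric.closedBall (0 : EuclideanSpace ℝ (Fin n)) τ).indicator fun _ => (1 : ℂ))
        (fun x => (mollifierAt n δ x : ℂ)) (ContinuousLinearMap.mul ℂ ℂ) volume := by
  funext x
  rw [convolution, smoothBall, ← integral_complex_ofReal,
    ← integral_indicator Metric.isClosed_closedBall.measurableSet]
  refine integral_congr_ae (ae_of_all _ fun y => ?_)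
  simp only [ContinuousLinearMap.mul_apply']
  by_cases hy : y ∈ Metric.closedBall (0 : EuclideanSpace ℝ (Fin n)) τ
  · rw [indicator_of_mem hy, indicator_of_mem hy, one_mul]
  · rw [indicator_of_notMem hy, indicator_of_notMem hy, zero_mul]

theorem integrable_indicator_closedBall (n : ℕ) (τ : ℝ) :
    Integrable ((Metric.closedBall (0 : EuclideanSpace ℝ (Fin n)) τ).indicator
      fun _ => (1 : ℂ)) := by
  rw [integrable_indicator_iff Metric.isClosed_closedBall.measurableSet]
  exact integrableOn_const (isCompact_closedBall _ _).measure_lt_top.ne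

theorem continuous_smoothBall (n : ℕ) (τ : ℝ) {δ : ℝ} (hδ : 0 < δ) :
    Continuous fun x => (smoothBall n τ δ x : ℂ) := by
  rw [smoothBall_eq_convolution]
  refine HasCompactSupport.continuous_convolution_right _ ?_
    (integrable_indicator_closedBall n τ).locallyIntegrable
    (Complex.continuous_ofReal.comp (continuous_mollifierAt n δ))
  exact (hasCompactSupport_mollifierAt n hδ).comp_left (g := fun r : ℝ => (r : ℂ)) (by simp)

theorem fourier_smoothBall (hd : 0 < d) {τ δ : ℝ} (hτ : 0 < τ) (hδ : 0 < δ)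
    (ξ : EuclideanSpace ℝ (Fin (d + 1))) :
    𝓕 (fun x => (smoothBall (d + 1) τ δ x : ℂ)) ξ =
      (ballCoeff (mollifierFourier (d + 1)) τ δ ξ : ℂ) := by
  have hi : Integrable fun x => (mollifierAt (d + 1) δ x : ℂ) :=
    ((continuous_mollifierAt _ δ).integrable_of_hasCompactSupport
      (hasCompactSupport_mollifierAt _ hδ)).ofReal
  rw [smoothBall_eq_convolution,
    Real.fourier_mul_convolution_eq (integrable_indicator_closedBall _ τ) hi,
    fourier_indicator_closedBall hd hτ, fourier_mollifierAt _ hδ, ballCoeff, ← Complex.ofReal_mul]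

theorem ballCoeff_zero (hd : 0 < d) {τ : ℝ} (hτ : 0 < τ) (δ : ℝ) :
    ballCoeff (mollifierFourier (d + 1)) τ δ 0 =
      τ ^ (d + 1) * (volume (unitBall (d + 1))).toReal := by
  have h := fourier_indicator_closedBall hd hτ 0
  rw [Real.fourier_eq'] at h
  simp only [inner_zero_right, mul_zero, Complex.ofReal_zero, zero_mul, Complex.exp_zero,
    one_smul] at h
  rw [integral_indicator Metric.isClosed_closedBall.measurableSet, setIntegral_const,
    Complex.real_smul, mul_one] at h
  have h' : volume.real (Metric.closedBall (0 : EuclideanSpace ℝ (Fin (d + 1))) τ) =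
      ballVol d * τ ^ (d + 1) * besselF (d + 1) (2 * Real.pi * τ * ‖(0 : EuclideanSpace ℝ (Fin (d + 1)))‖) := by
    exact_mod_cast h
  rw [ballCoeff, smul_zero, mollifierFourier_zero, mul_one, ← h', measureReal_def,
    Measure.addHaar_closedBall _ _ hτ.le, ENNReal.toReal_mul,
    ENNReal.toReal_ofReal (by positivity), finrank_euclideanSpace_fin]
  rw [unitBall, Measure.addHaar_closedBall _ _ zero_le_one]
  simp

end Mollifier

/-! ### Duality -/

section Dual

variable {n : ℕ}

/-- The inverse transpose `X⁻ᵀ`, whose lattice is dual to that of `X`. -/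
def dual (X : GL (Fin n) ℝ) : GL (Fin n) ℝ where
  val := (X⁻¹).1ᵀ
  inv := X.1ᵀ
  val_inv := by rw [← Matrix.transpose_mul, Units.mul_inv, Matrix.transpose_one]
  inv_val := by rw [← Matrix.transpose_mul, Units.inv_mul, Matrix.transpose_one]

theorem dual_dual (X : GL (Fin n) ℝ) : dual (dual X) = X := Units.ext rfl

theorem dual_mul (X Z : GL (Fin n) ℝ) : dual (X * Z) = dual X * dual Z := by
  apply Units.ext
  change ((X * Z)⁻¹).1ᵀ = (X⁻¹).1ᵀ * (Z⁻¹).1ᵀ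
  rw [_root_.mul_inv_rev, Units.val_mul, Matrix.transpose_mul]

theorem continuous_dual : Continuous (dual (n := n)) :=
  Units.continuous_iff.2 ⟨((continuous_val_GL n).comp continuous_inv).matrix_transpose,
    (continuous_val_GL n).matrix_transpose⟩

/-- `X ↦ X⁻ᵀ` as a homeomorphism. -/
def dualHomeomorph (n : ℕ) : GL (Fin n) ℝ ≃ₜ GL (Fin n) ℝ where
  toFun := dual
  invFun := dual
  left_inv := dual_dual
  right_inv := dual_dual
  continuous_toFun := continuous_dual
  continuous_invFun := continuous_dual

theorem isMulRightInvariant_map_dual (ν : Measure (GL (Fin n) ℝ)) [ν.IsMulRightInvariant] :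
    (ν.map dual).IsMulRightInvariant := by
  refine ⟨fun g => ?_⟩
  have hm : ∀ h : GL (Fin n) ℝ, Measurable fun X => X * h := fun h =>
    (continuous_mul_const h).measurable
  have hd : Measurable (dual (n := n)) := continuous_dual.measurable
  rw [Measure.map_map (hm g) hd]
  have : (fun X => X * g) ∘ dual = dual ∘ fun X => X * dual g := by
    funext X
    simp [dual_mul, dual_dual]
  rw [this, ← Measure.map_map hd (hm _), map_mul_right_eq_self]

theorem isFiniteMeasureOnCompacts_map_dual (ν : Measure (GL (Fin n) ℝ))
    [IsFiniteMeasureOnCompacts ν] : IsFiniteMeasureOnCompacts (ν.map dual) := by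
  refine ⟨fun K hK => ?_⟩
  have h : Measure.map dual ν K = ν (dual ⁻¹' K) :=
    (dualHomeomorph n).toMeasurableEquiv.map_apply K
  rw [h]
  exact ((dualHomeomorph n).isCompact_preimage.2 hK).measure_lt_top

theorem inner_act_inv (X : GL (Fin n) ℝ) (y ξ : EuclideanSpace ℝ (Fin n)) :
    inner ℝ (act X⁻¹ y) ξ = inner ℝ y (act (dual X) ξ) := by
  simp only [PiLp.inner_apply, RCLike.inner_apply, conj_trivial, act]
  simp_rw [toEuclideanLin_apply', Finset.mul_sum, Finset.sum_mul]
  rw [Finset.sum_comm]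
  refine Finset.sum_congr rfl fun i _ => Finset.sum_congr rfl fun j _ => ?_
  change ξ j * ((X⁻¹).1 j i * y i) = (X⁻¹).1 j i * ξ j * y i
  ring

theorem det_act (X : GL (Fin n) ℝ) : LinearMap.det (act X) = X.1.det := by
  rw [act, Matrix.toEuclideanLin, Matrix.toLpLin_eq_toLin, LinearMap.det_toLin]

theorem det_inv_GL (X : GL (Fin n) ℝ) : (X⁻¹).1.det = (X.1.det)⁻¹ := by
  refine eq_inv_of_mul_eq_one_left ?_
  rw [← Matrix.det_mul, Units.inv_mul, Matrix.det_one]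

theorem det_ne_zero_GL (X : GL (Fin n) ℝ) : X.1.det ≠ 0 :=
  ((Matrix.isUnit_iff_isUnit_det _).1 X.isUnit).ne_zero

theorem continuous_act_apply (X : GL (Fin n) ℝ) : Continuous (act X) :=
  LinearMap.continuous_of_finiteDimensional _

/-- The Fourier transform turns composition with `X` into composition with `X⁻ᵀ`. -/
theorem fourier_comp_act (X : GL (Fin n) ℝ) {g : EuclideanSpace ℝ (Fin n) → ℂ}
    (hg : Continuous g) (ξ : EuclideanSpace ℝ (Fin n)) :
    𝓕 (fun x => g (act X x)) ξ = ((|(X⁻¹).1.det| : ℝ) : ℂ) * 𝓕 g (act (dual X) ξ) := by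
  rw [Real.fourier_eq', Real.fourier_eq']
  have hc := continuous_act_apply X
  have hc' := continuous_act_apply X⁻¹
  let F : EuclideanSpace ℝ (Fin n) → ℂ := fun y =>
    Complex.exp (((-2 * Real.pi * inner ℝ (act X⁻¹ y) ξ : ℝ) : ℂ) * Complex.I) • g y
  have hF : Continuous F := by fun_prop
  have h1 : ∫ x, F (act X x) = ∫ y, F y ∂(Measure.map (act X) volume) :=
    (integral_map hc.measurable.aemeasurable hF.aestronglyMeasurable).symm
  rw [Measure.map_linearMap_addHaar_eq_smul_addHaar _ (by rw [det_act]; exact det_ne_zero_GL X),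
    integral_smul_measure, det_act, ENNReal.toReal_ofReal (abs_nonneg _)] at h1
  simp only [F, act_inv_act] at h1
  rw [h1, det_inv_GL, Complex.real_smul]
  simp only [inner_act_inv]

end Dual

/-! ### Poisson summation for a mollified ball -/

section Poisson

variable {n d : ℕ}

theorem norm_le_of_act (X : GL (Fin n) ℝ) (v : EuclideanSpace ℝ (Fin n)) :
    ‖v‖ ≤ ‖matVec (X⁻¹).1‖ * ‖act X v‖ := by
  calc ‖v‖ = ‖act X⁻¹ (act X v)‖ := by rw [act_inv_act]
    _ ≤ _ := norm_toEuclideanLin_le _ _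

theorem finite_setOf_norm_intVec_le (n : ℕ) (R : ℝ) :
    {k : Fin n → ℤ | ‖intVec k‖ ≤ R}.Finite := by
  refine (Fintype.piFinset fun _ : Fin n => Finset.Icc (-⌈R⌉) ⌈R⌉).finite_toSet.subset ?_
  intro k hk
  rw [Finset.mem_coe, Fintype.mem_piFinset]
  intro i
  have h := (abs_le_norm_intVec k i).trans (hk.trans (Int.le_ceil R))
  have h' : |k i| ≤ ⌈R⌉ := by exact_mod_cast h
  exact Finset.mem_Icc.2 (abs_le.1 h')

theorem setOf_norm_act_le_subset (X : GL (Fin n) ℝ) {t : ℝ} :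
    {k : Fin n → ℤ | ‖act X (intVec k)‖ ≤ t} ⊆ {k | ‖intVec k‖ ≤ ‖matVec (X⁻¹).1‖ * t} := by
  intro k hk
  exact (norm_le_of_act X _).trans (by gcongr; exact hk)

theorem finite_setOf_norm_act_le (X : GL (Fin n) ℝ) (t : ℝ) :
    {k : Fin n → ℤ | ‖act X (intVec k)‖ ≤ t}.Finite :=
  (finite_setOf_norm_intVec_le n _).subset (setOf_norm_act_le_subset X)

/-- The sum over the nonzero frequencies in the Poisson formula for the ball of radius `τ` mollified
at scale `1/t`, as a function of the dual matrix `Y`. -/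
noncomputable def dualSum (τ t : ℝ) (Y : GL (Fin (d + 1)) ℝ) : ℝ :=
  ∑' k : Fin (d + 1) → ℤ,
    if k = 0 then 0 else ballCoeff (mollifierFourier (d + 1)) τ t⁻¹ (act Y (intVec k))

theorem summable_ballCoeff (hd : d ≤ 2) {τ t : ℝ} (hτ : 0 < τ) (ht : 2 ≤ t)
    (Y : GL (Fin (d + 1)) ℝ) : Summable fun k : Fin (d + 1) → ℤ =>
      if k = 0 then 0 else ballCoeff (mollifierFourier (d + 1)) τ t⁻¹ (act Y (intVec k)) := by
  obtain ⟨C₀, hE⟩ := exists_isCutoff_mollifierFourier (d + 1)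
  obtain ⟨D, hD0, hD⟩ := abs_ballCoeff_le hE
  obtain ⟨f, ρ, m, M, hf, -⟩ := exists_isLocalWeight Y
  have hδ : 0 < t⁻¹ := inv_pos.2 (by linarith)
  have h := (summable_logWeight (n := d + 1) ht).mul_left
    (D * τ ^ ((d : ℝ) / 2) * (m ^ (-(((d + 1 : ℕ) : ℝ) + 1) / 2) / m ^ 4) * t)
  have h := (summable_subtype_iff_indicator (s := {k : Fin (d + 1) → ℤ | k ≠ 0})
    (f := fun k => D * τ ^ ((d : ℝ) / 2) * (m ^ (-(((d + 1 : ℕ) : ℝ) + 1) / 2) / m ^ 4) * t *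
      logWeight (d + 1) t⁻¹ ‖intVec k‖)).1 h
  refine Summable.of_norm_bounded h fun k => ?_
  by_cases hk : k = 0
  · simp [hk]
  rw [if_neg hk, indicator_of_mem (by exact hk)]
  have hk1 := one_le_norm_intVec hk
  have hk0 : intVec k ≠ 0 := norm_pos_iff.1 (by linarith)
  have hYY : ‖matVec Y.1 - matVec Y.1‖ ≤ 2 * ρ := by
    rw [sub_self, norm_zero]; linarith [hf.pos_rho]
  obtain ⟨h1, h2⟩ := coeffSize_act_le hf hYY hδ hk0
  have h3 := coeffSize_le_logWeight (n := d + 1) (by omega) hδ hk1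
  rw [inv_inv] at h3
  have hm := hf.pos_m
  calc _ ≤ D * (τ ^ ((d : ℝ) / 2) * coeffSize (d + 1) t⁻¹ ‖act Y (intVec k)‖) :=
        hD τ t⁻¹ _ hτ hδ h1
    _ ≤ D * (τ ^ ((d : ℝ) / 2) * (m ^ (-(((d + 1 : ℕ) : ℝ) + 1) / 2) / m ^ 4 *
          (t * logWeight (d + 1) t⁻¹ ‖intVec k‖))) := by
        gcongr
        exact h2.trans (by gcongr)
    _ = _ := by ring

theorem intVec_zero : intVec (0 : Fin n → ℤ) = 0 := by
  ext i
  simp [intVec_apply]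

/-- The Poisson summation formula for the mollified ball and the lattice of `X`. -/
theorem tsum_smoothBall (hd : 0 < d) (hd2 : d ≤ 2) {τ t : ℝ} (hτ : 0 < τ) (ht : 2 ≤ t)
    (X : GL (Fin (d + 1)) ℝ) :
    ∑' k : Fin (d + 1) → ℤ, smoothBall (d + 1) τ t⁻¹ (act X (intVec k)) =
      |(X⁻¹).1.det| * (τ ^ (d + 1) * (volume (unitBall (d + 1))).toReal + dualSum τ t (dual X)) := by
  have hδ : 0 < t⁻¹ := inv_pos.2 (by linarith)
  have hs := (summable_ballCoeff hd2 hτ ht (dual X)).hasSum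
  have hs1 := (hasSum_ite_eq (0 : Fin (d + 1) → ℤ)
    (τ ^ (d + 1) * (volume (unitBall (d + 1))).toReal)).add hs
  have hs2 : HasSum (fun k : Fin (d + 1) → ℤ => |(X⁻¹).1.det| *
      ballCoeff (mollifierFourier (d + 1)) τ t⁻¹ (act (dual X) (intVec k)))
      (|(X⁻¹).1.det| * (τ ^ (d + 1) * (volume (unitBall (d + 1))).toReal +
        dualSum τ t (dual X))) := by
    refine HasSum.mul_left _ ?_
    convert! hs1 using 2 with k
    by_cases hk : k = 0
    · rw [if_pos hk, if_pos hk, hk, intVec_zero, map_zero, ballCoeff_zero hd hτ, add_zero]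
    · rw [if_neg hk, if_neg hk, zero_add]
  have hc := continuous_smoothBall (d + 1) τ hδ
  have hF : ∀ k : Fin (d + 1) → ℤ,
      𝓕 (fun x => (smoothBall (d + 1) τ t⁻¹ (act X x) : ℂ)) (intVec k) =
        ((|(X⁻¹).1.det| * ballCoeff (mollifierFourier (d + 1)) τ t⁻¹
          (act (dual X) (intVec k)) : ℝ) : ℂ) := by
    intro k
    rw [fourier_comp_act X hc, fourier_smoothBall hd hτ hδ, Complex.ofReal_mul]
  have hP := hasSum_fourier_intVec (g := fun x => (smoothBall (d + 1) τ t⁻¹ (act X x) : ℂ))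
    (hc.comp (continuous_act_apply X)) ?_ ?_
  · simp_rw [hF] at hP
    rw [← Complex.ofReal_tsum] at hP
    exact (Complex.hasSum_ofReal.1 hP).unique hs2
  · refine HasCompactSupport.intro
      (isCompact_closedBall 0 (‖matVec (X⁻¹).1‖ * (τ + t⁻¹))) fun x hx => ?_
    rw [Metric.mem_closedBall, dist_zero_right, not_le] at hx
    rw [smoothBall_eq_zero _ hδ, Complex.ofReal_zero]
    by_contra h
    rw [not_le] at h
    have := norm_le_of_act X x
    have h2 : ‖matVec (X⁻¹).1‖ * ‖act X x‖ ≤ ‖matVec (X⁻¹).1‖ * (τ + t⁻¹) := by gcongr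
    linarith
  · simp_rw [hF]
    exact Complex.summable_ofReal.2 hs2.summable

theorem summable_smoothBall {τ δ : ℝ} (hδ : 0 < δ) (X : GL (Fin n) ℝ) :
    Summable fun k : Fin n → ℤ => smoothBall n τ δ (act X (intVec k)) := by
  refine summable_of_ne_finset_zero (s := (finite_setOf_norm_act_le X (τ + δ)).toFinset)
    fun k hk => smoothBall_eq_zero n hδ ?_
  rw [Finite.mem_toFinset, mem_ofPred_eq, not_le] at hk
  exact hk.le

theorem latticeCount_eq_tsum (X : GL (Fin n) ℝ) {t : ℝ} (ht : 0 < t) :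
    HasSum ({k : Fin n → ℤ | ‖act X (intVec k)‖ ≤ t}.indicator fun _ => (1 : ℝ))
      (latticeCount X t) := by
  have hfin := finite_setOf_norm_act_le X t
  have h : HasSum ({k : Fin n → ℤ | ‖act X (intVec k)‖ ≤ t}.indicator fun _ => (1 : ℝ)) _ :=
    hasSum_sum_of_ne_finset_zero (s := hfin.toFinset) fun k hk => by
      rw [Finite.mem_toFinset] at hk
      exact indicator_of_notMem hk _
  convert! h using 1
  rw [latticeCount_eq X ht, ncard_eq_toFinset_card _ hfin, Finset.card_eq_sum_ones, Nat.cast_sum]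
  refine Finset.sum_congr rfl fun k hk => ?_
  rw [indicator_of_mem (hfin.mem_toFinset.1 hk), Nat.cast_one]

/-- The lattice remainder is controlled by the dual sums for the radii `t ± 1/t`, because the
indicator of the ball of radius `t` lies between the balls of these radii mollified at scale
`1/t`. The volumes differ by `O(t^{n-2})`, which is `O(t^{(n-1)/2})` for `n ≤ 3`. -/
theorem abs_remainderGL_le (hd : 0 < d) (hd2 : d ≤ 2) {t : ℝ} (ht : 2 ≤ t)
    (X : GL (Fin (d + 1)) ℝ) :
    |remainderGL X t| ≤ |(X⁻¹).1.det| * (|dualSum (t + t⁻¹) t (dual X)| +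
      |dualSum (t - t⁻¹) t (dual X)| + 7 * (volume (unitBall (d + 1))).toReal * t ^ (d - 1)) := by
  have ht0 : 0 < t := by linarith
  have hδ : 0 < t⁻¹ := inv_pos.2 ht0
  have hδ1 : t⁻¹ ≤ 1 := inv_le_one_of_one_le₀ (by linarith)
  have hN := latticeCount_eq_tsum X ht0
  set V := (volume (unitBall (d + 1))).toReal with hV
  have hV0 : 0 ≤ V := ENNReal.toReal_nonneg
  set J := |(X⁻¹).1.det| with hJ
  have hJ0 : 0 ≤ J := abs_nonneg _
  have hup : (latticeCount X t : ℝ) ≤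
      J * ((t + t⁻¹) ^ (d + 1) * V + dualSum (t + t⁻¹) t (dual X)) := by
    rw [← tsum_smoothBall hd hd2 (by linarith) ht X, ← hN.tsum_eq]
    refine hN.summable.tsum_le_tsum (fun k => ?_) (summable_smoothBall hδ X)
    by_cases hk : k ∈ {k : Fin (d + 1) → ℤ | ‖act X (intVec k)‖ ≤ t}
    · rw [indicator_of_mem hk, smoothBall_eq_one _ hδ]
      rw [mem_ofPred_eq] at hk
      linarith
    · rw [indicator_of_notMem hk]
      exact smoothBall_nonneg _ _ hδ _
  have hlo : J * ((t - t⁻¹) ^ (d + 1) * V + dualSum (t - t⁻¹) t (dual X)) ≤ latticeCount X t := by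
    rw [← tsum_smoothBall hd hd2 (by linarith) ht X, ← hN.tsum_eq]
    refine (summable_smoothBall hδ X).tsum_le_tsum (fun k => ?_) hN.summable
    by_cases hk : k ∈ {k : Fin (d + 1) → ℤ | ‖act X (intVec k)‖ ≤ t}
    · rw [indicator_of_mem hk]
      exact smoothBall_le_one _ _ hδ _
    · rw [indicator_of_notMem hk, smoothBall_eq_zero _ hδ]
      rw [mem_ofPred_eq, not_le] at hk
      linarith
  have hpow : (t + t⁻¹) ^ (d + 1) ≤ t ^ (d + 1) + 7 * t ^ (d - 1) ∧
      t ^ (d + 1) - 7 * t ^ (d - 1) ≤ (t - t⁻¹) ^ (d + 1) := by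
    have e : t * t⁻¹ = 1 := mul_inv_cancel₀ ht0.ne'
    have hd12 : d = 1 ∨ d = 2 := by omega
    rcases hd12 with rfl | rfl
    · constructor <;> norm_num <;> nlinarith
    · have e2 : t ^ 2 * t⁻¹ = t := by rw [pow_two, mul_assoc, e, mul_one]
      have e3 : t * t⁻¹ ^ 2 = t⁻¹ := by rw [pow_two, ← mul_assoc, e, one_mul]
      have e4 : t⁻¹ ^ 3 ≤ 1 := pow_le_one₀ hδ.le hδ1
      have e5 : 0 ≤ t⁻¹ ^ 3 := by positivity
      constructor
      · have : (t + t⁻¹) ^ 3 = t ^ 3 + 3 * (t ^ 2 * t⁻¹) + 3 * (t * t⁻¹ ^ 2) + t⁻¹ ^ 3 := by ring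
        norm_num
        rw [this, e2, e3]
        linarith
      · have : (t - t⁻¹) ^ 3 = t ^ 3 - 3 * (t ^ 2 * t⁻¹) + 3 * (t * t⁻¹ ^ 2) - t⁻¹ ^ 3 := by ring
        norm_num
        rw [this, e2, e3]
        linarith
  have hR : remainderGL X t = latticeCount X t - J * (t ^ (d + 1) * V) := by
    rw [remainderGL, toReal_volume_ellipsoid X ht0]
  rw [hR, abs_le]
  have a1 := neg_abs_le (dualSum (t - t⁻¹) t (dual X))
  have a2 := le_abs_self (dualSum (t + t⁻¹) t (dual X))
  have a3 := abs_nonneg (dualSum (t - t⁻¹) t (dual X))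
  have a4 := abs_nonneg (dualSum (t + t⁻¹) t (dual X))
  have b1 := mul_le_mul_of_nonneg_right hpow.1 hV0
  have b2 := mul_le_mul_of_nonneg_right hpow.2 hV0
  constructor
  · have h1 : t ^ (d + 1) * V - (|dualSum (t + t⁻¹) t (dual X)| +
        |dualSum (t - t⁻¹) t (dual X)| + 7 * V * t ^ (d - 1)) ≤
        (t - t⁻¹) ^ (d + 1) * V + dualSum (t - t⁻¹) t (dual X) := by linarith
    have := mul_le_mul_of_nonneg_left h1 hJ0
    rw [mul_sub] at this
    linarith
  · have h1 : (t + t⁻¹) ^ (d + 1) * V + dualSum (t + t⁻¹) t (dual X) ≤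
        t ^ (d + 1) * V + (|dualSum (t + t⁻¹) t (dual X)| +
        |dualSum (t - t⁻¹) t (dual X)| + 7 * V * t ^ (d - 1)) := by linarith
    have := mul_le_mul_of_nonneg_left h1 hJ0
    rw [mul_add J (t ^ (d + 1) * V)] at this
    linarith

end Poisson

/-! ### The mean square of the dual sums -/

section MeanSquare

variable {d : ℕ}

theorem intVec_add {n : ℕ} (k l : Fin n → ℤ) : intVec (k + l) = intVec k + intVec l := by
  ext i
  simp [intVec_apply]

theorem intVec_sub {n : ℕ} (k l : Fin n → ℤ) : intVec (k - l) = intVec k - intVec l := by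
  ext i
  simp [intVec_apply]

theorem intVec_ne_zero {n : ℕ} {k : Fin n → ℤ} (hk : k ≠ 0) : intVec k ≠ 0 :=
  norm_pos_iff.1 (lt_of_lt_of_le one_pos (one_le_norm_intVec hk))

theorem gain_nonneg {n : ℕ} {τ : ℝ} (hτ : 0 < τ) (v : Fin n → ℤ) : 0 ≤ gain τ v := by
  rw [gain]
  split_ifs <;> positivity

variable {E : EuclideanSpace ℝ (Fin (d + 1)) → ℝ} {C₀ : ℝ}
  {Y₀ : GL (Fin (d + 1)) ℝ} {f : EuclideanSpace ℝ (Fin (d + 1) × Fin (d + 1)) → ℝ}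
  {ρ m M : ℝ} (μ : Measure (GL (Fin (d + 1)) ℝ))

/-- The trivial bound at `k = ±l` and the bound by averaging elsewhere, in one formula. -/
theorem abs_integral_correlation_le_gain [μ.IsMulRightInvariant] [IsFiniteMeasureOnCompacts μ]
    (hf : IsLocalWeight Y₀ f ρ m M) (hE : IsCutoff E C₀) : ∃ C : ℝ, 0 ≤ C ∧
    ∀ (τ δ : ℝ) (k l : Fin (d + 1) → ℤ), 0 < τ → 0 < δ → k ≠ 0 → l ≠ 0 →
      |∫ Y, f (matVec Y.1) * (ballCoeff E τ δ (act Y (intVec k)) *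
        ballCoeff E τ δ (act Y (intVec l))) ∂μ| ≤
        C * τ ^ d * (coeffSize (d + 1) δ ‖intVec k‖ * coeffSize (d + 1) δ ‖intVec l‖ *
          (gain τ (k - l) + gain τ (k + l))) := by
  obtain ⟨C₁, hC₁, h₁⟩ := abs_integral_correlation_le μ hf hE
  obtain ⟨C₂, hC₂, h₂⟩ := abs_integral_correlation_le_div μ hf hE
  refine ⟨C₁ + C₂, by positivity, fun τ δ k l hτ hδ hk hl => ?_⟩
  have hsk := coeffSize_nonneg (d + 1) hδ (norm_nonneg (intVec k))
  have hsl := coeffSize_nonneg (d + 1) hδ (norm_nonneg (intVec l))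
  have hg1 := gain_nonneg hτ (k - l)
  have hg2 := gain_nonneg hτ (k + l)
  by_cases hkl : k = l ∨ k = -l
  · have hg : 1 ≤ gain τ (k - l) + gain τ (k + l) := by
      rcases hkl with rfl | rfl
      · have : gain τ (k - k) = 1 := by rw [gain, if_pos (sub_self k)]
        linarith
      · have : gain τ (-l + l) = 1 := by rw [gain, if_pos (neg_add_cancel l)]
        linarith
    refine (h₁ τ δ _ _ hτ hδ (intVec_ne_zero hk) (intVec_ne_zero hl)).trans ?_
    calc C₁ * (τ ^ d * (coeffSize (d + 1) δ ‖intVec k‖ * coeffSize (d + 1) δ ‖intVec l‖))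
        ≤ (C₁ + C₂) * (τ ^ d * (coeffSize (d + 1) δ ‖intVec k‖ *
          coeffSize (d + 1) δ ‖intVec l‖ * 1)) := by
          rw [mul_one]; gcongr; linarith
      _ ≤ (C₁ + C₂) * (τ ^ d * (coeffSize (d + 1) δ ‖intVec k‖ *
          coeffSize (d + 1) δ ‖intVec l‖ * (gain τ (k - l) + gain τ (k + l)))) := by gcongr
      _ = _ := by ring
  · push Not at hkl
    obtain ⟨hne, hne'⟩ := hkl
    have i1 : intVec k ≠ intVec l := fun h => hne (intVec_injective h)
    have i2 : intVec k ≠ -intVec l := fun h => by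
      refine intVec_ne_zero (k := k + l) (fun h' => hne' (eq_neg_of_add_eq_zero_left h')) ?_
      rw [intVec_add, h, neg_add_cancel]
    have e1 : gain τ (k - l) = 1 / (τ * ‖intVec k - intVec l‖) := by
      rw [gain, if_neg (sub_ne_zero.2 hne), intVec_sub]
    have e2 : gain τ (k + l) = 1 / (τ * ‖intVec k + intVec l‖) := by
      rw [gain, if_neg (fun h' => hne' (eq_neg_of_add_eq_zero_left h')), intVec_add]
    refine (h₂ τ δ _ _ hτ hδ (intVec_ne_zero hk) (intVec_ne_zero hl) i1 i2).trans ?_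
    have e3 : ∀ x : ℝ, 1 / (τ * x) = 1 / τ * (1 / x) := fun x => by rw [one_div_mul_one_div]
    calc _ = C₂ * (τ ^ d * (coeffSize (d + 1) δ ‖intVec k‖ *
          coeffSize (d + 1) δ ‖intVec l‖ * (gain τ (k - l) + gain τ (k + l)))) := by
          rw [e1, e2, e3, e3]; ring
      _ ≤ (C₁ + C₂) * (τ ^ d * (coeffSize (d + 1) δ ‖intVec k‖ *
          coeffSize (d + 1) δ ‖intVec l‖ * (gain τ (k - l) + gain τ (k + l)))) := by
          gcongr; linarith
      _ = _ := by ring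

theorem integrable_weight_mul [IsFiniteMeasureOnCompacts μ] (hf : IsLocalWeight Y₀ f ρ m M)
    {G : GL (Fin (d + 1)) ℝ → ℝ} (hG : Continuous G) :
    Integrable (fun Y => f (matVec Y.1) * G Y) μ := by
  refine Continuous.integrable_of_hasCompactSupport
    ((hf.contDiff.continuous.comp (continuous_matVec.comp (continuous_val_GL _))).mul hG) ?_
  refine HasCompactSupport.intro hf.isCompact fun Y hY => ?_
  by_contra hne
  have h1 := hf.support _ (left_ne_zero_of_mul hne)
  exact hY (h1.trans (by linarith [hf.pos_rho]))

/-- The mean square of a finite part of the dual sum. -/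
theorem lintegral_sum_sq_le (hd2 : d ≤ 2) [μ.IsMulRightInvariant] [IsFiniteMeasureOnCompacts μ]
    (hf : IsLocalWeight Y₀ f ρ m M) (hE : IsCutoff E C₀) : ∃ C : ℝ, 0 ≤ C ∧
    ∀ (t τ : ℝ), 2 ≤ t → t / 2 ≤ τ → τ ≤ 2 * t → ∀ T : Finset (Fin (d + 1) → ℤ), 0 ∉ T →
      ∫⁻ Y, ENNReal.ofReal (f (matVec Y.1) *
        (∑ k ∈ T, ballCoeff E τ t⁻¹ (act Y (intVec k))) ^ 2) ∂μ ≤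
      ENNReal.ofReal (C * (t ^ d * Real.log t ^ (2 * (d + 1)))) := by
  obtain ⟨C₁, hC₁, h₁⟩ := abs_integral_correlation_le_gain μ hf hE
  obtain ⟨C₂, hC₂, h₂⟩ := sum_sum_coeffSize_mul_gain_le (n := d + 1) (by omega)
  refine ⟨C₁ * 2 ^ d * C₂, by positivity, fun t τ ht hτ hτ2 T hT => ?_⟩
  have hδ : 0 < t⁻¹ := inv_pos.2 (by linarith)
  have ht0 : 0 < t := by linarith
  have hτ0 : 0 < τ := by linarith
  have hcont : ∀ k, Continuous fun Y : GL (Fin (d + 1)) ℝ =>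
      ballCoeff E τ t⁻¹ (act Y (intVec k)) := fun k =>
    (continuous_ballCoeff hE τ t⁻¹).comp (continuous_act _ _)
  have hci : Integrable (fun Y => f (matVec Y.1) *
      (∑ k ∈ T, ballCoeff E τ t⁻¹ (act Y (intVec k))) ^ 2) μ :=
    integrable_weight_mul μ hf ((continuous_finsetSum T fun k _ => hcont k).pow 2)
  rw [← ofReal_integral_eq_lintegral_ofReal hci
    (ae_of_all _ fun Y => mul_nonneg (hf.nonneg _) (sq_nonneg _))]
  refine ENNReal.ofReal_le_ofReal ?_
  have hexp : ∀ Y : GL (Fin (d + 1)) ℝ, f (matVec Y.1) *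
      (∑ k ∈ T, ballCoeff E τ t⁻¹ (act Y (intVec k))) ^ 2 = ∑ k ∈ T, ∑ l ∈ T, f (matVec Y.1) *
        (ballCoeff E τ t⁻¹ (act Y (intVec k)) * ballCoeff E τ t⁻¹ (act Y (intVec l))) := by
    intro Y
    simp_rw [pow_two, Finset.sum_mul_sum, Finset.mul_sum]
  have hint : ∀ k l, Integrable (fun Y : GL (Fin (d + 1)) ℝ => f (matVec Y.1) *
      (ballCoeff E τ t⁻¹ (act Y (intVec k)) * ballCoeff E τ t⁻¹ (act Y (intVec l)))) μ :=
    fun k l => integrable_weight_mul μ hf ((hcont k).mul (hcont l))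
  simp_rw [hexp]
  rw [integral_finsetSum T fun k _ => integrable_finsetSum T fun l _ => hint k l]
  simp_rw [integral_finsetSum T fun l _ => hint _ l]
  have hk0 : ∀ k ∈ T, k ≠ 0 := fun k hk h => hT (h ▸ hk)
  calc _ ≤ ∑ k ∈ T, ∑ l ∈ T, C₁ * τ ^ d * (coeffSize (d + 1) t⁻¹ ‖intVec k‖ *
          coeffSize (d + 1) t⁻¹ ‖intVec l‖ * (gain τ (k - l) + gain τ (k + l))) :=
        Finset.sum_le_sum fun k hk => Finset.sum_le_sum fun l hl =>
          (le_abs_self _).trans (h₁ τ t⁻¹ k l hτ0 hδ (hk0 k hk) (hk0 l hl))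
    _ = C₁ * τ ^ d * ∑ k ∈ T, ∑ l ∈ T, coeffSize (d + 1) t⁻¹ ‖intVec k‖ *
          coeffSize (d + 1) t⁻¹ ‖intVec l‖ * (gain τ (k - l) + gain τ (k + l)) := by
        simp_rw [Finset.mul_sum]
    _ ≤ C₁ * (2 * t) ^ d * (C₂ * Real.log t ^ (2 * (d + 1))) :=
        mul_le_mul (by gcongr) (h₂ t τ ht hτ T hT)
          (Finset.sum_nonneg fun k _ => Finset.sum_nonneg fun l _ => by
            have hsk := coeffSize_nonneg (d + 1) hδ (norm_nonneg (intVec k))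
            have hsl := coeffSize_nonneg (d + 1) hδ (norm_nonneg (intVec l))
            have hg1 := gain_nonneg hτ0 (k - l)
            have hg2 := gain_nonneg hτ0 (k + l)
            positivity) (by positivity)
    _ = _ := by ring

theorem tendsto_sum_erase_dualSum (hd2 : d ≤ 2) {τ t : ℝ} (hτ : 0 < τ) (ht : 2 ≤ t)
    (Y : GL (Fin (d + 1)) ℝ) :
    Tendsto (fun T : Finset (Fin (d + 1) → ℤ) => ∑ k ∈ T.erase 0,
      ballCoeff (mollifierFourier (d + 1)) τ t⁻¹ (act Y (intVec k))) atTop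
      (𝓝 (dualSum τ t Y)) := by
  have h := (summable_ballCoeff hd2 hτ ht Y).hasSum
  rw [HasSum, SummationFilter.unconditional_filter] at h
  refine h.congr fun T => ?_
  rw [← Finset.sum_erase T (a := 0) (f := fun k => if k = 0 then 0 else
    ballCoeff (mollifierFourier (d + 1)) τ t⁻¹ (act Y (intVec k))) (if_pos rfl)]
  exact Finset.sum_congr rfl fun k hk => if_neg (Finset.ne_of_mem_erase hk)

theorem measurable_sum_ballCoeff (τ t : ℝ) (T : Finset (Fin (d + 1) → ℤ)) :
    Measurable fun Y : GL (Fin (d + 1)) ℝ => ∑ k ∈ T,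
      ballCoeff (mollifierFourier (d + 1)) τ t⁻¹ (act Y (intVec k)) := by
  obtain ⟨C₀, hE⟩ := exists_isCutoff_mollifierFourier (d + 1)
  exact (continuous_finsetSum T fun k _ =>
    (continuous_ballCoeff hE τ t⁻¹).comp (continuous_act _ _)).measurable

theorem measurable_dualSum (hd2 : d ≤ 2) {τ t : ℝ} (hτ : 0 < τ) (ht : 2 ≤ t) :
    Measurable (dualSum (d := d) τ t) :=
  measurable_of_tendsto_metrizable' atTop
    (fun T : Finset (Fin (d + 1) → ℤ) => measurable_sum_ballCoeff τ t (T.erase 0))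
    (tendsto_pi_nhds.2 fun Y => tendsto_sum_erase_dualSum hd2 hτ ht Y)

theorem measurable_weight (hf : IsLocalWeight Y₀ f ρ m M) :
    Measurable fun Y : GL (Fin (d + 1)) ℝ => f (matVec Y.1) :=
  (hf.contDiff.continuous.comp (continuous_matVec.comp (continuous_val_GL _))).measurable

/-- The mean square of the whole dual sum, by Fatou's lemma. -/
theorem lintegral_dualSum_sq_le (hd2 : d ≤ 2) [μ.IsMulRightInvariant]
    [IsFiniteMeasureOnCompacts μ] (hf : IsLocalWeight Y₀ f ρ m M) : ∃ C : ℝ, 0 ≤ C ∧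
    ∀ (t τ : ℝ), 2 ≤ t → t / 2 ≤ τ → τ ≤ 2 * t →
      ∫⁻ Y, ENNReal.ofReal (f (matVec Y.1) * dualSum τ t Y ^ 2) ∂μ ≤
      ENNReal.ofReal (C * (t ^ d * Real.log t ^ (2 * (d + 1)))) := by
  obtain ⟨C₀, hE⟩ := exists_isCutoff_mollifierFourier (d + 1)
  obtain ⟨C, hC0, hC⟩ := lintegral_sum_sq_le μ hd2 hf hE
  refine ⟨C, hC0, fun t τ ht hτ hτ2 => ?_⟩
  have hlim : ∀ Y, Tendsto (fun T : Finset (Fin (d + 1) → ℤ) => ENNReal.ofReal (f (matVec Y.1) *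
      (∑ k ∈ T.erase 0, ballCoeff (mollifierFourier (d + 1)) τ t⁻¹ (act Y (intVec k))) ^ 2)) atTop
      (𝓝 (ENNReal.ofReal (f (matVec Y.1) * dualSum τ t Y ^ 2))) := fun Y =>
    ENNReal.tendsto_ofReal
      (((tendsto_sum_erase_dualSum hd2 (by linarith) ht Y).pow 2).const_mul _)
  calc _ = ∫⁻ Y, liminf (fun T : Finset (Fin (d + 1) → ℤ) => ENNReal.ofReal (f (matVec Y.1) *
      (∑ k ∈ T.erase 0, ballCoeff (mollifierFourier (d + 1)) τ t⁻¹ (act Y (intVec k))) ^ 2))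
        atTop ∂μ := lintegral_congr fun Y => (hlim Y).liminf_eq.symm
    _ ≤ liminf (fun T : Finset (Fin (d + 1) → ℤ) => ∫⁻ Y, ENNReal.ofReal (f (matVec Y.1) *
      (∑ k ∈ T.erase 0, ballCoeff (mollifierFourier (d + 1)) τ t⁻¹ (act Y (intVec k))) ^ 2) ∂μ)
        atTop := lintegral_liminf_le fun T => ENNReal.measurable_ofReal.comp
          ((measurable_weight hf).mul ((measurable_sum_ballCoeff τ t _).pow_const 2))
    _ ≤ _ := liminf_le_of_frequently_le'
        (Frequently.of_forall fun T => hC t τ ht hτ hτ2 _ (Finset.notMem_erase 0 T))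

end MeanSquare

/-! ### The local estimate -/

section Local

variable {d : ℕ}

theorem norm_matVec_transpose {n : ℕ} (A : Matrix (Fin n) (Fin n) ℝ) :
    ‖matVec Aᵀ‖ = ‖matVec A‖ := by
  rw [← sq_eq_sq₀ (norm_nonneg _) (norm_nonneg _), norm_matVec_sq, norm_matVec_sq,
    Finset.sum_comm]
  rfl

/-- A crude bound for the remainder, uniform for `X` in a bounded set. -/
theorem abs_remainderGL_le_of_bounds {n : ℕ} {X : GL (Fin n) ℝ} {t B J : ℝ} (ht : 0 < t)
    (hB : ‖matVec (X⁻¹).1‖ ≤ B) (hJ : |(X⁻¹).1.det| ≤ J) :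
    |remainderGL X t| ≤ {k : Fin n → ℤ | ‖intVec k‖ ≤ B * t}.ncard +
      J * (t ^ n * (volume (unitBall n)).toReal) := by
  have h1 : (latticeCount X t : ℝ) ≤ {k : Fin n → ℤ | ‖intVec k‖ ≤ B * t}.ncard := by
    rw [latticeCount_eq X ht]
    have hsub : {k : Fin n → ℤ | ‖act X (intVec k)‖ ≤ t} ⊆ {k | ‖intVec k‖ ≤ B * t} :=
      fun k hk => (setOf_norm_act_le_subset X hk).trans (mul_le_mul_of_nonneg_right hB ht.le)
    exact_mod_cast ncard_le_ncard hsub (finite_setOf_norm_intVec_le n _)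
  have h0 : (0 : ℝ) ≤ latticeCount X t := Nat.cast_nonneg _
  have h2 : |(X⁻¹).1.det| * (t ^ n * (volume (unitBall n)).toReal) ≤
      J * (t ^ n * (volume (unitBall n)).toReal) := by gcongr
  have h3 : 0 ≤ |(X⁻¹).1.det| * (t ^ n * (volume (unitBall n)).toReal) := by positivity
  rw [remainderGL, toReal_volume_ellipsoid X ht, abs_le]
  constructor <;> linarith

/-- Every matrix has a neighbourhood over which the mean square of the remainder is
`O(t^{n-1} (log t)^{2n})`. -/
theorem exists_local_bound (hd : 0 < d) (hd2 : d ≤ 2) (ν : Measure (GL (Fin (d + 1)) ℝ))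
    [ν.IsHaarMeasure] (X₀ : GL (Fin (d + 1)) ℝ) : ∃ U : Set (GL (Fin (d + 1)) ℝ),
    IsOpen U ∧ X₀ ∈ U ∧ ν U < ∞ ∧ (∀ t : ℝ, 0 < t → ∃ C, ∀ X ∈ U, |remainderGL X t| ≤ C) ∧
    ∃ C : ℝ, 0 ≤ C ∧ ∀ t : ℝ, 2 ≤ t →
      ∫⁻ X in U, ENNReal.ofReal (|remainderGL X t| ^ 2) ∂ν ≤
        ENNReal.ofReal (C * (t ^ (((d + 1 : ℕ) : ℝ) - 1) * Real.log t ^ (2 * (d + 1)))) := by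
  obtain ⟨f, ρ, m, M, hf, hf1⟩ := exists_isLocalWeight (dual X₀)
  obtain ⟨O, hX₀O, hO, hνO⟩ := ν.exists_isOpen_measure_lt_top X₀
  have := isMulRightInvariant_GL ν
  have := isMulRightInvariant_map_dual ν
  have := isFiniteMeasureOnCompacts_map_dual ν
  obtain ⟨C, hC0, hC⟩ := lintegral_dualSum_sq_le (ν.map dual) hd2 hf
  set J := |(X₀⁻¹).1.det| + 1 with hJ
  have hJ0 : 0 ≤ J := by positivity
  let U : Set (GL (Fin (d + 1)) ℝ) := O ∩ ({X | ‖matVec (dual X).1 - matVec (dual X₀).1‖ < ρ / 2} ∩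
    {X | |(X⁻¹).1.det| < J})
  have hcm : Continuous fun X : GL (Fin (d + 1)) ℝ => matVec (dual X).1 :=
    continuous_matVec.comp ((continuous_val_GL _).comp continuous_dual)
  have hUo : IsOpen U := hO.inter ((isOpen_lt (hcm.sub continuous_const).norm
    continuous_const).inter (isOpen_lt (continuous_det_inv _) continuous_const))
  have hνU : ν U < ∞ := (measure_mono inter_subset_left).trans_lt hνO
  refine ⟨U, hUo, ⟨hX₀O, ?_, ?_⟩, hνU, ?_, ?_⟩
  · rw [mem_ofPred_eq, sub_self, norm_zero]
    linarith [hf.pos_rho]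
  · rw [mem_ofPred_eq]
    linarith
  · intro t ht
    refine ⟨_, fun X hX => abs_remainderGL_le_of_bounds ht
      (B := ‖matVec (dual X₀).1‖ + ρ / 2) ?_ hX.2.2.le⟩
    have h1 : ‖matVec (X⁻¹).1‖ = ‖matVec (dual X).1‖ := (norm_matVec_transpose _).symm
    have h2 := norm_sub_norm_le (matVec (dual X).1) (matVec (dual X₀).1)
    have h3 : ‖matVec (dual X).1 - matVec (dual X₀).1‖ < ρ / 2 := hX.2.1
    rw [h1]
    linarith
  set V := (volume (unitBall (d + 1))).toReal with hV
  refine ⟨3 * J ^ 2 * (C + C + 49 * V ^ 2 * 2 ^ (2 * (d + 1)) * ν.real U), by positivity,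
    fun t ht => ?_⟩
  have ht0 : 0 < t := by linarith
  have hδ : 0 < t⁻¹ := inv_pos.2 ht0
  have hδ1 : t⁻¹ ≤ 1 := inv_le_one_of_one_le₀ (by linarith)
  have hlog1 : 1 ≤ 2 * Real.log t := by
    have := Real.log_two_gt_d9
    have h2 : Real.log 2 ≤ Real.log t := Real.log_le_log (by norm_num) ht
    linarith
  have hlog0 : 0 ≤ Real.log t := by linarith
  set L := t ^ d * Real.log t ^ (2 * (d + 1)) with hL
  have hL0 : 0 ≤ L := by positivity
  have hrp : t ^ (((d + 1 : ℕ) : ℝ) - 1) = t ^ d := by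
    rw [← Real.rpow_natCast]
    congr 1
    push_cast
    ring
  let g : ℝ → GL (Fin (d + 1)) ℝ → ℝ≥0∞ := fun τ Y =>
    ENNReal.ofReal (f (matVec Y.1) * dualSum τ t Y ^ 2)
  have hgm : ∀ τ, 0 < τ → Measurable (g τ) := fun τ hτ =>
    ENNReal.measurable_ofReal.comp
      ((measurable_weight hf).mul ((measurable_dualSum hd2 hτ ht).pow_const 2))
  have hdm : Measurable (dual (n := d + 1)) := continuous_dual.measurable
  have hgi : ∀ τ, t / 2 ≤ τ → τ ≤ 2 * t → ∫⁻ X in U, g τ (dual X) ∂ν ≤ ENNReal.ofReal (C * L) := by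
    intro τ h1 h2
    refine (setLIntegral_le_lintegral _ _).trans ?_
    rw [← lintegral_map (hgm τ (by linarith)) hdm]
    exact hC t τ ht h1 h2
  have hpt : ∀ X ∈ U, ENNReal.ofReal (|remainderGL X t| ^ 2) ≤ ENNReal.ofReal (3 * J ^ 2) *
      (g (t + t⁻¹) (dual X) + g (t - t⁻¹) (dual X) + ENNReal.ofReal (49 * V ^ 2 * t ^ d)) := by
    intro X hX
    have hfX : f (matVec (dual X).1) = 1 := hf1 _ (le_of_lt hX.2.1)
    simp only [g, hfX, one_mul]
    rw [← ENNReal.ofReal_add (by positivity) (by positivity),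
      ← ENNReal.ofReal_add (by positivity) (by positivity), ← ENNReal.ofReal_mul (by positivity)]
    refine ENNReal.ofReal_le_ofReal ?_
    have hp : (t ^ (d - 1)) ^ 2 ≤ t ^ d := by
      rw [← pow_mul]
      exact pow_le_pow_right₀ (by linarith) (by omega)
    have h1 := abs_remainderGL_le hd hd2 ht X
    set a := |dualSum (t + t⁻¹) t (dual X)| with ha
    set b := |dualSum (t - t⁻¹) t (dual X)| with hb
    rw [← sq_abs (dualSum (t + t⁻¹) t (dual X)), ← sq_abs (dualSum (t - t⁻¹) t (dual X)),
      ← ha, ← hb]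
    have h2 : |remainderGL X t| ≤ J * (a + b + 7 * V * t ^ (d - 1)) :=
      h1.trans (mul_le_mul_of_nonneg_right (le_of_lt hX.2.2) (by positivity))
    calc |remainderGL X t| ^ 2 ≤ (J * (a + b + 7 * V * t ^ (d - 1))) ^ 2 := by gcongr
      _ = J ^ 2 * (a + b + 7 * V * t ^ (d - 1)) ^ 2 := by ring
      _ ≤ J ^ 2 * (3 * (a ^ 2 + b ^ 2 + (7 * V * t ^ (d - 1)) ^ 2)) := by
          gcongr
          nlinarith [sq_nonneg (a - b), sq_nonneg (a - 7 * V * t ^ (d - 1)),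
            sq_nonneg (b - 7 * V * t ^ (d - 1))]
      _ = 3 * J ^ 2 * (a ^ 2 + b ^ 2 + 49 * V ^ 2 * (t ^ (d - 1)) ^ 2) := by ring
      _ ≤ _ := by gcongr
  have hpl : 0 < t + t⁻¹ := by linarith
  have hmi : 0 < t - t⁻¹ := by linarith
  have hLt : 49 * V ^ 2 * t ^ d ≤ 49 * V ^ 2 * 2 ^ (2 * (d + 1)) * L := by
    calc 49 * V ^ 2 * t ^ d = 49 * V ^ 2 * (t ^ d * 1 ^ (2 * (d + 1))) := by
          rw [one_pow, mul_one]
      _ ≤ 49 * V ^ 2 * (t ^ d * (2 * Real.log t) ^ (2 * (d + 1))) := by gcongr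
      _ = _ := by rw [hL, mul_pow]; ring
  calc _ ≤ ∫⁻ X in U, ENNReal.ofReal (3 * J ^ 2) * (g (t + t⁻¹) (dual X) + g (t - t⁻¹) (dual X) +
        ENNReal.ofReal (49 * V ^ 2 * t ^ d)) ∂ν := setLIntegral_mono' hUo.measurableSet hpt
    _ = ENNReal.ofReal (3 * J ^ 2) * (∫⁻ X in U, g (t + t⁻¹) (dual X) ∂ν +
        ∫⁻ X in U, g (t - t⁻¹) (dual X) ∂ν + ENNReal.ofReal (49 * V ^ 2 * t ^ d) * ν U) := by
        rw [lintegral_const_mul' _ _ ENNReal.ofReal_ne_top,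
          lintegral_add_right _ measurable_const, setLIntegral_const,
          lintegral_add_left (f := fun X => g (t + t⁻¹) (dual X)) ((hgm _ hpl).comp hdm)]
    _ ≤ ENNReal.ofReal (3 * J ^ 2) * (ENNReal.ofReal (C * L) + ENNReal.ofReal (C * L) +
        ENNReal.ofReal (49 * V ^ 2 * 2 ^ (2 * (d + 1)) * L) * ENNReal.ofReal (ν.real U)) := by
        rw [ofReal_measureReal hνU.ne]
        refine mul_le_mul_right (add_le_add (add_le_add (hgi _ (by linarith) (by linarith))
          (hgi _ (by linarith) (by linarith))) ?_) _
        exact mul_le_mul_left (ENNReal.ofReal_le_ofReal hLt) _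
    _ = _ := by
        rw [hrp, ← hL, ← ENNReal.ofReal_mul (by positivity),
          ← ENNReal.ofReal_add (by positivity) (by positivity),
          ← ENNReal.ofReal_add (by positivity) (by positivity),
          ← ENNReal.ofReal_mul (by positivity)]
        congr 1
        ring

end Local

end RandomLattice


theorem theorem1 (n : ℕ) (hn : n = 2 ∨ n = 3)
    (ν : MeasureTheory.Measure (Matrix.GeneralLinearGroup (Fin n) ℝ)) [ν.IsHaarMeasure]
    (L₀ : Set (RandomLattice.LatticeSpace n)) (hL₀ : IsCompact L₀) :
    (∀ t : ℝ, 0 < t → MeasureTheory.IntegrableOn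
        (fun X => |RandomLattice.remainder t X| ^ 2) L₀ (RandomLattice.inducedMeasure ν)) ∧
    ∃ m : ℕ, 0 < m ∧
      (fun t : ℝ => Real.sqrt
        (∫ X in L₀, |RandomLattice.remainder t X| ^ 2 ∂(RandomLattice.inducedMeasure ν)))
      =O[Filter.atTop]
      (fun t : ℝ => t ^ (((n : ℝ) - 1) / 2) * (Real.log t) ^ m) := by
  obtain ⟨d, rfl⟩ : ∃ d, n = d + 1 := ⟨n - 1, by omega⟩
  exact RandomLattice.meanSquare_of_local (by omega) ν
    (fun X₀ => RandomLattice.exists_local_bound (by omega) (by omega) ν X₀) L₀ hL₀
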